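/- **Setting.** Consider $x_{t+1}=Ax_t+Bu_t$ in $\mathbb R^{d_x}$ with $B\ne 0$, constraints $x_t\in\mathcal X$, $u_t\in\mathcal U$, and stage cost $\ell(x,u)=x^\top Qx+u^\top Ru$, $Q\succeq 0$, $R\succ 0$. The sets $\mathcal X,\mathcal U$ are polyhedra containing the origin and $\mathcal U$ is bounded; $B_u:=\sup_{u\in\mathcal U}\|u\|$. All vector norms are Euclidean and all matrix norms are the induced operator norms. $P$ is the unique positive definite solution of the discrete algebraic Riccati equation $P=A^\top PA-A^\top PB(R+B^\top PB)^{-1}B^\top PA+Q$; $K=-(R+B^\top PB)^{-1}B^\top PA$, $A_K=A+BK$, $\pi^{\rm lqr}(x)=Kx$. Fix $\rho\in(0,1)$ and $\sigma>0$ with $\|A_K^k\|\le\sigma\rho^k$ for all $k\ge 0$, and put $\kappa=\sigma/(1-\rho)$. Fix a horizon $N\ge1$ and $V_N(x,u)=\sum_{k<N}\ell(x_k,u_k)+x_N^\top Px_N$ (with $x_0=x$). For $\varepsilon>0$ let $\mathcal W$ be the closed ball of radius $\varepsilon$ about $0$, and let $\mathcal Z\subseteq\{\|x\|\le\kappa\varepsilon\}$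 be a disturbance invariant set, i.e. a neighbourhood of $0$ with $A_K\mathcal Z+\mathcal W\subseteq\mathcal Z$. Put $\bar{\mathcal X}=\mathcal X\ominus\mathcal Z$, $\bar{\mathcal U}=\mathcal U\ominus K\mathcal Z$, where $S\ominus Y=\{s\in S: s+Y\subseteq S\}$. Let $\bar{\mathcal O}_\infty$ be the maximal set $\mathcal O\subseteq\bar{\mathcal X}$ such that from every point of $\mathcal O$ the LQR loop stays in $\mathcal O$ and its inputs stay in $\bar{\mathcal U}$. The tightened-constraint MPC problem at $x$ is to minimize $V_N(x,u)$ subject to $x_k\in\bar{\mathcal X}$, $u_k\in\bar{\mathcal U}$ $(k<N)$, $x_N\in\bar{\mathcal O}_\infty$; $\bar{\mathcal X}_0$ is the set of $x$ for which it is feasible, and $\bar\pi(x)$, $x\in\bar{\mathcal X}_0$, is the first input of its optimal solution. The robust MPC problem at $x\in(\bar{\mathcal X}_0\oplus\mathcal Z)\cap\mathcal X$ minimizes $V_N(\bar x_0,u)$ over $(\bar x_0,u)$ under the same constraints (from $\bar x_0$) and $x\in\bar x_0+\mathcal Z$; the robust MPC controller is $\pi^{\rm rmpc}(x)=\bar u_0(x)+K(x-\bar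 x_0(x))$ for an optimal solution $(\bar x_0(x),\bar u(x))$. It is extended to the other states in any way. **Training (Forward-Switch).** Let $\mathcal D$ be a probability distribution of initial states with $x_0\in\bar{\mathcal X}_0$ and $\|x_0\|\le b$ almost surely. Let $\Pi$ be a finite class of measurable controllers containing $\pi^{\rm rmpc}$, each with $\pi(\mathcal X)\subseteq\mathcal U$. Let $T,n,\ell$ be natural numbers. In stage $t=0,1,\dots$ one draws $n_t=\lceil c\,n\,t\lceil\ln^2(t+1)\rceil+n\rceil$ fresh i.i.d. initial states from $\mathcal D$, with $c=\sum_{t\ge1}1/(t\ln^2(t+1))$, runs them to time $t$ with the controllers $\hat\pi_0,\dots,\hat\pi_{t-1}$ learned so far, and lets $\hat\pi_t\in\Pi$ be a minimizer over $\Pi$ of the empirical mean of $\|\pi^{\rm rmpc}(\hat x_t^{(i)})-\pi(\hat x_t^{(i)})\|$ (ties broken measurably, without looking at later samples). After stage $t-1$ one draws $\ell$ fresh i.i.d. initial states and runs them to time $t$ with $\hat\pi_{0:t-1}$; $\hat\tau_\infty$ is the first $t\ge1$ at which all $\ell$ of these states are in $\bar{\mathcal O}_\infty$, or $T$ if this does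 not happen before $T$, and training stops there. The output is $\tilde\pi_t=\hat\pi_t$ for $t<\hat\tau_\infty$ and $\tilde\pi_t=\pi^{\rm lqr}$ for $\hat\tau_\infty\le t\le T-1$. Let $\hat x_t$ be the state at time $t$ under $\hat\pi$ from $x_0$, and let $\tilde J_T(x_0)$, $\bar J_T(x_0)$ be the $T$-step costs $\sum_{t<T}\ell(x_t,u_t)$ under $\tilde\pi$ and under $\bar\pi$. Let $\tau^\star_\infty\ge1$ be a time such that for $\mathcal D$-almost every $x_0$ and all $w_0,w_1,\ldots\in\mathcal W$ the trajectory $x_{t+1}=Ax_t+B\pi^{\rm rmpc}(x_t)+w_t$ satisfies $x_{\tau^\star_\infty}\in\bar{\mathcal O}_\infty$. **Theorem.** There is a constant $C>0$, depending only on $(A,B,Q,R,\mathcal X,\mathcal U,N)$, $(\rho,\sigma)$ and $b$, such that for all $\varepsilon,\delta\in(0,1)$ and all $\mathcal Z,\mathcal D,\Pi,\tau^\star_\infty,T,n,\ell$ as above with $$\ell\ge\frac{10\ln(T/\delta)}{\delta},\qquad n\ge\frac{14\,\ell\,\|B\|B_u\ln(2T\ell|\Pi|/\delta)}{\varepsilon\delta},$$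 the following holds. Let $\bar{\mathcal E}$ be the event of the training process that $\hat\tau_\infty\le\tau^\star_\infty$ and $$\Pr[\hat x_{\hat\tau_\infty}\in\bar{\mathcal O}_\infty\mid\hat\tau_\infty,\hat\pi]\ge1-\delta,\qquad \Pr\bigl[\forall t<\hat\tau_\infty:\ \|\pi^{\rm rmpc}(\hat x_t)-\hat\pi_t(\hat x_t)\|\le\varepsilon/\|B\|\ \big|\ \hat\tau_\infty,\hat\pi\bigr]\ge1-\delta,$$ the probabilities being over $x_0\sim\mathcal D$. If $T\ge\tau^\star_\infty$, then $\bar{\mathcal E}$ has probability at least $1-3\delta$. For every $T$, on $\bar{\mathcal E}$ and for every $x_0\in\bar{\mathcal X}_0$ with $\|x_0\|\le b$ for which $\hat x_{\hat\tau_\infty}\in\bar{\mathcal O}_\infty$ and $\|\pi^{\rm rmpc}(\hat x_t)-\hat\pi_t(\hat x_t)\|\le\varepsilon/\|B\|$ for all $t<\hat\tau_\infty$, $$\tilde J_T(x_0)-\bar J_T(x_0)\le C\,\tau^\star_\infty\,\varepsilon .$$ -/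

import Mathlib

open MeasureTheory ProbabilityTheory Metric Topology
open scoped Pointwise

/-- `ℝᵈ` with the Euclidean norm. -/
abbrev Vec (d : ℕ) : Type := EuclideanSpace ℝ (Fin d)

/-- The linear map `x ↦ M x` attached to a matrix. -/
noncomputable def mv {m n : ℕ} (M : Matrix (Fin m) (Fin n) ℝ) (x : Vec n) : Vec m :=
  Matrix.toEuclideanLin M x

/-- The operator norm of a matrix with respect to the Euclidean norms. -/
noncomputable def opNorm {m n : ℕ} (M : Matrix (Fin m) (Fin n) ℝ) : ℝ :=
  ‖(Matrix.toEuclideanLin M).toContinuousLinearMap‖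

/-- The quadratic form `xᵀ M x`. -/
noncomputable def quadForm {n : ℕ} (M : Matrix (Fin n) (Fin n) ℝ) (x : Vec n) : ℝ :=
  inner ℝ x (mv M x)

/-- `X ⊖ Y = {x ∈ X | x + Y ⊆ X}`. -/
def pontryaginDiff {n : ℕ} (X Y : Set (Vec n)) : Set (Vec n) :=
  {x | x ∈ X ∧ ∀ y ∈ Y, x + y ∈ X}

/-- A finite intersection of closed half-spaces. -/
def IsPolyhedron {n : ℕ} (X : Set (Vec n)) : Prop :=
  ∃ (m : ℕ) (a : Fin m → Vec n) (b : Fin m → ℝ), X = {x | ∀ i, inner ℝ (a i) x ≤ b i}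

/-- `P` solves the discrete algebraic Riccati equation
`P = Aᵀ P A - Aᵀ P B (R + Bᵀ P B)⁻¹ Bᵀ P A + Q`. -/
def SolvesDARE {dx du : ℕ} (A : Matrix (Fin dx) (Fin dx) ℝ) (B : Matrix (Fin dx) (Fin du) ℝ)
    (Q : Matrix (Fin dx) (Fin dx) ℝ) (R : Matrix (Fin du) (Fin du) ℝ)
    (P : Matrix (Fin dx) (Fin dx) ℝ) : Prop :=
  P = A.transpose * P * A
    - A.transpose * P * B * (R + B.transpose * P * B)⁻¹ * B.transpose * P * A + Q

/-- The data of a constrained linear-quadratic control problem: the dynamics `x⁺ = A x + B u`, the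
stage cost `xᵀ Q x + uᵀ R u`, the LQR cost matrix `P`, the MPC horizon `N`, and the constraint sets
`X` (states) and `U` (inputs). -/
structure ControlSystem (dx du : ℕ) where
  A : Matrix (Fin dx) (Fin dx) ℝ
  B : Matrix (Fin dx) (Fin du) ℝ
  Q : Matrix (Fin dx) (Fin dx) ℝ
  R : Matrix (Fin du) (Fin du) ℝ
  P : Matrix (Fin dx) (Fin dx) ℝ
  N : ℕ
  X : Set (Vec dx)
  U : Set (Vec du)

namespace ControlSystem

variable {dx du : ℕ} (S : ControlSystem dx du)

/-- The standing assumptions on the system. -/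
structure Standing : Prop where
  Q_posSemidef : S.Q.PosSemidef
  R_posDef : S.R.PosDef
  P_posDef : S.P.PosDef
  P_dare : SolvesDARE S.A S.B S.Q S.R S.P
  P_unique : ∀ P' : Matrix (Fin dx) (Fin dx) ℝ,
    P'.PosDef → SolvesDARE S.A S.B S.Q S.R P' → P' = S.P
  B_ne_zero : S.B ≠ 0
  N_pos : 0 < S.N
  X_polyhedron : IsPolyhedron S.X
  U_polyhedron : IsPolyhedron S.U
  zero_mem_X : (0 : Vec dx) ∈ S.X
  zero_mem_U : (0 : Vec du) ∈ S.U
  U_bounded : Bornology.IsBounded S.U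

/-- One step of the dynamics. -/
noncomputable def step (x : Vec dx) (u : Vec du) : Vec dx := mv S.A x + mv S.B u

/-- The stage cost `ℓ(x, u) = xᵀ Q x + uᵀ R u`. -/
noncomputable def stageCost (x : Vec dx) (u : Vec du) : ℝ := quadForm S.Q x + quadForm S.R u

/-- The LQR gain `K = -(R + Bᵀ P B)⁻¹ Bᵀ P A`. -/
noncomputable def K : Matrix (Fin du) (Fin dx) ℝ :=
  -((S.R + S.B.transpose * S.P * S.B)⁻¹ * S.B.transpose * S.P * S.A)

/-- The closed-loop matrix `A + B K`. -/
noncomputable def AK : Matrix (Fin dx) (Fin dx) ℝ := S.A + S.B * S.K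

/-- The LQR controller. -/
noncomputable def lqr (x : Vec dx) : Vec du := mv S.K x

/-- The largest input norm, `sup_{u ∈ U} ‖u‖`. -/
noncomputable def inputBound : ℝ := sSup ((fun u : Vec du => ‖u‖) '' S.U)

/-- The state at time `t` under the input sequence `u`, from `x`. -/
noncomputable def openLoop (x : Vec dx) (u : ℕ → Vec du) : ℕ → Vec dx
  | 0 => x
  | t + 1 => S.step (openLoop x u t) (u t)

/-- The state at time `t` under the time-varying feedback `π`, from `x`. -/
noncomputable def rollout (π : ℕ → Vec dx → Vec du) (x : Vec dx) : ℕ → Vec dx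
  | 0 => x
  | t + 1 => S.step (rollout π x t) (π t (rollout π x t))

/-- The state at time `t` under the feedback `π` and the additive disturbances `w`, from `x`. -/
noncomputable def disturbed (π : Vec dx → Vec du) (w : ℕ → Vec dx) (x : Vec dx) : ℕ → Vec dx
  | 0 => x
  | t + 1 => S.step (disturbed π w x t) (π (disturbed π w x t)) + w t

/-- The `T`-step cost of the time-varying feedback `π` from `x`. -/
noncomputable def cost (π : ℕ → Vec dx → Vec du) (T : ℕ) (x : Vec dx) : ℝ :=
  ∑ t ∈ Finset.range T, S.stageCost (S.rollout π x t) (π t (S.rollout π x t))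

/-- Positive invariance of `O` under the LQR controller with respect to `(X, U)`. -/
def IsPosInvariant (X : Set (Vec dx)) (U : Set (Vec du)) (O : Set (Vec dx)) : Prop :=
  O ⊆ X ∧ ∀ x ∈ O, ∀ t, S.rollout (fun _ => S.lqr) x t ∈ O ∧
    S.lqr (S.rollout (fun _ => S.lqr) x t) ∈ U

/-- The maximal positively invariant set with respect to `(X, U)`. -/
def maxInvariant (X : Set (Vec dx)) (U : Set (Vec du)) : Set (Vec dx) :=
  ⋃₀ {O | S.IsPosInvariant X U O}

/-- `Z` is a disturbance invariant set for the disturbance set `W`. -/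
def IsDisturbanceInvariant (W Z : Set (Vec dx)) : Prop :=
  Z ∈ 𝓝 (0 : Vec dx) ∧ mv S.AK '' Z + W ⊆ Z

/-- The tightened state constraint set `X ⊖ Z`. -/
def tightX (Z : Set (Vec dx)) : Set (Vec dx) := pontryaginDiff S.X Z

/-- The tightened input constraint set `U ⊖ K Z`. -/
def tightU (Z : Set (Vec dx)) : Set (Vec du) := pontryaginDiff S.U (mv S.K '' Z)

/-- The terminal set of the tightened problem, i.e. the maximal positively invariant set with
respect to the tightened constraints. -/
def tightO (Z : Set (Vec dx)) : Set (Vec dx) := S.maxInvariant (S.tightX Z) (S.tightU Z)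

/-- The states from which, within `k` steps respecting `(X, U)`, one can be steered to `Xf`. -/
def backwardReach (X : Set (Vec dx)) (U : Set (Vec du)) (Xf : Set (Vec dx)) : ℕ → Set (Vec dx)
  | 0 => Xf
  | k + 1 => {x | x ∈ X ∧ ∃ u ∈ U, S.step x u ∈ backwardReach X U Xf k}

/-- The feasible domain of the tightened MPC problem. -/
def feasible (Z : Set (Vec dx)) : Set (Vec dx) :=
  S.backwardReach (S.tightX Z) (S.tightU Z) (S.tightO Z) S.N

/-- The finite-horizon objective `V_N(x, u)`, with terminal cost `x_Nᵀ P x_N`. It depends only on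
the first `N` entries of `u`. -/
noncomputable def V (x : Vec dx) (u : ℕ → Vec du) : ℝ :=
  ∑ k ∈ Finset.range S.N, S.stageCost (S.openLoop x u k) (u k)
    + quadForm S.P (S.openLoop x u S.N)

/-- `u` satisfies the constraints of the tightened MPC problem at `x`. -/
def Admissible (Z : Set (Vec dx)) (x : Vec dx) (u : ℕ → Vec du) : Prop :=
  (∀ k < S.N, S.openLoop x u k ∈ S.tightX Z ∧ u k ∈ S.tightU Z) ∧
    S.openLoop x u S.N ∈ S.tightO Z

/-- `u` is an optimal solution of the tightened MPC problem at `x`. -/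
def IsMPCOptimal (Z : Set (Vec dx)) (x : Vec dx) (u : ℕ → Vec du) : Prop :=
  S.Admissible Z x u ∧ ∀ v, S.Admissible Z x v → S.V x u ≤ S.V x v

/-- `π` is the tightened-constraint MPC controller: on the feasible domain it plays the first input
of the optimal solution. -/
def IsTightMPC (Z : Set (Vec dx)) (π : Vec dx → Vec du) : Prop :=
  ∀ x ∈ S.feasible Z, ∃ u, S.IsMPCOptimal Z x u ∧ π x = u 0

/-- `(x₀, u)` is an optimal solution of the robust MPC problem at `x`, in which the initial state
`x₀` of the tightened problem is free subject to `x ∈ x₀ + Z`. -/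
def IsRMPCOptimal (Z : Set (Vec dx)) (x x₀ : Vec dx) (u : ℕ → Vec du) : Prop :=
  (x - x₀ ∈ Z ∧ S.Admissible Z x₀ u) ∧
    ∀ y v, x - y ∈ Z → S.Admissible Z y v → S.V x₀ u ≤ S.V y v

/-- `π` is the robust MPC controller on the domain of the robust MPC problem, extended to the other
states in any way. -/
def IsRobustMPC (Z : Set (Vec dx)) (π : Vec dx → Vec du) : Prop :=
  ∀ x ∈ (S.feasible Z + Z) ∩ S.X, ∃ x₀ u, S.IsRMPCOptimal Z x x₀ u ∧
    π x = u 0 + mv S.K (x - x₀)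

/-- `τ` is a number of steps after which the robust MPC loop, started from almost every initial
state and driven by any disturbances in the ball of radius `ε`, is in the terminal set. -/
def IsReachTime (Z : Set (Vec dx)) (ε : ℝ) (D : Measure (Vec dx)) (expert : Vec dx → Vec du)
    (τ : ℕ) : Prop :=
  1 ≤ τ ∧ ∀ᵐ x ∂D, ∀ w : ℕ → Vec dx, (∀ t, w t ∈ closedBall (0 : Vec dx) ε) →
    S.disturbed expert w x τ ∈ S.tightO Z

end ControlSystem

/-- The constant `c = ∑_{t ≥ 1} 1 / (t ln² (t + 1))` of the sampling schedule. -/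
noncomputable def scheduleConst : ℝ := ∑' t : ℕ, 1 / (((t : ℝ) + 1) * Real.log ((t : ℝ) + 2) ^ 2)

/-- The number of training samples of stage `t`, `n_t = c n t ⌈ln² (t + 1)⌉ + n`, rounded up to an
integer. -/
noncomputable def numSamples (n t : ℕ) : ℕ :=
  ⌈scheduleConst * n * t * (⌈Real.log ((t : ℝ) + 1) ^ 2⌉₊ : ℝ) + n⌉₊

/-- A record of a training run on the sample space `Ω`: `train t i` is the `i`-th initial state
sampled for training in stage `t`, `test t i` the `i`-th initial state sampled (at the end of stage
`t - 1`) for the test of time `t`, and `policy t` the controller learned in stage `t`. -/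
structure TrainingRun (Ω : Type*) (dx du : ℕ) where
  train : ℕ → ℕ → Ω → Vec dx
  test : ℕ → ℕ → Ω → Vec dx
  policy : ℕ → Ω → Vec dx → Vec du

namespace TrainingRun

variable {Ω : Type*} {dx du : ℕ} (r : TrainingRun Ω dx du) (S : ControlSystem dx du)

/-- The learned time-varying controller of the outcome `ω`. -/
def learned (ω : Ω) : ℕ → Vec dx → Vec du := fun t => r.policy t ω

/-- The switching time: the first `t ≥ 1` at which all `ℓ` test trajectories lie in the terminal
set, or `T` if there is none before `T`. -/
noncomputable def switchTime (Z : Set (Vec dx)) (T ℓ : ℕ) (ω : Ω) : ℕ :=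
  sInf ({t | 1 ≤ t ∧ ∀ i < ℓ, S.rollout (r.learned ω) (r.test t i ω) t ∈ S.tightO Z} ∪ {T})

/-- The empirical imitation loss of `π` on the training states of stage `t`. -/
noncomputable def empLoss (expert : Vec dx → Vec du) (n t : ℕ) (ω : Ω) (π : Vec dx → Vec du) : ℝ :=
  (1 / (numSamples n t : ℝ)) * ∑ i ∈ Finset.range (numSamples n t),
    ‖expert (S.rollout (r.learned ω) (r.train t i ω) t)
      - π (S.rollout (r.learned ω) (r.train t i ω) t)‖

/-- The information available when stage `t` selects its controller. -/
abbrev past (t : ℕ) : MeasurableSpace Ω :=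
  ⨆ s : {s : ℕ // s ≤ t}, ⨆ i : ℕ,
    MeasurableSpace.comap (r.train s i) inferInstance ⊔
      MeasurableSpace.comap (r.test s i) inferInstance

/-- `r` is a run of Forward-Switch: all sampled initial states are independent with law `D`, and
each stage reached before the switching time selects an empirical risk minimizer in the class
`models`, ties being broken by a measurable rule that does not look at later samples. -/
structure IsForwardSwitch [MeasurableSpace Ω] (μ : Measure Ω) (D : Measure (Vec dx))
    (Z : Set (Vec dx)) (expert : Vec dx → Vec du) (models : Finset (Vec dx → Vec du))
    (T n ℓ : ℕ) : Prop where
  train_measurable : ∀ t i, Measurable (r.train t i)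
  test_measurable : ∀ t i, Measurable (r.test t i)
  train_law : ∀ t i, μ.map (r.train t i) = D
  test_law : ∀ t i, μ.map (r.test t i) = D
  indep : iIndepFun (fun j : (ℕ × ℕ) ⊕ (ℕ × ℕ) =>
    Sum.elim (fun p : ℕ × ℕ => r.train p.1 p.2) (fun p : ℕ × ℕ => r.test p.1 p.2) j) μ
  erm : ∀ ω, ∀ t < r.switchTime S Z T ℓ ω, r.policy t ω ∈ models ∧
    ∀ π ∈ models, r.empLoss S expert n t ω (r.policy t ω) ≤ r.empLoss S expert n t ω π
  nonanticipating : ∀ t < T, ∀ π ∈ models, MeasurableSet[r.past t] {ω | r.policy t ω = π}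

/-- The output of Forward-Switch: the learned controllers before the switching time and the LQR
controller from then on. -/
noncomputable def output (Z : Set (Vec dx)) (T ℓ : ℕ) (ω : Ω) : ℕ → Vec dx → Vec du :=
  fun t => if t < r.switchTime S Z T ℓ ω then r.policy t ω else S.lqr

/-- The initial states from which the learned trajectory is in the terminal set at the switching
time. -/
def reachEvent (Z : Set (Vec dx)) (T ℓ : ℕ) (ω : Ω) : Set (Vec dx) :=
  {x | S.rollout (r.learned ω) x (r.switchTime S Z T ℓ ω) ∈ S.tightO Z}

/-- The initial states along whose learned trajectory, up to the switching time, the learned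
controller is `ε / ‖B‖`-close to the expert. -/
def closeEvent (Z : Set (Vec dx)) (ε : ℝ) (expert : Vec dx → Vec du) (T ℓ : ℕ) (ω : Ω) :
    Set (Vec dx) :=
  {x | ∀ t < r.switchTime S Z T ℓ ω,
    ‖expert (S.rollout (r.learned ω) x t) - r.policy t ω (S.rollout (r.learned ω) x t)‖
      ≤ ε / opNorm S.B}

/-- The training event: the switching time is at most `τ`, and each of the two events of the
initial state has conditional probability at least `1 - δ` given the outcome of the training. -/
def goodEvent (D : Measure (Vec dx)) (Z : Set (Vec dx)) (ε δ : ℝ) (expert : Vec dx → Vec du)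
    (T ℓ τ : ℕ) : Set Ω :=
  {ω | r.switchTime S Z T ℓ ω ≤ τ ∧
    ENNReal.ofReal (1 - δ) ≤ D (r.reachEvent S Z T ℓ ω) ∧
    ENNReal.ofReal (1 - δ) ≤ D (r.closeEvent S Z ε expert T ℓ ω)}

end TrainingRun

/-! The proof joins a deterministic regret bound (`exists_regret_bound`) to a probability bound for
the training event (`measure_goodEvent`).

Deterministic part. An imitation error of size ε/‖B‖ acts as a disturbance in the ball of radius ε.
Tube MPC therefore keeps the learned loop feasible, within κε of a nominal state whose optimal value
never increases, so all quantities are bounded uniformly in `Z`. The robust MPC input is the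
tightened MPC input at the nominal state plus `K` times the tube error. If tightened MPC is
Lipschitz with a constant L independent of ε, the learned and reference inputs thus differ by at
most L‖x - y‖ + cε.

This uniformity is the main point (`exists_lipschitz_fiberMin`, `exists_lipschitz_tightMPC`). MPC is
a parametric strongly convex quadratic program. Along a segment of parameters its minimizer is
continuous, and it is Lipschitz on each set of parameters with a given active set, with a constant
determined by the rows alone. Tightening moves only the right hand sides. The terminal set
contributes finitely many relevant rows, because for small ε the tightened constraints contain a
fixed ball (`exists_ball_subset_tight`) which the LQR continuation enters within a fixed time.

Lipschitz dependence alone would let the gap grow exponentially in time. Completion of squares,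
however, bounds the sum of the squared deviations of the reference from LQR, so the reference
enters, within a uniformly bounded time, a ball on which both MPC controllers coincide with LQR
(`exists_reach_small`, `exists_expert_eq_lqr`). From then on `A + B K` contracts an adapted norm:
the gap stays O(ε) while imitation errors continue and decays geometrically after the switch
(`sum_stageCost_sub_le`). The total is O(ε) for each step up to the switch. For ε above a fixed
threshold the cost itself is O(s + 1), s being the switching time.

Probabilistic part. The expert belongs to the class, so the empirical minimizer agrees with it on
every sample. A controller which disagrees with probability at least Λ/n_t does so with probability
at most exp(-Λ), since the samples of stage t are independent of the finitely many possible earlier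
controllers (`measure_le_pow`). The schedule makes the levels Λ/n_t sum to at most 2Λ/n. Hence the
learned loop is in the terminal set at time τ except with probability at most δ/ℓ, and all ℓ tests
pass there except with probability δ. Conversely a passed test certifies arrival with probability at
least 1 - δ. Imitation, false acceptance and false rejection cost δ each. -/

/-- `u` minimizes `q` over the fiber of `s` above `x`. -/
def IsFiberMin {E F : Type*} (q : E × F → ℝ) (s : Set (E × F)) (x : E) (u : F) : Prop :=
  (x, u) ∈ s ∧ ∀ v, (x, v) ∈ s → q (x, u) ≤ q (x, v)

/-! ### Lipschitz minimizers of parametric quadratic programs -/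

/-- A continuous curve whose domain is a finite union of sets on each of which it is Lipschitz. -/
theorem norm_sub_le_of_finite_cover {F κ : Type*} [NormedAddCommGroup F]
    [Finite κ] {f : ℝ → F} {c : κ → Set ℝ} {L a b : ℝ} (hab : a ≤ b)
    (hf : ContinuousOn f (Set.Icc a b)) (hcov : ∀ t ∈ Set.Icc a b, ∃ j, t ∈ c j)
    (hL : ∀ j, ∀ s ∈ c j ∩ Set.Icc a b, ∀ t ∈ c j ∩ Set.Icc a b, ‖f s - f t‖ ≤ L * |s - t|) :
    ‖f b - f a‖ ≤ L * (b - a) := by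
  refine image_le_of_liminf_slope_right_le_deriv_boundary
    (f := fun t => ‖f t - f a‖) (a := a) (b := b)
    (B := fun t => L * (t - a)) (B' := fun _ => L) ?_ (by simp) (by fun_prop)
    (fun x _ => ?_) ?_ ⟨hab, le_rfl⟩
  · exact (hf.sub continuousOn_const).norm
  · simpa using (((hasDerivAt_id x).sub_const a).const_mul L).hasDerivWithinAt
  intro x hx r hr
  have hxI : x ∈ Set.Icc a b := ⟨hx.1, hx.2.le⟩
  have hIoo : ∀ᶠ z in 𝓝[>] x, z ∈ Set.Ioo x b := Ioo_mem_nhdsGT hx.2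
  have hle : 𝓝[>] x ≤ 𝓝[Set.Icc a b] x := by
    refine le_inf nhdsWithin_le_nhds ?_
    rw [Filter.le_principal_iff]
    filter_upwards [hIoo] with z hz
    exact ⟨hx.1.trans hz.1.le, hz.2.le⟩
  -- There are finitely many pieces, so one of them accumulates at `x` from the right. The
  -- comparison theorem needs the slope bound only frequently, hence only on that piece.
  have hfr : ∃ j, ∃ᶠ z in 𝓝[>] x, z ∈ c j := by
    rw [← Filter.frequently_exists]
    refine Filter.Eventually.frequently ?_
    filter_upwards [hIoo] with z hz
    exact hcov z ⟨hx.1.trans hz.1.le, hz.2.le⟩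
  obtain ⟨j, hj⟩ := hfr
  refine (hj.and_eventually hIoo).mono ?_
  rintro z ⟨hzc, hz⟩
  have hzI : z ∈ Set.Icc a b := ⟨hx.1.trans hz.1.le, hz.2.le⟩
  -- The point `x` need not belong to the piece: the bound between two points of the piece passes to
  -- the limit by continuity.
  have hzx : ‖f z - f x‖ ≤ L * |z - x| := by
    by_contra! hcon
    have h1 : Filter.Tendsto (fun y => ‖f z - f y‖ - L * |z - y|) (𝓝[>] x)
        (𝓝 (‖f z - f x‖ - L * |z - x|)) := by
      have : ContinuousWithinAt (fun y => ‖f z - f y‖ - L * |z - y|) (Set.Icc a b) x := by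
        refine ((continuousWithinAt_const.sub (hf x hxI)).norm).sub ?_
        exact (by fun_prop : Continuous fun y => L * |z - y|).continuousWithinAt
      exact this.mono_left hle
    have h2 := h1.eventually (lt_mem_nhds (sub_pos.2 hcon))
    obtain ⟨y, ⟨hy, hyc⟩, hyI⟩ := ((h2.and_frequently hj).and_eventually hIoo).exists
    have := hL j z ⟨hzc, hzI⟩ y ⟨hyc, hx.1.trans hyI.1.le, hyI.2.le⟩
    linarith
  have hpos : 0 < z - x := sub_pos.2 hz.1
  rw [abs_of_pos hpos] at hzx
  refine lt_of_le_of_lt ?_ hr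
  rw [slope_def_field, div_le_iff₀ hpos]
  have := norm_sub_norm_le (f z - f a) (f x - f a)
  rw [sub_sub_sub_cancel_right] at this
  exact this.trans hzx

section FiberMin

variable {E F ι : Type*} [NormedAddCommGroup E] [NormedSpace ℝ E]
  [NormedAddCommGroup F] [NormedSpace ℝ F]

/-- The displacements between two stationary points with the same active rows. -/
def activeSpace (g : ι → E × F →ₗ[ℝ] ℝ) (q : LinearMap.BilinForm ℝ (E × F)) (J : Set ι) :
    Submodule ℝ (E × F) where
  carrier := {z | (∀ i ∈ J, g i z = 0) ∧ ∀ w : F, (∀ i ∈ J, g i (0, w) = 0) → q z (0, w) = 0}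
  zero_mem' := by simp
  add_mem' := by
    rintro a b ⟨ha, ha'⟩ ⟨hb, hb'⟩
    refine ⟨fun i hi => by simp [ha i hi, hb i hi], fun w hw => by simp [ha' w hw, hb' w hw]⟩
  smul_mem' := by
    rintro c a ⟨ha, ha'⟩
    refine ⟨fun i hi => by simp [ha i hi], fun w hw => by simp [ha' w hw]⟩

/-- An element over base point zero is one of its own test directions, so the form vanishes on it
and strong convexity kills it. The projection to the base is therefore injective, hence
antilipschitz in finite dimension. -/
theorem exists_bound_activeSpace [FiniteDimensional ℝ E] [FiniteDimensional ℝ F]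
    (g : ι → E × F →ₗ[ℝ] ℝ) (q : LinearMap.BilinForm ℝ (E × F)) {μ : ℝ} (hμ : 0 < μ)
    (hq : ∀ z, μ * ‖z.2‖ ^ 2 ≤ q z z) (J : Set ι) :
    ∃ L : ℝ, 0 ≤ L ∧ ∀ z ∈ activeSpace g q J, ‖z.2‖ ≤ L * ‖z.1‖ := by
  let p : activeSpace g q J →ₗ[ℝ] E := (LinearMap.fst ℝ E F).comp (activeSpace g q J).subtype
  have hker : p.ker = ⊥ := by
    rw [LinearMap.ker_eq_bot']
    rintro ⟨⟨x, u⟩, h1, h2⟩ h0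
    have hx : x = 0 := h0
    subst hx
    have h3 := hq (0, u)
    rw [h2 u h1] at h3
    have : ‖u‖ ^ 2 ≤ 0 := by simpa using nonpos_of_mul_nonpos_right h3 hμ
    have : u = 0 := by simpa using this
    simp [this]
  obtain ⟨K, -, hK⟩ := p.exists_antilipschitzWith hker
  refine ⟨K, K.2, fun z hz => ?_⟩
  have h := hK.le_mul_dist ⟨z, hz⟩ 0
  rw [map_zero, dist_zero_right, dist_zero_right] at h
  exact (norm_snd_le z).trans h

variable {q : LinearMap.BilinForm ℝ (E × F)} {μ : ℝ} {s : Set (E × F)}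

/-- Parallelogram identity, together with minimality at the midpoint, which lies in `s` by
convexity. Neither `u` nor `v` has to be a minimizer. Applied to minimizers, it bounds their
distance by a second difference of the value function. -/
theorem fiberMin_gap (hsymm : ∀ x y, q x y = q y x) (hq : ∀ z, μ * ‖z.2‖ ^ 2 ≤ q z z)
    (hs : Convex ℝ s) {x y : E} {u v w : F} (hu : (x, u) ∈ s) (hv : (y, v) ∈ s)
    (hw : IsFiberMin (fun z => q z z) s ((1 / 2 : ℝ) • x + (1 / 2 : ℝ) • y) w) :
    μ * ‖u - v‖ ^ 2 ≤ 2 * q (x, u) (x, u) + 2 * q (y, v) (y, v)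
      - 4 * q (((1 / 2 : ℝ) • x + (1 / 2 : ℝ) • y), w) (((1 / 2 : ℝ) • x + (1 / 2 : ℝ) • y), w) := by
  have h1 := hs hu hv (by norm_num : (0 : ℝ) ≤ 1 / 2) (by norm_num : (0 : ℝ) ≤ 1 / 2) (by norm_num)
  have h2 := hw.2 ((1 / 2 : ℝ) • u + (1 / 2 : ℝ) • v) h1
  have h3 := hq ((x, u) - (y, v))
  have e1 : (((1 / 2 : ℝ) • x + (1 / 2 : ℝ) • y), ((1 / 2 : ℝ) • u + (1 / 2 : ℝ) • v))
      = (1 / 2 : ℝ) • (x, u) + (1 / 2 : ℝ) • (y, v) := rfl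
  simp only [e1] at h2
  simp only [map_sub, map_add, map_smul, LinearMap.sub_apply, LinearMap.add_apply,
    LinearMap.smul_apply, smul_eq_mul, Prod.snd_sub] at h2 h3
  rw [hsymm (y, v) (x, u)] at h2 h3
  linarith

theorem fiberMin_unique (hμ : 0 < μ) (hsymm : ∀ x y, q x y = q y x)
    (hq : ∀ z, μ * ‖z.2‖ ^ 2 ≤ q z z) (hs : Convex ℝ s) {x : E} {u v : F}
    (hu : IsFiberMin (fun z => q z z) s x u) (hv : (x, v) ∈ s)
    (hle : q (x, v) (x, v) ≤ q (x, u) (x, u)) : v = u := by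
  have hx : (1 / 2 : ℝ) • x + (1 / 2 : ℝ) • x = x := by
    rw [← add_smul]; norm_num
  have h := fiberMin_gap (w := u) hsymm hq hs hu.1 hv (by rwa [hx])
  rw [hx] at h
  have : μ * ‖u - v‖ ^ 2 ≤ 0 := by linarith
  have : ‖u - v‖ ^ 2 ≤ 0 := nonpos_of_mul_nonpos_right this hμ
  have : u - v = 0 := by simpa using this
  exact (sub_eq_zero.1 this).symm

/-- On the line through the minimizer the form is a quadratic polynomial with an interior minimum at
zero, so its linear coefficient vanishes. -/
theorem fiberMin_stationary (hsymm : ∀ x y, q x y = q y x) {x : E} {u w : F}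
    (hu : IsFiberMin (fun z => q z z) s x u)
    (hw : ∃ s₀ > 0, ∀ c : ℝ, |c| ≤ s₀ → (x, u) + c • ((0 : E), w) ∈ s) :
    q (x, u) (0, w) = 0 := by
  obtain ⟨s₀, hs₀, h⟩ := hw
  have key : ∀ c : ℝ, |c| ≤ s₀ → 0 ≤ 2 * c * q (x, u) (0, w) + c ^ 2 * q (0, w) (0, w) := by
    intro c hc
    have h1 := h c hc
    have e : (x, u) + c • ((0 : E), w) = (x, u + c • w) := by simp
    have h2 := hu.2 (u + c • w) (by rw [← e]; exact h1)
    simp only [← e, map_add, map_smul, LinearMap.add_apply, LinearMap.smul_apply, smul_eq_mul,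
      hsymm (0, w) (x, u)] at h2
    linarith
  set a := q (x, u) (0, w)
  set d := q (0, w) (0, w)
  by_contra ha
  have hd : 0 < |d| + 1 := by positivity
  -- So small that the quadratic term cannot outweigh the linear one, which has factor two.
  set c : ℝ := min s₀ (|a| / (|d| + 1))
  have hc0 : 0 < c := lt_min hs₀ (by positivity)
  have hc1 : c ≤ s₀ := min_le_left _ _
  have hc2 : c * (|d| + 1) ≤ |a| := (le_div_iff₀ hd).1 (min_le_right _ _)
  have hd' : d ≤ |d| := le_abs_self d
  have ha' : 0 < |a| := abs_pos.2 ha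
  have hcd : c * d ≤ |a| := by nlinarith
  rcases lt_or_gt_of_ne ha with h1 | h1
  · have := key c (by rwa [abs_of_pos hc0])
    rw [abs_of_neg h1] at *
    nlinarith
  · have := key (-c) (by rwa [abs_neg, abs_of_pos hc0])
    rw [abs_of_pos h1] at *
    nlinarith

theorem convexOn_quadratic (hsymm : ∀ x y, q x y = q y x) (hq : ∀ z, 0 ≤ q z z) (z z' : E × F)
    {α β : ℝ} (hα : 0 ≤ α) (hβ : 0 ≤ β) (hαβ : α + β = 1) :
    q (α • z + β • z') (α • z + β • z') ≤ α * q z z + β * q z' z' := by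
  have h := hq (z - z')
  simp only [map_sub, map_add, map_smul, LinearMap.sub_apply, LinearMap.add_apply,
    LinearMap.smul_apply, smul_eq_mul, hsymm z' z] at h ⊢
  obtain rfl : β = 1 - α := by linarith
  nlinarith [mul_nonneg (mul_nonneg hα hβ) h]

/-- Minimizers of a strongly convex quadratic over the fibers of a locally polyhedral convex set
depend on the base point in a Lipschitz way, with a constant which does not depend on the right
hand sides of the constraints. -/
theorem exists_lipschitz_fiberMin [FiniteDimensional ℝ E] [FiniteDimensional ℝ F] [Finite ι]
    (g : ι → E × F →ₗ[ℝ] ℝ) (hμ : 0 < μ) (hsymm : ∀ x y, q x y = q y x)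
    (hq : ∀ z, μ * ‖z.2‖ ^ 2 ≤ q z z) (hqc : Continuous fun z => q z z) :
    ∃ L : ℝ, 0 ≤ L ∧ ∀ (s : Set (E × F)) (h : ι → ℝ), Convex ℝ s → IsClosed s →
      (∀ z ∈ s, ∀ w : F, (∀ i, g i z = h i → g i (0, w) = 0) →
        ∃ s₀ > 0, ∀ c : ℝ, |c| ≤ s₀ → z + c • ((0 : E), w) ∈ s) →
      (∀ z ∈ s, ∃ u, IsFiberMin (fun z => q z z) s z.1 u) →
      ∀ x y u v, IsFiberMin (fun z => q z z) s x u → IsFiberMin (fun z => q z z) s y v →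
        ‖u - v‖ ≤ L * ‖x - y‖ := by
  -- One constant for each of the finitely many possible active sets. No right hand side enters, so
  -- the maximum `L` can be fixed before `s` and `h`.
  choose LJ hLJ0 hLJ using exists_bound_activeSpace g q hμ hq
  obtain ⟨L, hL⟩ := (Set.finite_range LJ).bddAbove
  have hL' : ∀ J, LJ J ≤ L := fun J => hL ⟨J, rfl⟩
  refine ⟨L, (hLJ0 ∅).trans (hL' ∅), ?_⟩
  intro s h hs hcl hloc hex x y u v hu hv
  have hq0 : ∀ z, 0 ≤ q z z := fun z => (by positivity : 0 ≤ μ * ‖z.2‖ ^ 2).trans (hq z)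
  set X : ℝ → E := fun t => (1 - t) • x + t • y with hX
  have hXaff : ∀ a b α β : ℝ, α + β = 1 → X (α * a + β * b) = α • X a + β • X b := by
    intro a b α β hαβ
    simp only [hX, smul_add, smul_smul]
    rw [show 1 - (α * a + β * b) = α * (1 - a) + β * (1 - b) by linear_combination - hαβ]
    simp only [add_smul]
    abel
  have hXsub : ∀ a b : ℝ, X a - X b = (b - a) • (x - y) := by
    intro a b
    simp only [hX]
    module
  have hXc : Continuous X := by fun_prop
  have hmem : ∀ t ∈ Set.Icc (0 : ℝ) 1, ∃ w, IsFiberMin (fun z => q z z) s (X t) w := by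
    intro t ht
    exact hex _ (hs hu.1 hv.1 (sub_nonneg.2 ht.2) ht.1 (by ring))
  choose! m hm using hmem
  set φ : ℝ → ℝ := fun t => q (X t, m t) (X t, m t) with hφ
  have hφconv : ConvexOn ℝ (Set.Icc 0 1) φ := by
    refine ⟨convex_Icc _ _, fun a ha b hb α β hα hβ hαβ => ?_⟩
    have hc : α • a + β • b ∈ Set.Icc (0 : ℝ) 1 := convex_Icc _ _ ha hb hα hβ hαβ
    have h1 := hs (hm a ha).1 (hm b hb).1 hα hβ hαβ
    have e : α • (X a, m a) + β • (X b, m b) = (X (α • a + β • b), α • m a + β • m b) := by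
      rw [smul_eq_mul, smul_eq_mul, hXaff _ _ _ _ hαβ]; rfl
    have h2 := (hm _ hc).2 (α • m a + β • m b) (by rw [← e]; exact h1)
    have h3 := convexOn_quadratic hsymm hq0 (X a, m a) (X b, m b) hα hβ hαβ
    rw [e] at h3
    exact h2.trans h3
  -- Convexity gives continuity only in the interior; the endpoints of the segment are recovered at
  -- the end by a limit.
  have hφc : ContinuousOn φ (Set.Ioo 0 1) :=
    (hφconv.subset Set.Ioo_subset_Icc_self (convex_Ioo _ _)).continuousOn isOpen_Ioo
  have hIoo : ∀ {t : ℝ}, t ∈ Set.Ioo (0 : ℝ) 1 → t ∈ Set.Icc (0 : ℝ) 1 :=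
    fun ht => Set.Ioo_subset_Icc_self ht
  have hmc : ContinuousOn m (Set.Ioo 0 1) := by
    intro t₀ ht₀
    refine ContinuousAt.continuousWithinAt ?_
    have hn : Set.Ioo (0 : ℝ) 1 ∈ 𝓝 t₀ := isOpen_Ioo.mem_nhds ht₀
    have hφat : ContinuousAt φ t₀ := hφc.continuousAt hn
    have hmid : Filter.Tendsto (fun t => φ (1 / 2 * t + 1 / 2 * t₀)) (𝓝 t₀) (𝓝 (φ t₀)) := by
      have : Filter.Tendsto (fun t : ℝ => 1 / 2 * t + 1 / 2 * t₀) (𝓝 t₀) (𝓝 t₀) := by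
        have : ContinuousAt (fun t : ℝ => 1 / 2 * t + 1 / 2 * t₀) t₀ := by fun_prop
        convert this.tendsto using 2
        ring
      exact hφat.tendsto.comp this
    have hlim : Filter.Tendsto (fun t => (2 * φ t + 2 * φ t₀ - 4 * φ (1 / 2 * t + 1 / 2 * t₀)) / μ)
        (𝓝 t₀) (𝓝 0) := by
      have := (((hφat.tendsto.const_mul 2).add_const (2 * φ t₀)).sub (hmid.const_mul 4)).div_const μ
      convert this using 2
      ring
    -- The gap inequality bounds the squared distance of two minimizers by a second difference of
    -- `φ`, which tends to zero.
    have hsq : Filter.Tendsto (fun t => ‖m t - m t₀‖ ^ 2) (𝓝 t₀) (𝓝 0) := by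
      refine squeeze_zero' (Filter.Eventually.of_forall fun _ => by positivity) ?_ hlim
      filter_upwards [hn] with t ht
      rw [le_div_iff₀' hμ]
      have hc : 1 / 2 * t + 1 / 2 * t₀ ∈ Set.Icc (0 : ℝ) 1 :=
        ⟨by linarith [ht.1, ht₀.1], by linarith [ht.2, ht₀.2]⟩
      have h1 := hm _ hc
      rw [hXaff _ _ _ _ (by norm_num)] at h1
      have h2 := fiberMin_gap hsymm hq hs (hm t (hIoo ht)).1 (hm t₀ (hIoo ht₀)).1 h1
      rw [← hXaff _ _ _ _ (by norm_num)] at h2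
      exact h2
    have hnorm : Filter.Tendsto (fun t => ‖m t - m t₀‖) (𝓝 t₀) (𝓝 0) := by
      have := hsq.sqrt
      simpa [Real.sqrt_sq] using this
    exact tendsto_iff_norm_sub_tendsto_zero.2 hnorm
  -- With equal active sets the two stationarity conditions subtract, and the right hand sides
  -- cancel, so the difference lies in the active space.
  have hsame : ∀ a ∈ Set.Ioo (0 : ℝ) 1, ∀ b ∈ Set.Ioo (0 : ℝ) 1,
      {i | g i (X a, m a) = h i} = {i | g i (X b, m b) = h i} →
      ‖m a - m b‖ ≤ L * ‖x - y‖ * |a - b| := by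
    intro a ha b hb hab
    have hstat : ∀ t ∈ Set.Ioo (0 : ℝ) 1, ∀ w : F, (∀ i, g i (X t, m t) = h i → g i (0, w) = 0) →
        q (X t, m t) (0, w) = 0 := fun t ht w hw =>
      fiberMin_stationary hsymm (hm t (hIoo ht)) (hloc _ (hm t (hIoo ht)).1 w hw)
    have hz : (X a, m a) - (X b, m b) ∈ activeSpace g q {i | g i (X a, m a) = h i} := by
      refine ⟨fun i hi => ?_, fun w hw => ?_⟩
      · have hi' : i ∈ {i | g i (X b, m b) = h i} := hab ▸ hi
        rw [map_sub, hi, hi', sub_self]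
      · rw [map_sub, LinearMap.sub_apply, hstat a ha w hw, hstat b hb w, sub_self]
        intro i hi
        exact hw i (by rw [hab]; exact hi)
    have h1 := hLJ _ _ hz
    simp only [Prod.snd_sub, Prod.fst_sub, hXsub, norm_smul, Real.norm_eq_abs] at h1
    rw [abs_sub_comm b a] at h1
    refine h1.trans ?_
    have := mul_le_mul_of_nonneg_right (hL' {i | g i (X a, m a) = h i})
      (by positivity : 0 ≤ |a - b| * ‖x - y‖)
    linarith
  have hlip : ∀ a ∈ Set.Ioo (0 : ℝ) 1, ∀ b ∈ Set.Ioo (0 : ℝ) 1, a ≤ b →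
      ‖m b - m a‖ ≤ L * ‖x - y‖ * (b - a) := by
    intro a ha b hb hab
    have hsub : Set.Icc a b ⊆ Set.Ioo 0 1 := fun t ht =>
      ⟨ha.1.trans_le ht.1, ht.2.trans_lt hb.2⟩
    refine norm_sub_le_of_finite_cover (κ := Set ι)
      (c := fun J => {t | {i | g i (X t, m t) = h i} = J}) hab (hmc.mono hsub)
      (fun t _ => ⟨_, rfl⟩) ?_
    rintro J s ⟨hs, hsI⟩ t ⟨ht, htI⟩
    exact hsame s (hsub hsI) t (hsub htI) (hs.trans ht.symm)
  have hlip' : ∀ a ∈ Set.Ioo (0 : ℝ) 1, ∀ b ∈ Set.Ioo (0 : ℝ) 1,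
      ‖m a - m b‖ ≤ L * ‖x - y‖ * |a - b| := by
    intro a ha b hb
    rcases le_total a b with hab | hab
    · rw [norm_sub_rev, abs_sub_comm, abs_of_nonneg (sub_nonneg.2 hab)]
      exact hlip a ha b hb hab
    · rw [abs_of_nonneg (sub_nonneg.2 hab)]
      exact hlip b hb a ha hab
  have hhalf : (1 / 2 : ℝ) ∈ Set.Icc (0 : ℝ) 1 := by norm_num
  -- Weights in the open unit interval: they pull an endpoint towards the midpoint and so approach
  -- it through interior parameters.
  set c : ℕ → ℝ := fun k => 1 / ((k : ℝ) + 2) with hc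
  have hc0 : ∀ k, 0 < c k := fun k => by simp only [hc]; positivity
  have hc1 : ∀ k, c k < 1 := fun k => by
    simp only [hc]
    rw [div_lt_one (by positivity)]
    have : (0 : ℝ) ≤ k := k.cast_nonneg
    linarith
  have hclim : Filter.Tendsto c Filter.atTop (𝓝 0) := by
    have := (tendsto_one_div_add_atTop_nhds_zero_nat (𝕜 := ℝ)).comp (Filter.tendsto_add_atTop_nat 1)
    refine this.congr fun k => ?_
    simp only [hc, Function.comp]
    push_cast
    ring
  -- The interior Lipschitz bound makes the minimizers Cauchy. Their limit lies in the closed set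
  -- `s`, convexity of `φ` bounds its value by that of the endpoint, and uniqueness identifies it
  -- with `m e`.
  have hend : ∀ e ∈ Set.Icc (0 : ℝ) 1,
      Filter.Tendsto (fun k => m ((1 - c k) * e + c k * (1 / 2))) Filter.atTop (𝓝 (m e)) := by
    intro e he
    have htI : ∀ k, (1 - c k) * e + c k * (1 / 2) ∈ Set.Ioo (0 : ℝ) 1 := by
      intro k
      have := hc0 k
      have := hc1 k
      constructor <;> nlinarith [he.1, he.2]
    have htlim : Filter.Tendsto (fun k => (1 - c k) * e + c k * (1 / 2)) Filter.atTop (𝓝 e) := by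
      have := ((hclim.const_sub 1).mul_const e).add (hclim.mul_const (1 / 2))
      simpa using this
    have hcauchy : CauchySeq (fun k => m ((1 - c k) * e + c k * (1 / 2))) := by
      rw [Metric.cauchySeq_iff]
      intro η hη
      obtain ⟨k₀, hk₀⟩ := Metric.cauchySeq_iff.1 htlim.cauchySeq (η / (L * ‖x - y‖ + 1))
        (by have := (hLJ0 ∅).trans (hL' ∅); positivity)
      refine ⟨k₀, fun k hk l hl => ?_⟩
      have hLn : 0 ≤ L * ‖x - y‖ := mul_nonneg ((hLJ0 ∅).trans (hL' ∅)) (norm_nonneg _)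
      have h1 := hk₀ k hk l hl
      rw [lt_div_iff₀ (by positivity), Real.dist_eq] at h1
      rw [dist_eq_norm]
      refine (hlip' _ (htI k) _ (htI l)).trans_lt ?_
      have := abs_nonneg ((1 - c k) * e + c k * (1 / 2) - ((1 - c l) * e + c l * (1 / 2)))
      nlinarith
    obtain ⟨l, hl⟩ := cauchySeq_tendsto_of_complete hcauchy
    have hpair : Filter.Tendsto (fun k => (X ((1 - c k) * e + c k * (1 / 2)),
        m ((1 - c k) * e + c k * (1 / 2)))) Filter.atTop (𝓝 (X e, l)) :=
      ((hXc.tendsto e).comp htlim).prodMk_nhds hl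
    have hmeml : (X e, l) ∈ s :=
      hcl.mem_of_tendsto hpair (Filter.Eventually.of_forall fun k => (hm _ (hIoo (htI k))).1)
    have hle : q (X e, l) (X e, l) ≤ φ e := by
      have h1 : Filter.Tendsto (fun k => φ ((1 - c k) * e + c k * (1 / 2))) Filter.atTop
          (𝓝 (q (X e, l) (X e, l))) := (hqc.tendsto (X e, l)).comp hpair
      have h2 : Filter.Tendsto (fun k => (1 - c k) * φ e + c k * φ (1 / 2)) Filter.atTop
          (𝓝 (φ e)) := by
        have := ((hclim.const_sub 1).mul_const (φ e)).add (hclim.mul_const (φ (1 / 2)))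
        simpa using this
      exact le_of_tendsto_of_tendsto' h1 h2 fun k =>
        hφconv.2 he hhalf (sub_nonneg.2 (hc1 k).le) (hc0 k).le (by ring)
    rw [← fiberMin_unique hμ hsymm hq hs (hm e he) hmeml hle]
    exact hl
  have h01 : ‖m 0 - m 1‖ ≤ L * ‖x - y‖ := by
    have h0 := hend 0 (by norm_num)
    have h1 := hend 1 (by norm_num)
    refine le_of_tendsto (h0.sub h1).norm (Filter.Eventually.of_forall fun k => ?_)
    have hk0 := hc0 k
    have hk1 := hc1 k
    refine (hlip' _ ⟨by linarith, by linarith⟩ _ ⟨by linarith, by linarith⟩).trans ?_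
    have hLn : 0 ≤ L * ‖x - y‖ := mul_nonneg ((hLJ0 ∅).trans (hL' ∅)) (norm_nonneg _)
    refine mul_le_of_le_one_right hLn ?_
    rw [abs_le]
    constructor <;> linarith
  have hX0 : X 0 = x := by simp [hX]
  have hX1 : X 1 = y := by simp [hX]
  have e0 : u = m 0 := by
    have h0 := hm 0 (by norm_num)
    rw [hX0] at h0
    exact fiberMin_unique hμ hsymm hq hs h0 hu.1 (hu.2 _ h0.1)
  have e1 : v = m 1 := by
    have h0 := hm 1 (by norm_num)
    rw [hX1] at h0
    exact fiberMin_unique hμ hsymm hq hs h0 hv.1 (hv.2 _ h0.1)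
  rw [e0, e1]
  exact h01

end FiberMin

/-! ### Matrices as linear maps, quadratic forms, an adapted norm -/

section MatrixVector

variable {k m n : ℕ}

theorem mv_add (M : Matrix (Fin m) (Fin n) ℝ) (x y : Vec n) : mv M (x + y) = mv M x + mv M y :=
  map_add _ _ _

theorem mv_sub (M : Matrix (Fin m) (Fin n) ℝ) (x y : Vec n) : mv M (x - y) = mv M x - mv M y :=
  map_sub _ _ _

theorem mv_smul (M : Matrix (Fin m) (Fin n) ℝ) (c : ℝ) (x : Vec n) : mv M (c • x) = c • mv M x :=
  map_smul _ _ _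

@[simp]
theorem mv_zero (M : Matrix (Fin m) (Fin n) ℝ) : mv M (0 : Vec n) = 0 := map_zero _

theorem mv_neg (M : Matrix (Fin m) (Fin n) ℝ) (x : Vec n) : mv (-M) x = -mv M x := by
  simp [mv]

theorem mv_add_left (M N : Matrix (Fin m) (Fin n) ℝ) (x : Vec n) :
    mv (M + N) x = mv M x + mv N x := by
  simp [mv]

theorem mv_mul (M : Matrix (Fin m) (Fin n) ℝ) (N : Matrix (Fin n) (Fin k) ℝ) (x : Vec k) :
    mv (M * N) x = mv M (mv N x) := by
  simp [mv, Matrix.toLpLin_apply, Matrix.mulVec_mulVec]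

theorem mv_one (x : Vec n) : mv (1 : Matrix (Fin n) (Fin n) ℝ) x = x := by
  simp [mv]

theorem continuous_mv (M : Matrix (Fin m) (Fin n) ℝ) : Continuous (mv M) :=
  (Matrix.toEuclideanLin M).continuous_of_finiteDimensional

theorem norm_mv_le (M : Matrix (Fin m) (Fin n) ℝ) (x : Vec n) : ‖mv M x‖ ≤ opNorm M * ‖x‖ :=
  (Matrix.toEuclideanLin M).toContinuousLinearMap.le_opNorm x

theorem opNorm_nonneg (M : Matrix (Fin m) (Fin n) ℝ) : 0 ≤ opNorm M := norm_nonneg _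

theorem opNorm_pos {M : Matrix (Fin m) (Fin n) ℝ} (hM : M ≠ 0) : 0 < opNorm M := by
  rw [opNorm, norm_pos_iff]
  intro h
  apply hM
  have : Matrix.toEuclideanLin M = 0 := by
    ext1 x
    exact congrArg (fun f : Vec n →L[ℝ] Vec m => f x) h
  simpa using this

theorem inner_mv (M : Matrix (Fin m) (Fin n) ℝ) (x : Vec n) (y : Vec m) :
    inner ℝ (mv M x) y = inner ℝ x (mv M.transpose y) := by
  have := Matrix.toEuclideanLin_conjTranspose_eq_adjoint M
  rw [Matrix.conjTranspose_eq_transpose_of_trivial] at this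
  simp only [mv, this, LinearMap.adjoint_inner_right]

theorem abs_inner_mv_le (M : Matrix (Fin n) (Fin n) ℝ) (x y : Vec n) :
    |inner ℝ x (mv M y)| ≤ opNorm M * ‖x‖ * ‖y‖ := by
  refine (abs_real_inner_le_norm _ _).trans ?_
  have := mul_le_mul_of_nonneg_left (norm_mv_le M y) (norm_nonneg x)
  linarith

theorem quadForm_le (M : Matrix (Fin n) (Fin n) ℝ) (x : Vec n) :
    quadForm M x ≤ opNorm M * ‖x‖ ^ 2 := by
  have := (le_abs_self _).trans (abs_inner_mv_le M x x)
  rw [quadForm]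
  linarith

theorem quadForm_sub_le (M : Matrix (Fin n) (Fin n) ℝ) (x y : Vec n) :
    quadForm M x - quadForm M y ≤ opNorm M * (‖x‖ + ‖y‖) * ‖x - y‖ := by
  have e : quadForm M x - quadForm M y = inner ℝ x (mv M (x - y)) + inner ℝ (x - y) (mv M y) := by
    simp only [quadForm, mv_sub, inner_sub_left, inner_sub_right]
    ring
  rw [e]
  have h1 := (le_abs_self _).trans (abs_inner_mv_le M x (x - y))
  have h2 := (le_abs_self _).trans (abs_inner_mv_le M (x - y) y)
  linarith

theorem quadForm_eq_dotProduct (M : Matrix (Fin n) (Fin n) ℝ) (x : Vec n) :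
    quadForm M x = x.ofLp ⬝ᵥ (M.mulVec x.ofLp) := by
  simp [quadForm, mv, Matrix.toLpLin_apply, EuclideanSpace.inner_eq_star_dotProduct,
    dotProduct_comm]

theorem quadForm_nonneg {M : Matrix (Fin n) (Fin n) ℝ} (hM : M.PosSemidef) (x : Vec n) :
    0 ≤ quadForm M x := by
  rw [quadForm_eq_dotProduct]
  simpa using hM.dotProduct_mulVec_nonneg x.ofLp

theorem quadForm_pos {M : Matrix (Fin n) (Fin n) ℝ} (hM : M.PosDef) {x : Vec n} (hx : x ≠ 0) :
    0 < quadForm M x := by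
  rw [quadForm_eq_dotProduct]
  have : x.ofLp ≠ 0 := fun h => hx (by ext i; simp [h])
  simpa using hM.dotProduct_mulVec_pos this

theorem quadForm_smul (M : Matrix (Fin n) (Fin n) ℝ) (c : ℝ) (x : Vec n) :
    quadForm M (c • x) = c ^ 2 * quadForm M x := by
  simp only [quadForm, mv_smul, inner_smul_left, inner_smul_right]
  simp
  ring

theorem continuous_quadForm (M : Matrix (Fin n) (Fin n) ℝ) : Continuous (quadForm M) := by
  unfold quadForm
  exact continuous_id.inner (continuous_mv M)

/-- The minimum over the unit sphere, extended by homogeneity. In dimension zero the sphere is empty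
and any constant works. -/
theorem exists_quadForm_ge {M : Matrix (Fin n) (Fin n) ℝ} (hM : M.PosDef) :
    ∃ μ : ℝ, 0 < μ ∧ ∀ x : Vec n, μ * ‖x‖ ^ 2 ≤ quadForm M x := by
  rcases (sphere (0 : Vec n) 1).eq_empty_or_nonempty with h | h
  · refine ⟨1, one_pos, fun x => ?_⟩
    have hx : x = 0 := by
      by_contra hx
      have : ‖x‖⁻¹ • x ∈ sphere (0 : Vec n) 1 := by
        simp [norm_smul, hx]
      rw [h] at this
      exact this
    simp [hx, quadForm]
  · obtain ⟨z, hz, hmin⟩ := (isCompact_sphere (0 : Vec n) 1).exists_isMinOn h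
      (continuous_quadForm M).continuousOn
    have hz1 : ‖z‖ = 1 := by simpa using hz
    refine ⟨quadForm M z, quadForm_pos hM (fun h0 => by simp [h0] at hz1), fun x => ?_⟩
    by_cases hx : x = 0
    · simp [hx, quadForm]
    have h1 : ‖x‖⁻¹ • x ∈ sphere (0 : Vec n) 1 := by
      simp [norm_smul, hx]
    have h2 := hmin h1
    simp only [Set.mem_ofPred_eq, quadForm_smul] at h2
    have hx' : 0 < ‖x‖ := norm_pos_iff.2 hx
    rw [inv_pow, inv_mul_eq_div, le_div_iff₀ (by positivity)] at h2
    exact h2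

/-- A power bounded decaying matrix contracts an equivalent norm. -/
theorem exists_contracted_norm {M : Matrix (Fin n) (Fin n) ℝ} {ρ σ : ℝ} (hρ : 0 < ρ)
    (hM : ∀ k : ℕ, opNorm (M ^ k) ≤ σ * ρ ^ k) :
    ∃ ν : Vec n → ℝ, (∀ x, ‖x‖ ≤ ν x) ∧ (∀ x, ν x ≤ σ * ‖x‖) ∧
      (∀ x y, ν (x + y) ≤ ν x + ν y) ∧ ∀ x, ν (mv M x) ≤ ρ * ν x := by
  have hle : ∀ x k, (ρ ^ k)⁻¹ * ‖mv (M ^ k) x‖ ≤ σ * ‖x‖ := by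
    intro x k
    rw [inv_mul_eq_div, div_le_iff₀ (by positivity)]
    have := mul_le_mul_of_nonneg_right (hM k) (norm_nonneg x)
    linarith [norm_mv_le (M ^ k) x]
  have hbdd : ∀ x, BddAbove (Set.range fun k : ℕ => (ρ ^ k)⁻¹ * ‖mv (M ^ k) x‖) := by
    intro x
    refine ⟨σ * ‖x‖, ?_⟩
    rintro _ ⟨k, rfl⟩
    exact hle x k
  -- The supremum along the orbit, weighted by powers of ρ⁻¹, is finite by the decay hypothesis.
  -- Applying the matrix shifts the index by one and gains a factor ρ.
  refine ⟨fun x => ⨆ k : ℕ, (ρ ^ k)⁻¹ * ‖mv (M ^ k) x‖, fun x => ?_, fun x => ciSup_le (hle x),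
    fun x y => ciSup_le fun k => ?_, fun x => ciSup_le fun k => ?_⟩
  · have := le_ciSup (hbdd x) 0
    simpa [mv_one] using this
  · have h1 := le_ciSup (hbdd x) k
    have h2 := le_ciSup (hbdd y) k
    rw [mv_add]
    have h3 := mul_le_mul_of_nonneg_left (norm_add_le (mv (M ^ k) x) (mv (M ^ k) y))
      (by positivity : 0 ≤ (ρ ^ k)⁻¹)
    linarith
  · have h1 := le_ciSup (hbdd x) (k + 1)
    rw [← mv_mul, ← pow_succ]
    have h2 := mul_le_mul_of_nonneg_left h1 hρ.le
    have e : ρ * ((ρ ^ (k + 1))⁻¹ * ‖mv (M ^ (k + 1)) x‖) = (ρ ^ k)⁻¹ * ‖mv (M ^ (k + 1)) x‖ := by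
      rw [pow_succ]
      field_simp
    rwa [e] at h2

end MatrixVector

/-! ### Riccati equation and completion of squares -/

namespace ControlSystem

variable {dx du : ℕ} {S : ControlSystem dx du}

/-- The weight `R + Bᵀ P B` of the deviations from the LQR inputs. -/
noncomputable def inputWeight (S : ControlSystem dx du) : Matrix (Fin du) (Fin du) ℝ :=
  S.R + S.B.transpose * S.P * S.B

theorem Standing.inputWeight_posDef (hS : S.Standing) : S.inputWeight.PosDef := by
  refine hS.R_posDef.add_posSemidef ?_
  have := hS.P_posDef.posSemidef.conjTranspose_mul_mul_same S.B
  rwa [Matrix.conjTranspose_eq_transpose_of_trivial] at this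

theorem step_eq (S : ControlSystem dx du) (x : Vec dx) (u : Vec du) :
    S.step x u = mv S.AK x + mv S.B (u - mv S.K x) := by
  simp only [step, AK, mv_add_left, mv_mul, mv_sub]
  abel

theorem step_lqr (S : ControlSystem dx du) (x : Vec dx) : S.step x (mv S.K x) = mv S.AK x := by
  simp [step_eq]

theorem step_add (S : ControlSystem dx du) (x y : Vec dx) (u v : Vec du) :
    S.step (x + y) (u + v) = S.step x u + S.step y v := by
  simp only [step, mv_add]
  abel

theorem step_sub (S : ControlSystem dx du) (x y : Vec dx) (u v : Vec du) :
    S.step (x - y) (u - v) = S.step x u - S.step y v := by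
  simp only [step, mv_sub]
  abel

theorem step_smul (S : ControlSystem dx du) (c : ℝ) (x : Vec dx) (u : Vec du) :
    S.step (c • x) (c • u) = c • S.step x u := by
  simp only [step, mv_smul, smul_add]

theorem norm_step_le (S : ControlSystem dx du) (x : Vec dx) (u : Vec du) :
    ‖S.step x u‖ ≤ opNorm S.A * ‖x‖ + opNorm S.B * ‖u‖ :=
  (norm_add_le _ _).trans (add_le_add (norm_mv_le _ _) (norm_mv_le _ _))

theorem Standing.stageCost_nonneg (hS : S.Standing) (x : Vec dx) (u : Vec du) :
    0 ≤ S.stageCost x u :=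
  add_nonneg (quadForm_nonneg hS.Q_posSemidef x) (quadForm_nonneg hS.R_posDef.posSemidef u)

theorem stageCost_le (S : ControlSystem dx du) (x : Vec dx) (u : Vec du) :
    S.stageCost x u ≤ opNorm S.Q * ‖x‖ ^ 2 + opNorm S.R * ‖u‖ ^ 2 :=
  add_le_add (quadForm_le _ _) (quadForm_le _ _)

/-- Completion of squares. -/
theorem Standing.stageCost_add_step (hS : S.Standing) (x : Vec dx) (u : Vec du) :
    S.stageCost x u + quadForm S.P (S.step x u)
      = quadForm S.P x + quadForm S.inputWeight (u - mv S.K x) := by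
  have hPT : S.P.transpose = S.P := by
    have := hS.P_posDef.isHermitian.eq
    rwa [Matrix.conjTranspose_eq_transpose_of_trivial] at this
  have hWT : S.inputWeight.transpose = S.inputWeight := by
    have := hS.inputWeight_posDef.isHermitian.eq
    rwa [Matrix.conjTranspose_eq_transpose_of_trivial] at this
  have hdet : IsUnit S.inputWeight.det :=
    (Matrix.isUnit_iff_isUnit_det _).1 hS.inputWeight_posDef.isUnit
  have hWK : S.inputWeight * S.K = -(S.B.transpose * S.P * S.A) := by
    have e : S.K = -(S.inputWeight⁻¹ * (S.B.transpose * S.P * S.A)) := by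
      simp only [K, inputWeight, Matrix.mul_assoc]
    rw [e, Matrix.mul_neg, ← Matrix.mul_assoc, Matrix.mul_nonsing_inv _ hdet, Matrix.one_mul]
  -- Substituting the gain removes the inverse from the Riccati equation. Together with the normal
  -- equation `hWK`, the identity becomes linear in inner products of `A x`, `B u` and `B K x`.
  have hdare : S.P = S.A.transpose * (S.P * S.A) + S.A.transpose * (S.P * (S.B * S.K)) + S.Q := by
    have e : S.A.transpose * (S.P * (S.B * S.K)) = -(S.A.transpose * S.P * S.B *
        (S.R + S.B.transpose * S.P * S.B)⁻¹ * S.B.transpose * S.P * S.A) := by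
      simp only [K, Matrix.mul_assoc, Matrix.mul_neg]
    rw [e, ← sub_eq_add_neg, ← Matrix.mul_assoc]
    exact hS.P_dare
  have f1 : quadForm S.P x = inner ℝ (mv S.A x) (mv S.P (mv S.A x))
      + inner ℝ (mv S.A x) (mv S.P (mv S.B (mv S.K x))) + quadForm S.Q x := by
    rw [quadForm]
    nth_rewrite 1 [hdare]
    simp only [mv_add_left, inner_add_right, mv_mul, quadForm, inner_mv]
  have f2 : ∀ v w : Vec du, inner ℝ v (mv S.inputWeight w)
      = inner ℝ v (mv S.R w) + inner ℝ (mv S.B v) (mv S.P (mv S.B w)) := by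
    intro v w
    simp only [inputWeight, mv_add_left, inner_add_right, mv_mul, inner_mv]
  have f3 : ∀ v : Vec du, inner ℝ v (mv S.inputWeight (mv S.K x))
      = -inner ℝ (mv S.B v) (mv S.P (mv S.A x)) := by
    intro v
    rw [← mv_mul, hWK, mv_neg, inner_neg_right, inner_mv, mv_mul, mv_mul]
  have f4 : inner ℝ (mv S.K x) (mv S.inputWeight u) = inner ℝ u (mv S.inputWeight (mv S.K x)) := by
    rw [real_inner_comm, inner_mv, hWT]
  have f6 : ∀ v : Vec du, inner ℝ (mv S.A x) (mv S.P (mv S.B v))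
      = inner ℝ (mv S.B v) (mv S.P (mv S.A x)) := by
    intro v
    rw [real_inner_comm, inner_mv, hPT]
  have g1 := f3 u
  have g2 := f3 (mv S.K x)
  have g3 := f2 u u
  have g4 := f6 u
  have g5 := f6 (mv S.K x)
  rw [f1]
  simp only [stageCost, quadForm, step, mv_add, mv_sub, inner_add_left, inner_add_right,
    inner_sub_left, inner_sub_right]
  linarith

end ControlSystem

/-! ### Closedness and convexity of tightened polyhedra -/

section Polyhedra

variable {n : ℕ} {X Y : Set (Vec n)}

theorem IsPolyhedron.isClosed (hX : IsPolyhedron X) : IsClosed X := by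
  obtain ⟨m, a, b, rfl⟩ := hX
  simp only [Set.ofPred_forall]
  exact isClosed_iInter fun i => isClosed_le (by fun_prop) continuous_const

theorem IsPolyhedron.convex (hX : IsPolyhedron X) : Convex ℝ X := by
  obtain ⟨m, a, b, rfl⟩ := hX
  simp only [Set.ofPred_forall]
  refine convex_iInter fun i => ?_
  exact convex_halfSpace_le (innerₗ (Vec n) (a i)).isLinear (b i)

theorem isClosed_pontryaginDiff (hX : IsClosed X) : IsClosed (pontryaginDiff X Y) := by
  have : pontryaginDiff X Y = X ∩ ⋂ y ∈ Y, (fun x => x + y) ⁻¹' X := by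
    ext x
    simp [pontryaginDiff]
  rw [this]
  exact hX.inter (isClosed_biInter fun y _ => hX.preimage (by fun_prop))

theorem convex_pontryaginDiff (hX : Convex ℝ X) : Convex ℝ (pontryaginDiff X Y) := by
  rintro x ⟨hx, hx'⟩ y ⟨hy, hy'⟩ a b ha hb hab
  refine ⟨hX hx hy ha hb hab, fun z hz => ?_⟩
  have := hX (hx' z hz) (hy' z hz) ha hb hab
  convert this using 1
  rw [smul_add, smul_add, add_add_add_comm, ← add_smul, hab, one_smul]

end Polyhedra

/-! ### Predicted trajectories, terminal set, recursive feasibility, tubes -/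

namespace ControlSystem

variable {dx du : ℕ} {S : ControlSystem dx du} {Z : Set (Vec dx)}

section OpenLoop

theorem openLoop_succ_left (S : ControlSystem dx du) (x : Vec dx) (u : ℕ → Vec du) (t : ℕ) :
    S.openLoop x u (t + 1) = S.openLoop (S.step x (u 0)) (fun k => u (k + 1)) t := by
  induction t with
  | zero => rfl
  | succ t ih => rw [openLoop, ih]; rfl

theorem openLoop_congr (S : ControlSystem dx du) (x : Vec dx) {u v : ℕ → Vec du} {t : ℕ}
    (h : ∀ k < t, u k = v k) : S.openLoop x u t = S.openLoop x v t := by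
  induction t with
  | zero => rfl
  | succ t ih =>
    rw [openLoop, openLoop, ih fun k hk => h k (hk.trans t.lt_succ_self), h t t.lt_succ_self]

theorem openLoop_add (S : ControlSystem dx du) (x y : Vec dx) (u v : ℕ → Vec du) (t : ℕ) :
    S.openLoop (x + y) (u + v) t = S.openLoop x u t + S.openLoop y v t := by
  induction t with
  | zero => rfl
  | succ t ih => rw [openLoop, openLoop, openLoop, ih, Pi.add_apply, step_add]

theorem openLoop_smul (S : ControlSystem dx du) (c : ℝ) (x : Vec dx) (u : ℕ → Vec du) (t : ℕ) :
    S.openLoop (c • x) (c • u) t = c • S.openLoop x u t := by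
  induction t with
  | zero => rfl
  | succ t ih => rw [openLoop, openLoop, ih, Pi.smul_apply, step_smul]

theorem V_congr (S : ControlSystem dx du) (x : Vec dx) {u v : ℕ → Vec du}
    (h : ∀ k < S.N, u k = v k) : S.V x u = S.V x v := by
  rw [V, V, S.openLoop_congr x h]
  congr 1
  refine Finset.sum_congr rfl fun k hk => ?_
  have hk := Finset.mem_range.1 hk
  rw [h k hk, S.openLoop_congr x fun j hj => h j (hj.trans hk)]

theorem Admissible.congr {x : Vec dx} {u v : ℕ → Vec du}
    (h : ∀ k < S.N, u k = v k) (hu : S.Admissible Z x u) : S.Admissible Z x v := by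
  refine ⟨fun k hk => ?_, ?_⟩
  · rw [← h k hk, ← S.openLoop_congr x fun j hj => h j (hj.trans hk)]
    exact hu.1 k hk
  · rw [← S.openLoop_congr x h]
    exact hu.2

/-- Completion of squares telescopes because the terminal weight is the Riccati solution. For a
fixed initial state the objective thus only penalizes deviations from the LQR inputs. -/
theorem Standing.V_eq (hS : S.Standing) (x : Vec dx) (u : ℕ → Vec du) :
    S.V x u = quadForm S.P x
      + ∑ k ∈ Finset.range S.N, quadForm S.inputWeight (u k - mv S.K (S.openLoop x u k)) := by
  rw [V]
  generalize S.N = n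
  induction n with
  | zero => simp [openLoop]
  | succ n ih =>
    have h := hS.stageCost_add_step (S.openLoop x u n) (u n)
    rw [Finset.sum_range_succ, Finset.sum_range_succ, openLoop]
    linarith

theorem Standing.quadForm_inputWeight_nonneg (hS : S.Standing) (v : Vec du) :
    0 ≤ quadForm S.inputWeight v := quadForm_nonneg hS.inputWeight_posDef.posSemidef v

theorem Standing.quadForm_le_V (hS : S.Standing) (x : Vec dx) (u : ℕ → Vec du) :
    quadForm S.P x ≤ S.V x u := by
  rw [hS.V_eq]
  exact le_add_of_nonneg_right (Finset.sum_nonneg fun k _ => hS.quadForm_inputWeight_nonneg _)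

end OpenLoop

section TerminalSet

theorem rollout_lqr (S : ControlSystem dx du) (x : Vec dx) (t : ℕ) :
    S.rollout (fun _ => S.lqr) x t = mv (S.AK ^ t) x := by
  induction t with
  | zero => simp [rollout, mv_one]
  | succ t ih => rw [rollout, ih, lqr, step_lqr, ← mv_mul, ← pow_succ']

/-- The set described on the right is itself positively invariant, so the maximal invariant set is
an explicit intersection of constraints along LQR orbits. -/
theorem mem_tightO_iff {x : Vec dx} : x ∈ S.tightO Z ↔
    ∀ t : ℕ, mv (S.AK ^ t) x ∈ S.tightX Z ∧ mv S.K (mv (S.AK ^ t) x) ∈ S.tightU Z := by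
  constructor
  · rintro ⟨O, ⟨hO1, hO2⟩, hx⟩ t
    have := hO2 x hx t
    rw [rollout_lqr] at this
    exact ⟨hO1 this.1, this.2⟩
  · intro h
    refine ⟨{y | ∀ t : ℕ, mv (S.AK ^ t) y ∈ S.tightX Z ∧
      mv S.K (mv (S.AK ^ t) y) ∈ S.tightU Z}, ⟨fun y hy => ?_, fun y hy t => ?_⟩, h⟩
    · have := (hy 0).1
      rwa [pow_zero, mv_one] at this
    · rw [rollout_lqr]
      refine ⟨fun s => ?_, (hy t).2⟩
      rw [← mv_mul, ← pow_add]
      exact hy (s + t)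

theorem mv_AK_mem_tightO {x : Vec dx} (hx : x ∈ S.tightO Z) : mv S.AK x ∈ S.tightO Z := by
  rw [mem_tightO_iff] at hx ⊢
  intro t
  rw [← mv_mul, ← pow_succ]
  exact hx (t + 1)

theorem tightO_subset {x : Vec dx} (hx : x ∈ S.tightO Z) :
    x ∈ S.tightX Z ∧ mv S.K x ∈ S.tightU Z := by
  have := mem_tightO_iff.1 hx 0
  rwa [pow_zero, mv_one] at this

theorem Standing.isClosed_tightX (hS : S.Standing) : IsClosed (S.tightX Z) :=
  isClosed_pontryaginDiff hS.X_polyhedron.isClosed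

theorem Standing.isClosed_tightU (hS : S.Standing) : IsClosed (S.tightU Z) :=
  isClosed_pontryaginDiff hS.U_polyhedron.isClosed

theorem Standing.convex_tightX (hS : S.Standing) : Convex ℝ (S.tightX Z) :=
  convex_pontryaginDiff hS.X_polyhedron.convex

theorem Standing.convex_tightU (hS : S.Standing) : Convex ℝ (S.tightU Z) :=
  convex_pontryaginDiff hS.U_polyhedron.convex

theorem Standing.isClosed_tightO (hS : S.Standing) : IsClosed (S.tightO Z) := by
  have : S.tightO Z = ⋂ t : ℕ, (mv (S.AK ^ t) ⁻¹' S.tightX Z) ∩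
      (fun x => mv S.K (mv (S.AK ^ t) x)) ⁻¹' S.tightU Z := by
    ext x
    simp [mem_tightO_iff]
  rw [this]
  exact isClosed_iInter fun t => (hS.isClosed_tightX.preimage (continuous_mv _)).inter
    (hS.isClosed_tightU.preimage ((continuous_mv _).comp (continuous_mv _)))

theorem Standing.convex_tightO (hS : S.Standing) : Convex ℝ (S.tightO Z) := by
  intro x hx y hy a b ha hb hab
  rw [mem_tightO_iff] at *
  intro t
  simp only [mv_add, mv_smul]
  exact ⟨hS.convex_tightX (hx t).1 (hy t).1 ha hb hab,
    hS.convex_tightU (hx t).2 (hy t).2 ha hb hab⟩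

theorem add_mem_of_mem_tightX {x z : Vec dx} (hx : x ∈ S.tightX Z) (hz : z ∈ Z) : x + z ∈ S.X :=
  hx.2 z hz

theorem add_mem_of_mem_tightU {u : Vec du} {z : Vec dx} (hu : u ∈ S.tightU Z) (hz : z ∈ Z) :
    u + mv S.K z ∈ S.U := hu.2 _ ⟨z, hz, rfl⟩

end TerminalSet

section Admissible

theorem Standing.convex_admissible (hS : S.Standing) {x y : Vec dx} {u v : ℕ → Vec du}
    (hx : S.Admissible Z x u) (hy : S.Admissible Z y v) {a b : ℝ} (ha : 0 ≤ a) (hb : 0 ≤ b)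
    (hab : a + b = 1) : S.Admissible Z (a • x + b • y) (a • u + b • v) := by
  refine ⟨fun k hk => ?_, ?_⟩
  · rw [openLoop_add, openLoop_smul, openLoop_smul]
    exact ⟨hS.convex_tightX (hx.1 k hk).1 (hy.1 k hk).1 ha hb hab,
      hS.convex_tightU (hx.1 k hk).2 (hy.1 k hk).2 ha hb hab⟩
  · rw [openLoop_add, openLoop_smul, openLoop_smul]
    exact hS.convex_tightO hx.2 hy.2 ha hb hab

theorem mem_backwardReach_iff (X : Set (Vec dx)) (U : Set (Vec du)) (Xf : Set (Vec dx)) (k : ℕ)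
    (x : Vec dx) : x ∈ S.backwardReach X U Xf k ↔ ∃ u : ℕ → Vec du,
      (∀ j < k, S.openLoop x u j ∈ X ∧ u j ∈ U) ∧ S.openLoop x u k ∈ Xf := by
  induction k generalizing x with
  | zero => simp [backwardReach, openLoop]
  | succ k ih =>
    constructor
    · rintro ⟨hx, u₀, hu₀, h⟩
      obtain ⟨u, hu, huf⟩ := (ih _).1 h
      refine ⟨fun j => j.casesOn u₀ u, fun j hj => ?_, ?_⟩
      · cases j with
        | zero => exact ⟨hx, hu₀⟩
        | succ j =>
          rw [openLoop_succ_left]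
          exact hu j (Nat.lt_of_succ_lt_succ hj)
      · rw [openLoop_succ_left]
        exact huf
    · rintro ⟨u, hu, huf⟩
      refine ⟨(hu 0 k.succ_pos).1, u 0, (hu 0 k.succ_pos).2, (ih _).2
        ⟨fun j => u (j + 1), fun j hj => ?_, ?_⟩⟩
      · rw [← openLoop_succ_left]
        exact hu (j + 1) (Nat.succ_lt_succ hj)
      · rw [← openLoop_succ_left]
        exact huf

theorem mem_feasible_iff {x : Vec dx} : x ∈ S.feasible Z ↔ ∃ u, S.Admissible Z x u :=
  mem_backwardReach_iff _ _ _ _ _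

/-- The candidate input sequence at the next state: the tail of `u`, followed by LQR. -/
noncomputable def shiftInput (S : ControlSystem dx du) (x : Vec dx) (u : ℕ → Vec du) :
    ℕ → Vec du :=
  fun k => if k + 1 < S.N then u (k + 1) else mv S.K (S.openLoop x u S.N)

theorem openLoop_shiftInput (S : ControlSystem dx du) (x : Vec dx) (u : ℕ → Vec du) {k : ℕ}
    (hk : k + 1 ≤ S.N) : S.openLoop (S.step x (u 0)) (S.shiftInput x u) k
      = S.openLoop x u (k + 1) := by
  rw [openLoop_succ_left]
  refine S.openLoop_congr _ fun j hj => ?_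
  rw [shiftInput, if_pos (by omega)]

theorem openLoop_shiftInput_last (hS : S.Standing) (x : Vec dx) (u : ℕ → Vec du) :
    S.openLoop (S.step x (u 0)) (S.shiftInput x u) S.N = mv S.AK (S.openLoop x u S.N) := by
  obtain ⟨n, hn⟩ := Nat.exists_eq_succ_of_ne_zero hS.N_pos.ne'
  have h1 := S.openLoop_shiftInput x u hn.ge
  conv_lhs => rw [hn, openLoop, h1, ← Nat.succ_eq_add_one, ← hn]
  rw [shiftInput, if_neg (by omega), step_lqr]

/-- The appended LQR step is allowed because the terminal set lies in the constraints and is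
invariant. -/
theorem Admissible.shift (hS : S.Standing) {x : Vec dx} {u : ℕ → Vec du}
    (h : S.Admissible Z x u) : S.Admissible Z (S.step x (u 0)) (S.shiftInput x u) := by
  refine ⟨fun k hk => ?_, ?_⟩
  · rw [S.openLoop_shiftInput x u hk, shiftInput]
    split_ifs with h1
    · exact h.1 (k + 1) h1
    · have hk' : k + 1 = S.N := by omega
      rw [hk']
      exact tightO_subset h.2
  · rw [openLoop_shiftInput_last hS]
    exact mv_AK_mem_tightO h.2

/-- The appended LQR step costs exactly what the terminal term loses, so the shift yields an
equality. -/
theorem Standing.V_shift (hS : S.Standing) (x : Vec dx) (u : ℕ → Vec du) :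
    S.V (S.step x (u 0)) (S.shiftInput x u) = S.V x u - S.stageCost x (u 0) := by
  obtain ⟨n, hn⟩ := Nat.exists_eq_succ_of_ne_zero hS.N_pos.ne'
  have hlast := openLoop_shiftInput_last hS x u
  have hN := hS.stageCost_add_step (S.openLoop x u S.N) (mv S.K (S.openLoop x u S.N))
  rw [step_lqr, sub_self] at hN
  have h0 : quadForm S.inputWeight (0 : Vec du) = 0 := by simp [quadForm]
  rw [V, V, hlast]
  have e1 : ∑ k ∈ Finset.range S.N, S.stageCost (S.openLoop (S.step x (u 0)) (S.shiftInput x u) k)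
      (S.shiftInput x u k) = (∑ k ∈ Finset.range n, S.stageCost (S.openLoop x u (k + 1)) (u (k + 1)))
        + S.stageCost (S.openLoop x u S.N) (mv S.K (S.openLoop x u S.N)) := by
    nth_rewrite 1 [hn]
    rw [Finset.sum_range_succ]
    congr 1
    · refine Finset.sum_congr rfl fun k hk => ?_
      have hk := Finset.mem_range.1 hk
      rw [S.openLoop_shiftInput x u (by omega), shiftInput, if_pos (by omega)]
    · rw [S.openLoop_shiftInput x u (by omega), shiftInput, if_neg (by omega), ← Nat.succ_eq_add_one,
        ← hn]
  have e2 : ∑ k ∈ Finset.range S.N, S.stageCost (S.openLoop x u k) (u k)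
      = (∑ k ∈ Finset.range n, S.stageCost (S.openLoop x u (k + 1)) (u (k + 1)))
        + S.stageCost x (u 0) := by
    rw [hn, Finset.sum_range_succ']
    rfl
  rw [e1, e2]
  linarith

/-- The LQR input sequence. -/
noncomputable def lqrInput (S : ControlSystem dx du) (x : Vec dx) : ℕ → Vec du :=
  fun k => mv S.K (mv (S.AK ^ k) x)

theorem openLoop_lqrInput (S : ControlSystem dx du) (x : Vec dx) (t : ℕ) :
    S.openLoop x (S.lqrInput x) t = mv (S.AK ^ t) x := by
  induction t with
  | zero => simp [openLoop, mv_one]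
  | succ t ih => rw [openLoop, ih, lqrInput, step_lqr, ← mv_mul, ← pow_succ']

theorem admissible_lqrInput {x : Vec dx} (hx : x ∈ S.tightO Z) :
    S.Admissible Z x (S.lqrInput x) := by
  refine ⟨fun k _ => ?_, ?_⟩
  · rw [openLoop_lqrInput]
    exact mem_tightO_iff.1 hx k
  · rw [openLoop_lqrInput, mem_tightO_iff]
    intro t
    rw [← mv_mul, ← pow_add]
    exact mem_tightO_iff.1 hx _

theorem tightO_subset_feasible : S.tightO Z ⊆ S.feasible Z :=
  fun _ hx => mem_feasible_iff.2 ⟨_, admissible_lqrInput hx⟩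

theorem Standing.V_lqrInput (hS : S.Standing) (x : Vec dx) :
    S.V x (S.lqrInput x) = quadForm S.P x := by
  rw [hS.V_eq, Finset.sum_eq_zero, add_zero]
  intro k _
  rw [openLoop_lqrInput, lqrInput, sub_self]
  simp [quadForm]

/-- In the terminal set the LQR inputs are admissible and attain the unconstrained lower bound xᵀPx,
so the weighted deviations of an optimal sequence sum to zero. -/
theorem Standing.first_input_of_mem_tightO (hS : S.Standing) {x : Vec dx} {u : ℕ → Vec du}
    (hu : S.IsMPCOptimal Z x u) (hx : x ∈ S.tightO Z) : u 0 = mv S.K x := by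
  have h1 := hu.2 _ (admissible_lqrInput hx)
  rw [hS.V_lqrInput, hS.V_eq] at h1
  have h2 := Finset.single_le_sum (f := fun k => quadForm S.inputWeight
    (u k - mv S.K (S.openLoop x u k))) (fun k _ => hS.quadForm_inputWeight_nonneg _)
    (Finset.mem_range.2 hS.N_pos)
  by_contra hne
  have h3 := quadForm_pos hS.inputWeight_posDef (sub_ne_zero.2 hne)
  simp only [openLoop] at h2
  linarith

theorem Admissible.step_mem_feasible (hS : S.Standing) {x : Vec dx} {u : ℕ → Vec du}
    (h : S.Admissible Z x u) : S.step x (u 0) ∈ S.feasible Z :=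
  mem_feasible_iff.2 ⟨_, h.shift hS⟩

theorem Admissible.mem_tightX (hS : S.Standing) {x : Vec dx} {u : ℕ → Vec du}
    (h : S.Admissible Z x u) : x ∈ S.tightX Z := (h.1 0 hS.N_pos).1

theorem Admissible.mem_tightU (hS : S.Standing) {x : Vec dx} {u : ℕ → Vec du}
    (h : S.Admissible Z x u) : u 0 ∈ S.tightU Z := (h.1 0 hS.N_pos).2

theorem IsMPCOptimal.V_step_le (hS : S.Standing) {x : Vec dx} {u v : ℕ → Vec du}
    (h : S.IsMPCOptimal Z x u) (h' : S.IsMPCOptimal Z (S.step x (u 0)) v) :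
    S.V (S.step x (u 0)) v ≤ S.V x u - S.stageCost x (u 0) := by
  rw [← hS.V_shift]
  exact h'.2 _ (h.1.shift hS)

end Admissible

section Robust

variable {ε : ℝ}

/-- Freezing the optimal nominal start leaves a tightened MPC problem, whose admissible inputs all
compete in the robust problem. -/
theorem IsRMPCOptimal.isMPCOptimal {x y : Vec dx} {u : ℕ → Vec du}
    (h : S.IsRMPCOptimal Z x y u) : S.IsMPCOptimal Z y u :=
  ⟨h.1.2, fun v hv => h.2 y v h.1.1 hv⟩

/-- The feedback on the tube error makes it evolve by `A + B K` plus the disturbance, whatever the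
nominal input is. -/
theorem IsDisturbanceInvariant.sub_mem (hZ : S.IsDisturbanceInvariant (closedBall 0 ε) Z)
    {x y w : Vec dx} (u : Vec du) (hxy : x - y ∈ Z) (hw : ‖w‖ ≤ ε) :
    S.step x (u + mv S.K (x - y)) + w - S.step y u ∈ Z := by
  have e : S.step x (u + mv S.K (x - y)) + w - S.step y u = mv S.AK (x - y) + w := by
    rw [add_sub_right_comm, ← step_sub, add_sub_cancel_left, step_lqr]
  rw [e]
  exact hZ.2 (Set.add_mem_add ⟨_, hxy, rfl⟩ (by simpa using hw))

theorem mem_X_of_sub_mem {x y : Vec dx} (hy : y ∈ S.tightX Z) (hxy : x - y ∈ Z) : x ∈ S.X := by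
  have := add_mem_of_mem_tightX hy hxy
  rwa [add_sub_cancel] at this

theorem mem_domain_of_sub_mem (hS : S.Standing) {x y : Vec dx} {u : ℕ → Vec du}
    (hy : S.Admissible Z y u) (hxy : x - y ∈ Z) : x ∈ (S.feasible Z + Z) ∩ S.X :=
  ⟨⟨y, mem_feasible_iff.2 ⟨u, hy⟩, x - y, hxy, by simp⟩, mem_X_of_sub_mem (hy.mem_tightX hS) hxy⟩

theorem IsDisturbanceInvariant.mem_domain_of_feasible (hS : S.Standing)
    (hZ : S.IsDisturbanceInvariant (closedBall 0 ε) Z) {x : Vec dx} (hx : x ∈ S.feasible Z) :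
    x ∈ (S.feasible Z + Z) ∩ S.X := by
  obtain ⟨u, hu⟩ := mem_feasible_iff.1 hx
  exact mem_domain_of_sub_mem hS hu (by simpa using mem_of_mem_nhds hZ.1)

theorem IsRMPCOptimal.step_mem_domain (hS : S.Standing)
    (hZ : S.IsDisturbanceInvariant (closedBall 0 ε) Z) {x y w : Vec dx} {u : ℕ → Vec du}
    (h : S.IsRMPCOptimal Z x y u) (hw : ‖w‖ ≤ ε) :
    S.step x (u 0 + mv S.K (x - y)) + w ∈ (S.feasible Z + Z) ∩ S.X :=
  mem_domain_of_sub_mem hS (h.1.2.shift hS) (hZ.sub_mem _ h.1.1 hw)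

/-- The shifted nominal plan remains a competitor after any admissible disturbance, because the new
state is still within `Z` of the nominal successor. Disturbances therefore never raise the optimal
value. -/
theorem IsRMPCOptimal.V_step_le (hS : S.Standing)
    (hZ : S.IsDisturbanceInvariant (closedBall 0 ε) Z) {x y w y' : Vec dx} {u u' : ℕ → Vec du}
    (h : S.IsRMPCOptimal Z x y u) (hw : ‖w‖ ≤ ε)
    (h' : S.IsRMPCOptimal Z (S.step x (u 0 + mv S.K (x - y)) + w) y' u') :
    S.V y' u' ≤ S.V y u := by
  have h1 := h'.2 _ _ (hZ.sub_mem _ h.1.1 hw) (h.1.2.shift hS)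
  rw [hS.V_shift] at h1
  linarith [hS.stageCost_nonneg y (u 0)]

end Robust

end ControlSystem

/-! ### Tightened constraints and the quadratic program, uniformly in the tightening -/

section Tightening

variable {n : ℕ} {X Y : Set (Vec n)}

/-- Around each of its points, a tightened polyhedron is cut out by the active rows. -/
theorem exists_rows_pontryaginDiff {m : ℕ} {a : Fin m → Vec n} {b : Fin m → ℝ}
    (hX : X = {x | ∀ i, inner ℝ (a i) x ≤ b i}) (h0 : (0 : Vec n) ∈ Y)
    (hY : Bornology.IsBounded Y) :
    ∃ h : Fin m → ℝ, ∀ p ∈ pontryaginDiff X Y, ∀ v : Vec n,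
      (∀ i, inner ℝ (a i) p = h i → inner ℝ (a i) v = 0) →
      ∀ᶠ c : ℝ in 𝓝 0, p + c • v ∈ pontryaginDiff X Y := by
  subst hX
  obtain ⟨M, hM⟩ := hY.exists_norm_le
  have hbdd : ∀ i, BddBelow ((fun y => b i - inner ℝ (a i) y) '' Y) := by
    intro i
    refine ⟨b i - ‖a i‖ * M, ?_⟩
    rintro _ ⟨y, hy, rfl⟩
    have h1 := (le_abs_self _).trans (abs_real_inner_le_norm (a i) y)
    have h2 := mul_le_mul_of_nonneg_left (hM y hy) (norm_nonneg (a i))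
    simp only
    linarith
  -- Tightening keeps the rows and replaces each right hand side by its worst case over `Y`;
  -- boundedness of `Y` makes the infimum finite.
  set h : Fin m → ℝ := fun i => sInf ((fun y => b i - inner ℝ (a i) y) '' Y)
  have hmem : ∀ p, p ∈ pontryaginDiff {x | ∀ i, inner ℝ (a i) x ≤ b i} Y ↔
      ∀ i, inner ℝ (a i) p ≤ h i := by
    intro p
    constructor
    · rintro ⟨-, hp⟩ i
      refine le_csInf (Set.Nonempty.image _ ⟨0, h0⟩) ?_
      rintro _ ⟨y, hy, rfl⟩
      have := hp y hy i
      rw [inner_add_right] at this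
      simp only
      linarith
    · intro hp
      have key : ∀ y ∈ Y, ∀ i, inner ℝ (a i) (p + y) ≤ b i := by
        intro y hy i
        have := (hp i).trans (csInf_le (hbdd i) ⟨y, hy, rfl⟩)
        simp only at this
        rw [inner_add_right]
        linarith
      exact ⟨fun i => by simpa only [add_zero] using key 0 h0 i, key⟩
  refine ⟨h, fun p hp v hv => ?_⟩
  simp only [hmem] at hp ⊢
  rw [Filter.eventually_all]
  intro i
  rcases eq_or_lt_of_le (hp i) with h1 | h1
  · refine Filter.Eventually.of_forall fun c => ?_
    rw [inner_add_right, inner_smul_right, hv i h1, mul_zero, add_zero, h1]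
  · have hc : Continuous fun c : ℝ => inner ℝ (a i) (p + c • v) := by fun_prop
    have h2 : inner ℝ (a i) (p + (0 : ℝ) • v) < h i := by simpa using h1
    exact (hc.continuousAt.eventually_lt continuousAt_const h2).mono fun c hc => hc.le

end Tightening

namespace ControlSystem

variable {dx du : ℕ} {S : ControlSystem dx du} {Z : Set (Vec dx)} {ρ σ : ℝ}

theorem norm_AK_pow_le (hdecay : ∀ k : ℕ, opNorm (S.AK ^ k) ≤ σ * ρ ^ k) (k : ℕ) (x : Vec dx) :
    ‖mv (S.AK ^ k) x‖ ≤ σ * ρ ^ k * ‖x‖ :=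
  (norm_mv_le _ _).trans (mul_le_mul_of_nonneg_right (hdecay k) (norm_nonneg x))

theorem tendsto_AK_pow (hρ0 : 0 < ρ) (hρ1 : ρ < 1)
    (hdecay : ∀ k : ℕ, opNorm (S.AK ^ k) ≤ σ * ρ ^ k) (x : Vec dx) :
    Filter.Tendsto (fun k => mv (S.AK ^ k) x) Filter.atTop (𝓝 0) := by
  refine squeeze_zero_norm (norm_AK_pow_le hdecay · x) ?_
  have := ((tendsto_pow_atTop_nhds_zero_of_lt_one hρ0.le hρ1).const_mul σ).mul_const ‖x‖
  simpa using this

/-- A nonempty terminal set forces the tightened constraint sets to contain the origin. -/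
theorem Standing.subset_of_tightO_nonempty (hS : S.Standing) (hρ0 : 0 < ρ) (hρ1 : ρ < 1)
    (hdecay : ∀ k : ℕ, opNorm (S.AK ^ k) ≤ σ * ρ ^ k) (hne : (S.tightO Z).Nonempty) :
    Z ⊆ S.X ∩ mv S.K ⁻¹' S.U := by
  obtain ⟨x, hx⟩ := hne
  have hlim := tendsto_AK_pow hρ0 hρ1 hdecay x
  have h1 := mem_tightO_iff.1 hx
  have h2 : (0 : Vec dx) ∈ S.tightX Z :=
    hS.isClosed_tightX.mem_of_tendsto hlim (Filter.Eventually.of_forall fun t => (h1 t).1)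
  have h3 : (0 : Vec du) ∈ S.tightU Z := by
    have := ((continuous_mv S.K).tendsto 0).comp hlim
    rw [mv_zero] at this
    exact hS.isClosed_tightU.mem_of_tendsto this (Filter.Eventually.of_forall fun t => (h1 t).2)
  intro z hz
  refine ⟨?_, ?_⟩
  · simpa using add_mem_of_mem_tightX h2 hz
  · simpa using add_mem_of_mem_tightU h3 hz

/-- For small disturbances, the tightened constraints contain a fixed ball. -/
theorem Standing.exists_ball_subset_tight (hS : S.Standing) (hρ0 : 0 < ρ) (hρ1 : ρ < 1)
    (hσ : 0 < σ) (hdecay : ∀ k : ℕ, opNorm (S.AK ^ k) ≤ σ * ρ ^ k) :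
    ∃ ε₀ > 0, ∃ r > 0, ∀ ε ≤ ε₀, ∀ Z : Set (Vec dx), Z ∈ 𝓝 (0 : Vec dx) →
      Z ⊆ closedBall 0 (σ / (1 - ρ) * ε) → (S.tightO Z).Nonempty →
      ∀ x : Vec dx, ‖x‖ ≤ r → x ∈ S.tightX Z ∧ mv S.K x ∈ S.tightU Z := by
  -- If the constraints do not contain a neighbourhood of the origin, no neighbourhood `Z` fits
  -- inside them, the terminal set is empty and the claim is vacuous. Otherwise half of a ball
  -- inside them survives any tightening of size at most r / 2.
  by_cases hn : S.X ∩ mv S.K ⁻¹' S.U ∈ 𝓝 (0 : Vec dx)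
  · obtain ⟨r, hr, hball⟩ := Metric.nhds_basis_closedBall.mem_iff.1 hn
    have hκ : 0 < σ / (1 - ρ) := div_pos hσ (sub_pos.2 hρ1)
    refine ⟨r / 2 / (σ / (1 - ρ)), by positivity, r / 2, by positivity, ?_⟩
    intro ε hε Z _ hZ _ x hx
    have key : ∀ z ∈ Z, x + z ∈ S.X ∩ mv S.K ⁻¹' S.U := by
      intro z hz
      apply hball
      have h1 : ‖z‖ ≤ σ / (1 - ρ) * ε := by simpa using hZ hz
      rw [le_div_iff₀' hκ] at hε
      rw [mem_closedBall, dist_zero_right]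
      linarith [norm_add_le x z]
    have hx0 : x ∈ S.X ∩ mv S.K ⁻¹' S.U := by
      apply hball
      rw [mem_closedBall, dist_zero_right]
      linarith
    refine ⟨⟨hx0.1, fun z hz => (key z hz).1⟩, ⟨hx0.2, ?_⟩⟩
    rintro _ ⟨z, hz, rfl⟩
    rw [← mv_add]
    exact (key z hz).2
  · refine ⟨1, one_pos, 1, one_pos, fun ε _ Z hZ _ hne => ?_⟩
    exact absurd (Filter.mem_of_superset hZ
      (hS.subset_of_tightO_nonempty hρ0 hρ1 hdecay hne)) hn

/-- The LQR orbit never leaves the ball of radius σ‖x‖. -/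
theorem mem_tightO_of_norm_le (hρ0 : 0 < ρ) (hρ1 : ρ < 1) (hσ : 0 < σ)
    (hdecay : ∀ k : ℕ, opNorm (S.AK ^ k) ≤ σ * ρ ^ k) {r : ℝ}
    (hr : ∀ x : Vec dx, ‖x‖ ≤ r → x ∈ S.tightX Z ∧ mv S.K x ∈ S.tightU Z) {x : Vec dx}
    (hx : σ * ‖x‖ ≤ r) : x ∈ S.tightO Z := by
  rw [mem_tightO_iff]
  intro t
  apply hr
  refine (norm_AK_pow_le hdecay t x).trans (le_trans ?_ hx)
  have : ρ ^ t ≤ 1 := pow_le_one₀ hρ0.le hρ1.le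
  nlinarith [mul_nonneg hσ.le (norm_nonneg x)]

theorem Standing.norm_le_inputBound (hS : S.Standing) {u : Vec du} (hu : u ∈ S.U) :
    ‖u‖ ≤ S.inputBound := by
  obtain ⟨M, hM⟩ := hS.U_bounded.exists_norm_le
  refine le_csSup ⟨M, ?_⟩ ⟨u, hu, rfl⟩
  rintro _ ⟨v, hv, rfl⟩
  exact hM v hv

/-- The state constraints may be unbounded, but the inputs are bounded, and finitely many steps from
a bounded state stay bounded. -/
theorem Standing.exists_openLoop_bound (hS : S.Standing) (β : ℝ) (n : ℕ) :
    ∃ β' : ℝ, 0 ≤ β' ∧ ∀ (x : Vec dx) (u : ℕ → Vec du), ‖x‖ ≤ β → (∀ k < n, u k ∈ S.U) →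
      ∀ k ≤ n, ‖S.openLoop x u k‖ ≤ β' := by
  induction n with
  | zero =>
    refine ⟨|β|, abs_nonneg _, fun x u hx _ k hk => ?_⟩
    obtain rfl := Nat.le_zero.1 hk
    exact hx.trans (le_abs_self β)
  | succ n ih =>
    obtain ⟨β', hβ', h⟩ := ih
    refine ⟨max β' (opNorm S.A * β' + opNorm S.B * S.inputBound), hβ'.trans (le_max_left _ _),
      fun x u hx hu k hk => ?_⟩
    have h1 := h x u hx fun k hk => hu k (hk.trans n.lt_succ_self)
    obtain rfl | hk := eq_or_lt_of_le hk
    · refine le_trans ?_ (le_max_right _ _)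
      refine (S.norm_step_le _ _).trans (add_le_add ?_ ?_)
      · exact mul_le_mul_of_nonneg_left (h1 n le_rfl) (opNorm_nonneg _)
      · exact mul_le_mul_of_nonneg_left (hS.norm_le_inputBound (hu n n.lt_succ_self))
          (opNorm_nonneg _)
    · exact (h1 k (Nat.lt_succ_iff.1 hk)).trans (le_max_left _ _)

section QuadraticProgram

/-- Extension of a finite input sequence by zero. -/
noncomputable def extendInput {n : ℕ} (u : Fin n → Vec du) : ℕ → Vec du :=
  fun k => if h : k < n then u ⟨k, h⟩ else 0

theorem extendInput_restrict {n : ℕ} (u : ℕ → Vec du) {k : ℕ} (hk : k < n) :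
    extendInput (fun i : Fin n => u i) k = u k := by
  simp [extendInput, hk]

/-- The input at time `k`, as a linear map. -/
noncomputable def inputMap (S : ControlSystem dx du) (k : ℕ) :
    Vec dx × (Fin S.N → Vec du) →ₗ[ℝ] Vec du where
  toFun z := extendInput z.2 k
  map_add' z z' := by
    simp only [extendInput]
    split_ifs <;> simp
  map_smul' c z := by
    simp only [extendInput]
    split_ifs <;> simp

theorem extendInput_add {n : ℕ} (u v : Fin n → Vec du) :
    extendInput (u + v) = extendInput u + extendInput v := by
  ext1 k
  simp only [extendInput, Pi.add_apply]
  split_ifs <;> simp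

theorem extendInput_smul {n : ℕ} (c : ℝ) (u : Fin n → Vec du) :
    extendInput (c • u) = c • extendInput u := by
  ext1 k
  simp only [extendInput, Pi.smul_apply]
  split_ifs <;> simp

/-- The state at time `k`, as a linear map of the initial state and the inputs. -/
noncomputable def stateMap (S : ControlSystem dx du) (k : ℕ) :
    Vec dx × (Fin S.N → Vec du) →ₗ[ℝ] Vec dx where
  toFun z := S.openLoop z.1 (extendInput z.2) k
  map_add' z z' := by
    rw [Prod.fst_add, Prod.snd_add, extendInput_add, openLoop_add]
  map_smul' c z := by
    rw [Prod.smul_fst, Prod.smul_snd, extendInput_smul, openLoop_smul, RingHom.id_apply]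

/-- The bilinear form `⟨f z, M f z'⟩`. -/
noncomputable def pullbackForm {W : Type*} [AddCommGroup W] [Module ℝ W] {n : ℕ}
    (M : Matrix (Fin n) (Fin n) ℝ) (f : W →ₗ[ℝ] Vec n) : LinearMap.BilinForm ℝ W :=
  (innerₗ (Vec n)).compl₁₂ f ((Matrix.toEuclideanLin M).comp f)

theorem pullbackForm_apply {W : Type*} [AddCommGroup W] [Module ℝ W] {n : ℕ}
    (M : Matrix (Fin n) (Fin n) ℝ) (f : W →ₗ[ℝ] Vec n) (z z' : W) :
    pullbackForm M f z z' = inner ℝ (f z) (mv M (f z')) := rfl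

theorem pullbackForm_symm {W : Type*} [AddCommGroup W] [Module ℝ W] {n : ℕ}
    {M : Matrix (Fin n) (Fin n) ℝ} (hM : M.IsHermitian) (f : W →ₗ[ℝ] Vec n) (z z' : W) :
    pullbackForm M f z z' = pullbackForm M f z' z := by
  have hT : M.transpose = M := by
    have := hM.eq
    rwa [Matrix.conjTranspose_eq_transpose_of_trivial] at this
  rw [pullbackForm_apply, pullbackForm_apply, real_inner_comm, inner_mv, hT]

/-- The bilinear form of the finite-horizon objective. -/
noncomputable def valueForm (S : ControlSystem dx du) :
    LinearMap.BilinForm ℝ (Vec dx × (Fin S.N → Vec du)) :=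
  (∑ k ∈ Finset.range S.N, (pullbackForm S.Q (S.stateMap k) + pullbackForm S.R (S.inputMap k)))
    + pullbackForm S.P (S.stateMap S.N)

theorem valueForm_apply (S : ControlSystem dx du) (z z' : Vec dx × (Fin S.N → Vec du)) :
    S.valueForm z z' = (∑ k ∈ Finset.range S.N, (pullbackForm S.Q (S.stateMap k) z z'
      + pullbackForm S.R (S.inputMap k) z z')) + pullbackForm S.P (S.stateMap S.N) z z' := by
  simp [valueForm, LinearMap.sum_apply]

theorem valueForm_self (S : ControlSystem dx du) (z : Vec dx × (Fin S.N → Vec du)) :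
    S.valueForm z z = S.V z.1 (extendInput z.2) := by
  rw [valueForm_apply]
  rfl

theorem Standing.valueForm_symm (hS : S.Standing) (z z' : Vec dx × (Fin S.N → Vec du)) :
    S.valueForm z z' = S.valueForm z' z := by
  rw [valueForm_apply, valueForm_apply]
  simp only [pullbackForm_symm hS.Q_posSemidef.isHermitian _ z,
    pullbackForm_symm hS.R_posDef.isHermitian _ z, pullbackForm_symm hS.P_posDef.isHermitian _ z]

theorem Standing.valueForm_ge (hS : S.Standing) {μ : ℝ}
    (hR : ∀ u : Vec du, μ * ‖u‖ ^ 2 ≤ quadForm S.R u) (hμ : 0 < μ)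
    (z : Vec dx × (Fin S.N → Vec du)) : μ * ‖z.2‖ ^ 2 ≤ S.valueForm z z := by
  rw [valueForm_self, V]
  have h1 : ∀ k ∈ Finset.range S.N, μ * ‖extendInput z.2 k‖ ^ 2 ≤
      S.stageCost (S.openLoop z.1 (extendInput z.2) k) (extendInput z.2 k) := fun k _ =>
    (hR _).trans (le_add_of_nonneg_left (quadForm_nonneg hS.Q_posSemidef _))
  have h2 := quadForm_nonneg hS.P_posDef.posSemidef (S.openLoop z.1 (extendInput z.2) S.N)
  set T := ∑ k ∈ Finset.range S.N,
    S.stageCost (S.openLoop z.1 (extendInput z.2) k) (extendInput z.2 k) with hT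
  have hT0 : 0 ≤ T := Finset.sum_nonneg fun k _ => hS.stageCost_nonneg _ _
  -- The space of input sequences carries the sup norm, so bounding each single input by the whole
  -- sum is enough.
  have h3 : ‖z.2‖ ≤ Real.sqrt (T / μ) := by
    rw [pi_norm_le_iff_of_nonneg (Real.sqrt_nonneg _)]
    intro i
    refine Real.le_sqrt_of_sq_le ?_
    rw [le_div_iff₀' hμ]
    have h4 := h1 i (Finset.mem_range.2 i.2)
    have e : extendInput z.2 i = z.2 i := by simp [extendInput]
    rw [← e]
    refine h4.trans ?_
    exact Finset.single_le_sum (f := fun k =>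
      S.stageCost (S.openLoop z.1 (extendInput z.2) k) (extendInput z.2 k))
      (fun k _ => hS.stageCost_nonneg _ _) (Finset.mem_range.2 i.2)
  have h5 : ‖z.2‖ ^ 2 ≤ T / μ := by
    have := pow_le_pow_left₀ (norm_nonneg _) h3 2
    rwa [Real.sq_sqrt (by positivity)] at this
  rw [le_div_iff₀' hμ] at h5
  linarith

theorem continuous_valueForm_self (S : ControlSystem dx du) :
    Continuous fun z => S.valueForm z z := by
  have hx : ∀ k, Continuous (S.stateMap k) := fun k => LinearMap.continuous_of_finiteDimensional _
  have hu : ∀ k, Continuous (S.inputMap k) := fun k => LinearMap.continuous_of_finiteDimensional _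
  simp only [valueForm_apply, pullbackForm_apply]
  refine Continuous.add (continuous_finsetSum _ fun k _ => Continuous.add ?_ ?_) ?_
  · exact (hx k).inner ((continuous_mv _).comp (hx k))
  · exact (hu k).inner ((continuous_mv _).comp (hu k))
  · exact (hx _).inner ((continuous_mv _).comp (hx _))

end QuadraticProgram

end ControlSystem

/-! ### Lipschitz continuity of tightened MPC -/

namespace ControlSystem

variable {dx du : ℕ} {S : ControlSystem dx du} {Z : Set (Vec dx)} {ρ σ : ℝ}

/-- The cap on the base point keeps the predicted states bounded. Directions in the fiber do not
move the base point, so the cap adds no row. -/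
theorem isFiberMin_of_isMPCOptimal {β : ℝ} {x : Vec dx} {u : ℕ → Vec du} (hx : ‖x‖ ≤ β)
    (h : S.IsMPCOptimal Z x u) :
    IsFiberMin (fun z => S.valueForm z z)
      {z | ‖z.1‖ ≤ β ∧ S.Admissible Z z.1 (extendInput z.2)} x (fun i : Fin S.N => u i) := by
  have e : ∀ k < S.N, u k = extendInput (fun i : Fin S.N => u i) k := fun k hk =>
    (extendInput_restrict u hk).symm
  refine ⟨⟨hx, h.1.congr e⟩, fun v hv => ?_⟩
  simp only [valueForm_self]
  rw [← S.V_congr x e]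
  exact h.2 _ hv.2

/-- The states and inputs which the constraints act on: those up to the horizon, followed by those
of the LQR continuation. -/
noncomputable def constrainedState (S : ControlSystem dx du) (n : ℕ) :
    Fin S.N ⊕ Fin n → Vec dx × (Fin S.N → Vec du) →ₗ[ℝ] Vec dx
  | .inl k => S.stateMap k
  | .inr t => (Matrix.toEuclideanLin (S.AK ^ (t : ℕ))).comp (S.stateMap S.N)

/-- The inputs at the times of `constrainedState`. -/
noncomputable def constrainedInput (S : ControlSystem dx du) (n : ℕ) :
    Fin S.N ⊕ Fin n → Vec dx × (Fin S.N → Vec du) →ₗ[ℝ] Vec du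
  | .inl k => S.inputMap k
  | .inr t => (Matrix.toEuclideanLin S.K).comp
      ((Matrix.toEuclideanLin (S.AK ^ (t : ℕ))).comp (S.stateMap S.N))

/-- Terminal membership amounts to infinitely many constraints. Cutting them at time `n` separates
those that become rows of the program from those that hold automatically. -/
theorem admissible_iff_constrained (n : ℕ) (z : Vec dx × (Fin S.N → Vec du)) :
    S.Admissible Z z.1 (extendInput z.2) ↔
      (∀ j, S.constrainedState n j z ∈ S.tightX Z ∧ S.constrainedInput n j z ∈ S.tightU Z) ∧
      ∀ t ≥ n, mv (S.AK ^ t) (S.stateMap S.N z) ∈ S.tightX Z ∧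
        mv S.K (mv (S.AK ^ t) (S.stateMap S.N z)) ∈ S.tightU Z := by
  rw [Sum.forall, Admissible, mem_tightO_iff]
  constructor
  · rintro ⟨h1, h2⟩
    exact ⟨⟨fun k => h1 k k.2, fun t => h2 t⟩, fun t _ => h2 t⟩
  · rintro ⟨⟨h1, h2⟩, h3⟩
    refine ⟨fun k hk => h1 ⟨k, hk⟩, fun t => ?_⟩
    rcases lt_or_ge t n with ht | ht
    · exact h2 ⟨t, ht⟩
    · exact h3 t ht

theorem Standing.isClosed_admissible (hS : S.Standing) (β : ℝ) :
    IsClosed {z : Vec dx × (Fin S.N → Vec du) |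
      ‖z.1‖ ≤ β ∧ S.Admissible Z z.1 (extendInput z.2)} := by
  have hx : ∀ k, Continuous (S.stateMap k) := fun k => LinearMap.continuous_of_finiteDimensional _
  have hu : ∀ k, Continuous (S.inputMap k) := fun k => LinearMap.continuous_of_finiteDimensional _
  have e : {z : Vec dx × (Fin S.N → Vec du) | ‖z.1‖ ≤ β ∧ S.Admissible Z z.1 (extendInput z.2)}
      = {z | ‖z.1‖ ≤ β} ∩ ((⋂ k, ⋂ (_ : k < S.N), (S.stateMap k ⁻¹' S.tightX Z) ∩
        (S.inputMap k ⁻¹' S.tightU Z)) ∩ S.stateMap S.N ⁻¹' S.tightO Z) := by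
    ext z
    simp only [Set.mem_inter_iff, Set.mem_iInter, Set.mem_preimage]
    rfl
  rw [e]
  refine (isClosed_le (by fun_prop) continuous_const).inter (IsClosed.inter ?_ ?_)
  · exact isClosed_iInter fun k => isClosed_iInter fun _ =>
      (hS.isClosed_tightX.preimage (hx k)).inter (hS.isClosed_tightU.preimage (hu k))
  · exact hS.isClosed_tightO.preimage (hx _)

theorem Standing.convex_admissible_bounded (hS : S.Standing) (β : ℝ) :
    Convex ℝ {z : Vec dx × (Fin S.N → Vec du) |
      ‖z.1‖ ≤ β ∧ S.Admissible Z z.1 (extendInput z.2)} := by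
  rintro z ⟨hz, hz'⟩ y ⟨hy, hy'⟩ a b ha hb hab
  refine ⟨?_, ?_⟩
  · refine (norm_add_le _ _).trans ?_
    rw [Prod.smul_fst, Prod.smul_fst, norm_smul, norm_smul, Real.norm_of_nonneg ha,
      Real.norm_of_nonneg hb]
    calc a * ‖z.1‖ + b * ‖y.1‖ ≤ a * β + b * β := by gcongr
      _ = β := by rw [← add_mul, hab, one_mul]
  · have := hS.convex_admissible hz' hy' ha hb hab
    rw [← extendInput_smul, ← extendInput_smul, ← extendInput_add] at this
    exact this

/-- On bounded sets the tightened MPC controller is Lipschitz, with a constant which does not depend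
on the tightening. -/
theorem Standing.exists_lipschitz_tightMPC (hS : S.Standing) (hρ0 : 0 < ρ) (hρ1 : ρ < 1)
    (hσ : 0 < σ) (hdecay : ∀ k : ℕ, opNorm (S.AK ^ k) ≤ σ * ρ ^ k) {r : ℝ} (hr0 : 0 < r) (β : ℝ) :
    ∃ L : ℝ, 0 ≤ L ∧ ∀ Z : Set (Vec dx), (0 : Vec dx) ∈ Z → Bornology.IsBounded Z →
      (∀ x : Vec dx, ‖x‖ ≤ r → x ∈ S.tightX Z ∧ mv S.K x ∈ S.tightU Z) →
      ∀ π, S.IsTightMPC Z π → ∀ x ∈ S.feasible Z, ∀ y ∈ S.feasible Z, ‖x‖ ≤ β → ‖y‖ ≤ β →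
        ‖π x - π y‖ ≤ L * ‖x - y‖ := by
  obtain ⟨mX, a, b, hX⟩ := hS.X_polyhedron
  obtain ⟨mU, a', b', hU⟩ := hS.U_polyhedron
  obtain ⟨μ, hμ, hR⟩ := exists_quadForm_ge hS.R_posDef
  obtain ⟨β', hβ', hbound⟩ := hS.exists_openLoop_bound β S.N
  -- From time `n` on the LQR continuation lies in the ball of radius `r`, where all constraints
  -- hold. The extra one is a margin for small perturbations of the terminal state.
  obtain ⟨n, hn⟩ : ∃ n : ℕ, ∀ t ≥ n, σ * ρ ^ t * (β' + 1) ≤ r := by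
    have h1 := ((tendsto_pow_atTop_nhds_zero_of_lt_one hρ0.le hρ1).const_mul σ).mul_const (β' + 1)
    rw [mul_zero, zero_mul] at h1
    obtain ⟨n, hn⟩ := Filter.eventually_atTop.1 (h1.eventually (gt_mem_nhds hr0))
    exact ⟨n, fun t ht => (hn t ht).le⟩
  -- The rows are fixed before `Z` is introduced, hence so is the Lipschitz constant.
  let g : (Fin S.N ⊕ Fin n) × (Fin mX ⊕ Fin mU) → Vec dx × (Fin S.N → Vec du) →ₗ[ℝ] ℝ := fun p =>
    p.2.elim (fun i => (innerₗ (Vec dx) (a i)).comp (S.constrainedState n p.1))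
      (fun i => (innerₗ (Vec du) (a' i)).comp (S.constrainedInput n p.1))
  obtain ⟨L, hL0, hL⟩ := exists_lipschitz_fiberMin (q := S.valueForm) g hμ
    hS.valueForm_symm (hS.valueForm_ge hR hμ) S.continuous_valueForm_self
  refine ⟨L, hL0, ?_⟩
  intro Z h0 hZb hball π hπ x hx y hy hxβ hyβ
  obtain ⟨hx', hhx⟩ := exists_rows_pontryaginDiff hX h0 hZb
  obtain ⟨hu', hhu⟩ := exists_rows_pontryaginDiff (Y := mv S.K '' Z) hU ⟨0, h0, mv_zero _⟩ (by
    obtain ⟨M, hM⟩ := hZb.exists_norm_le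
    refine isBounded_iff_forall_norm_le.2 ⟨opNorm S.K * M, ?_⟩
    rintro _ ⟨z, hz, rfl⟩
    exact (norm_mv_le _ _).trans (mul_le_mul_of_nonneg_left (hM z hz) (opNorm_nonneg _)))
  obtain ⟨u, hu, hxu⟩ := hπ x hx
  obtain ⟨v, hv, hyv⟩ := hπ y hy
  have key := hL {z | ‖z.1‖ ≤ β ∧ S.Admissible Z z.1 (extendInput z.2)}
    (fun p => p.2.elim hx' hu') (hS.convex_admissible_bounded β) (hS.isClosed_admissible β) ?_ ?_
    x y _ _ (isFiberMin_of_isMPCOptimal hxβ hu) (isFiberMin_of_isMPCOptimal hyβ hv)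
  · refine le_trans ?_ key
    rw [hxu, hyv]
    exact norm_le_pi_norm ((fun i : Fin S.N => u i) - fun i : Fin S.N => v i) ⟨0, hS.N_pos⟩
  · rintro z ⟨hz1, hz2⟩ w hw
    have hev : ∀ᶠ c : ℝ in 𝓝 0, z + c • ((0 : Vec dx), w) ∈
        {z | ‖z.1‖ ≤ β ∧ S.Admissible Z z.1 (extendInput z.2)} := by
      have h1 := ((admissible_iff_constrained n z).1 hz2).1
      have hA : ∀ᶠ c : ℝ in 𝓝 0, ∀ j,
          S.constrainedState n j (z + c • ((0 : Vec dx), w)) ∈ S.tightX Z ∧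
          S.constrainedInput n j (z + c • ((0 : Vec dx), w)) ∈ S.tightU Z := by
        rw [Filter.eventually_all]
        intro j
        simp only [map_add, map_smul]
        refine (hhx _ (h1 j).1 _ fun i hi => ?_).and (hhu _ (h1 j).2 _ fun i hi => ?_)
        · exact hw (j, .inl i) hi
        · exact hw (j, .inr i) hi
      have hB : ∀ᶠ c : ℝ in 𝓝 0, ‖S.stateMap S.N (z + c • ((0 : Vec dx), w))‖ < β' + 1 := by
        have hc : Continuous fun c : ℝ => ‖S.stateMap S.N (z + c • ((0 : Vec dx), w))‖ :=
          ((LinearMap.continuous_of_finiteDimensional _).comp (by fun_prop)).norm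
        refine hc.continuousAt.eventually_lt continuousAt_const ?_
        rw [zero_smul, add_zero]
        have := hbound z.1 (extendInput z.2) hz1 (fun k hk => (hz2.1 k hk).2.1) S.N le_rfl
        exact lt_of_le_of_lt this (lt_add_one _)
      filter_upwards [hA, hB] with c hcA hcB
      refine ⟨by simpa using hz1, (admissible_iff_constrained n _).2 ⟨hcA, fun t ht => hball _ ?_⟩⟩
      refine (norm_AK_pow_le hdecay t _).trans (le_trans ?_ (hn t ht))
      exact mul_le_mul_of_nonneg_left hcB.le (by positivity)
    obtain ⟨s₀, hs₀, h⟩ := Metric.eventually_nhds_iff.1 hev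
    refine ⟨s₀ / 2, by positivity, fun c hc => h ?_⟩
    rw [dist_zero_right, Real.norm_eq_abs]
    linarith
  · rintro z ⟨hz1, hz2⟩
    obtain ⟨w, hw, -⟩ := hπ z.1 (mem_feasible_iff.2 ⟨_, hz2⟩)
    exact ⟨_, isFiberMin_of_isMPCOptimal hz1 hw⟩

end ControlSystem

/-! ### Uniform bounds, and agreement with LQR near the origin -/

/-- A contracted nonnegative sequence with summable inputs becomes small within a uniform time. -/
theorem exists_time_le_of_contracted {ρ η F H : ℝ} (hρ1 : ρ < 1) (hη : 0 < η) :
    ∃ T₀ : ℕ, ∀ f g : ℕ → ℝ, (∀ t, 0 ≤ f t) → (∀ t, f (t + 1) ≤ ρ * f t + g t) → f 0 ≤ F →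
      (∀ n, ∑ t ∈ Finset.range n, g t ≤ H) → ∃ t ≤ T₀, f t ≤ η := by
  -- Summing the recursion gives (1 - ρ) ∑ f ≤ F + H, so `f` cannot exceed η during `n` steps.
  obtain ⟨n, hn⟩ := exists_nat_gt ((F + H) / ((1 - ρ) * η))
  have hpos : 0 < (1 - ρ) * η := mul_pos (sub_pos.2 hρ1) hη
  rw [div_lt_iff₀ hpos] at hn
  refine ⟨n, fun f g hf hfg hf0 hg => ?_⟩
  by_contra! hcon
  have h1 : ∀ m, f m + (1 - ρ) * ∑ t ∈ Finset.range m, f t ≤ f 0 + ∑ t ∈ Finset.range m, g t := by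
    intro m
    induction m with
    | zero => simp
    | succ m ih =>
      rw [Finset.sum_range_succ, Finset.sum_range_succ]
      linarith [hfg m]
  have h2 : (n : ℝ) * η ≤ ∑ t ∈ Finset.range n, f t := by
    have := Finset.card_nsmul_le_sum (Finset.range n) f η fun t ht =>
      (hcon t (Finset.mem_range.1 ht).le).le
    simpa using this
  have h3 := mul_le_mul_of_nonneg_left h2 (sub_nonneg.2 hρ1.le)
  linarith [h1 n, hg n, hf n]

/-- Convexity of the square with weights ρ and 1 - ρ, at the points x and y / (1 - ρ). -/
theorem sq_mul_add_le {ρ : ℝ} (hρ0 : 0 ≤ ρ) (hρ1 : ρ < 1) (x y : ℝ) :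
    (ρ * x + y) ^ 2 ≤ ρ * x ^ 2 + y ^ 2 / (1 - ρ) := by
  have h1 : 0 < 1 - ρ := sub_pos.2 hρ1
  have h2 : ρ * x ^ 2 + y ^ 2 / (1 - ρ) - (ρ * x + y) ^ 2
      = ρ * ((1 - ρ) * x - y) ^ 2 / (1 - ρ) := by
    field_simp
    ring
  have h3 : 0 ≤ ρ * ((1 - ρ) * x - y) ^ 2 / (1 - ρ) := by positivity
  linarith

namespace ControlSystem

variable {dx du : ℕ} {S : ControlSystem dx du} {Z : Set (Vec dx)} {ρ σ : ℝ}

/-- Tightened inputs still lie in the bounded set `S.U`, so the bound does not see `Z`. -/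
theorem Standing.exists_V_bound (hS : S.Standing) (b : ℝ) :
    ∃ M : ℝ, 0 ≤ M ∧ ∀ (Z : Set (Vec dx)) (x : Vec dx) (u : ℕ → Vec du), ‖x‖ ≤ b →
      S.Admissible Z x u → S.V x u ≤ M := by
  obtain ⟨β, hβ, h⟩ := hS.exists_openLoop_bound b S.N
  refine ⟨S.N * (opNorm S.Q * β ^ 2 + opNorm S.R * S.inputBound ^ 2) + opNorm S.P * β ^ 2, ?_, ?_⟩
  · have := opNorm_nonneg S.Q
    have := opNorm_nonneg S.R
    have := opNorm_nonneg S.P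
    positivity
  intro Z x u hx hu
  have hb := h x u hx fun k hk => (hu.1 k hk).2.1
  refine add_le_add ?_ ?_
  · have := Finset.sum_le_card_nsmul (Finset.range S.N)
      (fun k => S.stageCost (S.openLoop x u k) (u k))
      (opNorm S.Q * β ^ 2 + opNorm S.R * S.inputBound ^ 2) fun k hk => ?_
    · simpa only [Finset.card_range, nsmul_eq_mul] using this
    have hk := Finset.mem_range.1 hk
    refine (S.stageCost_le _ _).trans (add_le_add ?_ ?_)
    · exact mul_le_mul_of_nonneg_left (pow_le_pow_left₀ (norm_nonneg _) (hb k hk.le) 2)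
        (opNorm_nonneg _)
    · exact mul_le_mul_of_nonneg_left (pow_le_pow_left₀ (norm_nonneg _)
        (hS.norm_le_inputBound (hu.1 k hk).2.1) 2) (opNorm_nonneg _)
  · refine (quadForm_le _ _).trans ?_
    exact mul_le_mul_of_nonneg_left (pow_le_pow_left₀ (norm_nonneg _) (hb _ le_rfl) 2)
      (opNorm_nonneg _)

theorem exists_norm_bound_of_quadForm {n : ℕ} {M : Matrix (Fin n) (Fin n) ℝ} (hM : M.PosDef) :
    ∃ c : ℝ, 0 < c ∧ ∀ (x : Vec n) (V : ℝ), quadForm M x ≤ V → ‖x‖ ^ 2 ≤ c * V := by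
  obtain ⟨μ, hμ, h⟩ := exists_quadForm_ge hM
  refine ⟨μ⁻¹, inv_pos.2 hμ, fun x V hV => ?_⟩
  rw [inv_mul_eq_div, le_div_iff₀' hμ]
  exact (h x).trans hV

/-- Near the origin the robust MPC controller is the LQR controller. -/
theorem Standing.exists_expert_eq_lqr (hS : S.Standing) (hρ0 : 0 < ρ) (hρ1 : ρ < 1)
    (hσ : 0 < σ) (hdecay : ∀ k : ℕ, opNorm (S.AK ^ k) ≤ σ * ρ ^ k) {r : ℝ} (hr0 : 0 < r) :
    ∃ ζ : ℝ, 0 < ζ ∧ ∀ Z : Set (Vec dx), (0 : Vec dx) ∈ Z →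
      (∀ x : Vec dx, ‖x‖ ≤ r → x ∈ S.tightX Z ∧ mv S.K x ∈ S.tightU Z) →
      ∀ x : Vec dx, ‖x‖ ≤ ζ → x ∈ S.tightO Z ∧
        ∀ y u, S.IsRMPCOptimal Z x y u → u 0 + mv S.K (x - y) = mv S.K x := by
  obtain ⟨c, hc, hnorm⟩ := exists_norm_bound_of_quadForm hS.P_posDef
  have hP := opNorm_nonneg S.P
  set q := Real.sqrt (c * opNorm S.P) with hq
  -- Room for both the state and its nominal start, whose norm is at most `q` times that of the
  -- state.
  refine ⟨r / (σ * (1 + q)), by positivity, fun Z h0 hr x hx => ?_⟩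
  rw [le_div_iff₀ (by positivity)] at hx
  have hσx : 0 ≤ σ * ‖x‖ := mul_nonneg hσ.le (norm_nonneg x)
  have hq0 : 0 ≤ q := Real.sqrt_nonneg _
  have hxO : x ∈ S.tightO Z := mem_tightO_of_norm_le hρ0 hρ1 hσ hdecay hr (by nlinarith)
  refine ⟨hxO, fun y u h => ?_⟩
  -- Since `Z` contains the origin, the state itself with LQR inputs competes. This bounds the
  -- robust value by xᵀPx and hence the nominal start.
  have h1 := h.2 x _ (by simpa using h0) (admissible_lqrInput hxO)
  rw [hS.V_lqrInput] at h1
  have h2 := hnorm y _ (((hS.quadForm_le_V y u).trans h1).trans (quadForm_le S.P x))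
  have h3 : ‖y‖ ≤ q * ‖x‖ := by
    refine le_of_sq_le_sq ?_ (by positivity)
    rw [mul_pow, hq, Real.sq_sqrt (by positivity)]
    linarith
  have hyO : y ∈ S.tightO Z := by
    refine mem_tightO_of_norm_le hρ0 hρ1 hσ hdecay hr ?_
    have := mul_le_mul_of_nonneg_left h3 hσ.le
    nlinarith
  rw [hS.first_input_of_mem_tightO h.isMPCOptimal hyO, ← mv_add, add_sub_cancel]

theorem stageCost_sub_le (S : ControlSystem dx du) {x y : Vec dx} {u v : Vec du} {β γ : ℝ}
    (hx : ‖x‖ ≤ β) (hy : ‖y‖ ≤ β) (hu : ‖u‖ ≤ γ) (hv : ‖v‖ ≤ γ) :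
    S.stageCost x u - S.stageCost y v
      ≤ opNorm S.Q * (2 * β) * ‖x - y‖ + opNorm S.R * (2 * γ) * ‖u - v‖ := by
  have h1 := quadForm_sub_le S.Q x y
  have h2 := quadForm_sub_le S.R u v
  have h3 : opNorm S.Q * (‖x‖ + ‖y‖) * ‖x - y‖ ≤ opNorm S.Q * (2 * β) * ‖x - y‖ := by
    have := opNorm_nonneg S.Q
    gcongr
    linarith
  have h4 : opNorm S.R * (‖u‖ + ‖v‖) * ‖u - v‖ ≤ opNorm S.R * (2 * γ) * ‖u - v‖ := by
    have := opNorm_nonneg S.R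
    gcongr
    linarith
  simp only [stageCost]
  linarith

end ControlSystem

/-! ### Reference loop and comparison of trajectories -/

namespace ControlSystem

variable {dx du : ℕ} {S : ControlSystem dx du} {Z : Set (Vec dx)} {ρ σ : ℝ}

/-- Along the tightened MPC loop the optimal value decreases by the stage cost. -/
theorem IsTightMPC.exists_values (hS : S.Standing) {π : Vec dx → Vec du} (hπ : S.IsTightMPC Z π)
    {x : Vec dx} (hx : x ∈ S.feasible Z) {M : ℝ} (hM : ∀ u, S.Admissible Z x u → S.V x u ≤ M) :
    (∀ t, S.rollout (fun _ => π) x t ∈ S.feasible Z) ∧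
      (∀ t, π (S.rollout (fun _ => π) x t) ∈ S.U) ∧
      (∀ t, quadForm S.P (S.rollout (fun _ => π) x t) ≤ M) ∧
      ∀ n, ∑ t ∈ Finset.range n, quadForm S.inputWeight
        (π (S.rollout (fun _ => π) x t) - mv S.K (S.rollout (fun _ => π) x t)) ≤ M := by
  choose! u hu hπu using hπ
  set y := S.rollout (fun _ => π) x with hy
  have hfeas : ∀ t, y t ∈ S.feasible Z := by
    intro t
    induction t with
    | zero => exact hx
    | succ t ih =>
      have := (hu _ ih).1.step_mem_feasible hS
      rw [← hπu _ ih] at this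
      exact this
  have hdec : ∀ t, S.V (y (t + 1)) (u (y (t + 1))) ≤ S.V (y t) (u (y t))
      - S.stageCost (y t) (π (y t)) := by
    intro t
    have e : y (t + 1) = S.step (y t) (u (y t) 0) := by
      rw [← hπu _ (hfeas t)]; rfl
    have h1 := hu _ (hfeas (t + 1))
    rw [e] at h1
    rw [hπu _ (hfeas t), e]
    exact (hu _ (hfeas t)).V_step_le hS h1
  have hM0 : S.V (y 0) (u (y 0)) ≤ M := hM _ (hu _ hx).1
  have hVM : ∀ t, S.V (y t) (u (y t)) ≤ M := by
    intro t
    induction t with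
    | zero => exact hM0
    | succ t ih => linarith [hdec t, hS.stageCost_nonneg (y t) (π (y t))]
  refine ⟨hfeas, fun t => ?_, fun t => (hS.quadForm_le_V _ _).trans (hVM t), fun n => ?_⟩
  · rw [hπu _ (hfeas t)]
    exact ((hu _ (hfeas t)).1.mem_tightU hS).1
  -- The excess of the optimal value over xᵀPx drops at each step by at least the weighted squared
  -- deviation from LQR.
  · have h1 : ∑ t ∈ Finset.range n, quadForm S.inputWeight (π (y t) - mv S.K (y t))
        + (S.V (y n) (u (y n)) - quadForm S.P (y n))
        ≤ S.V (y 0) (u (y 0)) - quadForm S.P (y 0) := by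
      induction n with
      | zero => simp
      | succ n ih =>
        rw [Finset.sum_range_succ]
        have h2 := hS.stageCost_add_step (y n) (π (y n))
        have h3 : S.step (y n) (π (y n)) = y (n + 1) := rfl
        rw [h3] at h2
        linarith [hdec n]
    linarith [hS.quadForm_le_V (y n) (u (y n)), quadForm_nonneg hS.P_posDef.posSemidef (y 0)]

/-- The closed loop with summable deviations from LQR is close to the origin at some time which is
uniformly bounded. -/
theorem Standing.exists_reach_small (hS : S.Standing) (hρ0 : 0 < ρ) (hρ1 : ρ < 1) (hσ : 0 < σ)
    {ν : Vec dx → ℝ} (hν1 : ∀ x, ‖x‖ ≤ ν x) (hν2 : ∀ x, ν x ≤ σ * ‖x‖)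
    (hν3 : ∀ x y, ν (x + y) ≤ ν x + ν y) (hν4 : ∀ x, ν (mv S.AK x) ≤ ρ * ν x)
    (b M : ℝ) {η : ℝ} (hη : 0 < η) :
    ∃ T₀ : ℕ, ∀ (y : ℕ → Vec dx) (w : ℕ → Vec du), (∀ t, y (t + 1) = S.step (y t) (w t)) →
      ‖y 0‖ ≤ b →
      (∀ n, ∑ t ∈ Finset.range n, quadForm S.inputWeight (w t - mv S.K (y t)) ≤ M) →
      ∃ t ≤ T₀, ν (y t) ≤ η := by
  obtain ⟨c, hc, hnorm⟩ := exists_norm_bound_of_quadForm hS.inputWeight_posDef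
  have hν0 : ∀ x, 0 ≤ ν x := fun x => (norm_nonneg x).trans (hν1 x)
  have h1ρ : 0 < 1 - ρ := sub_pos.2 hρ1
  -- Convexity of the square turns the contraction of ν into one of ν², with forcing at most `a`
  -- times the weighted squared deviation, whose sum is bounded.
  set a := (σ * opNorm S.B) ^ 2 / (1 - ρ) * c with ha
  have ha0 : 0 ≤ a := by positivity
  obtain ⟨T₀, hT₀⟩ := exists_time_le_of_contracted (F := (σ * b) ^ 2) (H := a * M) hρ1
    (by positivity : 0 < η ^ 2)
  refine ⟨T₀, fun y w hy hb hsum => ?_⟩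
  have hmain : ∃ t ≤ T₀, ν (y t) ^ 2 ≤ η ^ 2 := by
    refine hT₀ (fun t => ν (y t) ^ 2)
      (fun t => a * quadForm S.inputWeight (w t - mv S.K (y t))) (fun t => by positivity) ?_ ?_ ?_
    · intro t
      have h1 : ν (y (t + 1)) ≤ ρ * ν (y t) + σ * opNorm S.B * ‖w t - mv S.K (y t)‖ := by
        rw [hy, step_eq]
        refine (hν3 _ _).trans (add_le_add (hν4 _) ((hν2 _).trans ?_))
        rw [mul_assoc]
        exact mul_le_mul_of_nonneg_left (norm_mv_le _ _) hσ.le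
      refine (pow_le_pow_left₀ (hν0 _) h1 2).trans ((sq_mul_add_le hρ0.le hρ1 _ _).trans ?_)
      have h2 := hnorm (w t - mv S.K (y t)) _ le_rfl
      have h3 := mul_le_mul_of_nonneg_left h2
        (by positivity : 0 ≤ (σ * opNorm S.B) ^ 2 / (1 - ρ))
      simp only [ha]
      rw [mul_pow, mul_div_right_comm]
      linarith
    · have := (hν2 (y 0)).trans (mul_le_mul_of_nonneg_left hb hσ.le)
      exact pow_le_pow_left₀ (hν0 _) this 2
    · intro n
      rw [← Finset.mul_sum]
      exact mul_le_mul_of_nonneg_left (hsum n) ha0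
  obtain ⟨t, ht, hle⟩ := hmain
  exact ⟨t, ht, le_of_sq_le_sq hle hη.le⟩

/-- Comparison of two trajectories from the same state, the inputs of which are Lipschitz close up
to an error `ε`, and which both end up under LQR. -/
theorem sum_stageCost_sub_le (S : ControlSystem dx du) (hρ0 : 0 < ρ) (hρ1 : ρ < 1) (hσ : 0 < σ)
    {ν : Vec dx → ℝ} (hν1 : ∀ x, ‖x‖ ≤ ν x) (hν2 : ∀ x, ν x ≤ σ * ‖x‖)
    (hν3 : ∀ x y, ν (x + y) ≤ ν x + ν y) (hν4 : ∀ x, ν (mv S.AK x) ≤ ρ * ν x)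
    {L c β γ : ℝ} (hL : 0 ≤ L) (hc : 0 ≤ c) (hβ : 0 ≤ β) (hγ : 0 ≤ γ) (T₀ : ℕ) :
    ∃ C G : ℝ, 0 ≤ C ∧ 0 ≤ G ∧ ∀ (x y : ℕ → Vec dx) (u w : ℕ → Vec du) (ε η : ℝ) (s t₀ : ℕ),
      0 ≤ ε → (∀ t, x (t + 1) = S.step (x t) (u t)) → (∀ t, y (t + 1) = S.step (y t) (w t)) →
      x 0 = y 0 → (∀ t, ‖x t‖ ≤ β) → (∀ t, ‖y t‖ ≤ β) → (∀ t, ‖u t‖ ≤ γ) → (∀ t, ‖w t‖ ≤ γ) →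
      (∀ t, ‖u t - w t‖ ≤ L * ‖x t - y t‖ + c * ε) →
      t₀ ≤ T₀ → ν (y t₀) ≤ η → G * ε ≤ η →
      (∀ t, ‖y t‖ ≤ 2 * η → w t = mv S.K (y t)) →
      (∀ t, ‖x t‖ ≤ 2 * η → ‖mv S.B (u t - mv S.K (x t))‖ ≤ ε) →
      (∀ t, s ≤ t → u t = mv S.K (x t)) →
      ∀ T : ℕ, ∑ t ∈ Finset.range T, (S.stageCost (x t) (u t) - S.stageCost (y t) (w t))
        ≤ C * (s + 1) * ε := by
  have h1ρ : 0 < 1 - ρ := sub_pos.2 hρ1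
  have hA := opNorm_nonneg S.A
  have hB := opNorm_nonneg S.B
  have hQ := opNorm_nonneg S.Q
  have hR := opNorm_nonneg S.R
  have hK := opNorm_nonneg S.K
  have hν0 : ∀ x, 0 ≤ ν x := fun x => (norm_nonneg x).trans (hν1 x)
  -- Growth factor of the gap in one step; the summand one ensures that it is at least one.
  obtain ⟨a, ha⟩ : ∃ v, v = 1 + opNorm S.A + opNorm S.B * L := ⟨_, rfl⟩
  obtain ⟨b, hb⟩ : ∃ v, v = opNorm S.B * c := ⟨_, rfl⟩
  have ha1 : 1 ≤ a := by
    have := mul_nonneg hB hL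
    simp only [ha]
    linarith
  obtain ⟨H, hH⟩ : ∃ v, v = b * (T₀ * a ^ T₀) := ⟨_, rfl⟩
  have hb0 : 0 ≤ b := hb ▸ mul_nonneg hB hc
  have ha0 : 0 ≤ a := zero_le_one.trans ha1
  have hH0 : 0 ≤ H := by rw [hH]; positivity
  -- Large enough to dominate the gap up to `T₀`, also when measured by ν, and to satisfy ρG + σ ≤
  -- G. The latter makes the tube ν ≤ Gε invariant under a contraction followed by an error of norm
  -- ε.
  obtain ⟨G, hG⟩ : ∃ v, v = (1 + σ) * H + σ / (1 - ρ) := ⟨_, rfl⟩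
  have hκ : 0 ≤ σ / (1 - ρ) := by positivity
  have hσH0 : 0 ≤ σ * H := mul_nonneg hσ.le hH0
  have hHG : H ≤ G := by linarith
  have hG0 : 0 ≤ G := hH0.trans hHG
  have hσHG : σ * H ≤ G := by linarith
  have hρG : ρ * G + σ ≤ G := by
    have : (1 - ρ) * (σ / (1 - ρ)) = σ := by field_simp
    have := mul_nonneg h1ρ.le (by positivity : 0 ≤ (1 + σ) * H)
    rw [hG]
    linarith
  obtain ⟨c₁, hc₁⟩ : ∃ v, v = opNorm S.Q * (2 * β) * G + opNorm S.R * (2 * γ) * (L * G + c) := ⟨_, rfl⟩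
  have hc₁0 : 0 ≤ c₁ := by rw [hc₁]; positivity
  obtain ⟨c₂, hc₂⟩ : ∃ v, v = opNorm S.Q * (2 * β) * G + opNorm S.R * (2 * γ) * (opNorm S.K * G) := ⟨_, rfl⟩
  have hc₂0 : 0 ≤ c₂ := by rw [hc₂]; positivity
  refine ⟨(T₀ + 1) * c₁ + c₂ / (1 - ρ), G, by positivity, hG0, ?_⟩
  intro x y u w ε η s t₀ hε hx hy hxy hxβ hyβ huγ hwγ hlip ht₀ hyt₀ hGη hyK hxK hxs T
  have hearly : ∀ t, ‖x t - y t‖ ≤ b * (t * a ^ t) * ε := by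
    intro t
    induction t with
    | zero => simp [hxy]
    | succ t ih =>
      rw [hx, hy, ← step_sub]
      have h1 := S.norm_step_le (x t - y t) (u t - w t)
      have h2 := mul_le_mul_of_nonneg_left (hlip t) hB
      have h3 : ‖S.step (x t - y t) (u t - w t)‖ ≤ a * ‖x t - y t‖ + b * ε := by
        simp only [ha, hb]
        linarith [norm_nonneg (x t - y t)]
      refine h3.trans ?_
      have h4 := mul_le_mul_of_nonneg_left ih (by linarith : 0 ≤ a)
      have h5 : b * ε * 1 ≤ b * ε * a ^ (t + 1) :=
        mul_le_mul_of_nonneg_left (one_le_pow₀ ha1) (by positivity)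
      push_cast
      calc a * ‖x t - y t‖ + b * ε ≤ a * (b * (t * a ^ t) * ε) + b * ε * a ^ (t + 1) := by linarith
        _ = b * ((t + 1) * a ^ (t + 1)) * ε := by ring
  have hearly' : ∀ t ≤ t₀, ‖x t - y t‖ ≤ H * ε := by
    intro t ht
    refine (hearly t).trans (mul_le_mul_of_nonneg_right ?_ hε)
    rw [hH]
    refine mul_le_mul_of_nonneg_left ?_ hb0
    have : (t : ℝ) ≤ T₀ := by exact_mod_cast ht.trans ht₀
    exact mul_le_mul this (pow_le_pow_right₀ ha1 (ht.trans ht₀)) (by positivity) (by positivity)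
  have hη : 0 ≤ η := (mul_nonneg hG0 hε).trans hGη
  have hylate : ∀ t ≥ t₀, ν (y t) ≤ η := by
    intro t ht
    induction t, ht using Nat.le_induction with
    | base => exact hyt₀
    | succ t ht ih =>
      rw [hy, hyK t (by linarith [hν1 (y t)]), step_lqr]
      exact (hν4 (y t)).trans ((mul_le_of_le_one_left (hν0 _) hρ1.le).trans ih)
  have hdiff : ∀ t ≥ t₀, ν (x t - y t) ≤ G * ε →
      w t = mv S.K (y t) ∧ ‖mv S.B (u t - mv S.K (x t))‖ ≤ ε := by
    intro t ht h
    have h1 := hylate t ht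
    refine ⟨hyK t (by linarith [hν1 (y t)]), hxK t ?_⟩
    have h2 := hν3 (x t - y t) (y t)
    rw [sub_add_cancel] at h2
    linarith [hν1 (x t)]
  have hstep : ∀ t, w t = mv S.K (y t) →
      x (t + 1) - y (t + 1) = mv S.AK (x t - y t) + mv S.B (u t - mv S.K (x t)) := by
    intro t ht
    rw [hx, hy, ht, step_lqr, step_eq, mv_sub S.AK]
    abel
  -- Bootstrap: a gap below Gε ≤ η keeps both states in the ball of radius 2η, where the reference
  -- is LQR and the other loop is LQR up to an error ε. This reproduces the bound at the next step.
  have hlate : ∀ t ≥ t₀, ν (x t - y t) ≤ G * ε := by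
    intro t ht
    induction t, ht using Nat.le_induction with
    | base =>
      refine (hν2 _).trans ?_
      have h1 := mul_le_mul_of_nonneg_left (hearly' t₀ le_rfl) hσ.le
      have h2 := mul_le_mul_of_nonneg_right hσHG hε
      linarith
    | succ t ht ih =>
      obtain ⟨h1, h2⟩ := hdiff t ht ih
      rw [hstep t h1]
      have h3 := hν3 (mv S.AK (x t - y t)) (mv S.B (u t - mv S.K (x t)))
      have h4 := hν4 (x t - y t)
      have h5 := hν2 (mv S.B (u t - mv S.K (x t)))
      have h6 := mul_le_mul_of_nonneg_left ih hρ0.le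
      have h7 := mul_le_mul_of_nonneg_left h2 hσ.le
      have h8 := mul_le_mul_of_nonneg_right hρG hε
      linarith
  have hall : ∀ t, ‖x t - y t‖ ≤ G * ε := by
    intro t
    rcases le_total t t₀ with ht | ht
    · exact (hearly' t ht).trans (mul_le_mul_of_nonneg_right hHG hε)
    · exact (hν1 _).trans (hlate t ht)
  have hbig : ∀ t, S.stageCost (x t) (u t) - S.stageCost (y t) (w t) ≤ c₁ * ε := by
    intro t
    refine (S.stageCost_sub_le (hxβ t) (hyβ t) (huγ t) (hwγ t)).trans ?_
    have h1 := hall t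
    have h2 : ‖u t - w t‖ ≤ (L * G + c) * ε := by
      have := mul_le_mul_of_nonneg_left h1 hL
      linarith [hlip t]
    have h3 := mul_le_mul_of_nonneg_left h1 (by positivity : 0 ≤ opNorm S.Q * (2 * β))
    have h4 := mul_le_mul_of_nonneg_left h2 (by positivity : 0 ≤ opNorm S.R * (2 * γ))
    simp only [hc₁]
    linarith
  -- From here on both loops are plain LQR, so the gap decays geometrically and the remaining cost
  -- difference is O(ε) independently of `T`.
  set t₁ := max t₀ s with ht₁
  have hdecay' : ∀ k, ν (x (t₁ + k) - y (t₁ + k)) ≤ ρ ^ k * (G * ε) := by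
    intro k
    induction k with
    | zero => simpa using hlate t₁ (le_max_left _ _)
    | succ k ih =>
      have hk : t₀ ≤ t₁ + k := (le_max_left t₀ s).trans (Nat.le_add_right _ _)
      have hk' : s ≤ t₁ + k := (le_max_right t₀ s).trans (Nat.le_add_right _ _)
      rw [← add_assoc, hstep _ (hdiff _ hk (hlate _ hk)).1, hxs _ hk', sub_self, mv_zero, add_zero]
      have := mul_le_mul_of_nonneg_left ih hρ0.le
      rw [pow_succ']
      linarith [hν4 (x (t₁ + k) - y (t₁ + k))]
  have hsmall : ∀ k, S.stageCost (x (t₁ + k)) (u (t₁ + k)) - S.stageCost (y (t₁ + k)) (w (t₁ + k))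
      ≤ c₂ * ε * ρ ^ k := by
    intro k
    have hk : t₀ ≤ t₁ + k := (le_max_left t₀ s).trans (Nat.le_add_right _ _)
    have hk' : s ≤ t₁ + k := (le_max_right t₀ s).trans (Nat.le_add_right _ _)
    refine (S.stageCost_sub_le (hxβ _) (hyβ _) (huγ _) (hwγ _)).trans ?_
    have h1 : ‖x (t₁ + k) - y (t₁ + k)‖ ≤ ρ ^ k * (G * ε) := (hν1 _).trans (hdecay' k)
    have h2 : ‖u (t₁ + k) - w (t₁ + k)‖ ≤ opNorm S.K * (ρ ^ k * (G * ε)) := by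
      rw [hxs _ hk', (hdiff _ hk (hlate _ hk)).1, ← mv_sub]
      exact (norm_mv_le _ _).trans (mul_le_mul_of_nonneg_left h1 hK)
    have h3 := mul_le_mul_of_nonneg_left h1 (by positivity : 0 ≤ opNorm S.Q * (2 * β))
    have h4 := mul_le_mul_of_nonneg_left h2 (by positivity : 0 ≤ opNorm S.R * (2 * γ))
    simp only [hc₂]
    linarith
  have hsum : ∀ k, ∑ t ∈ Finset.range (t₁ + k),
      (S.stageCost (x t) (u t) - S.stageCost (y t) (w t)) ≤ t₁ * (c₁ * ε) + c₂ * ε / (1 - ρ) := by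
    intro k
    rw [Finset.sum_range_add]
    refine add_le_add ?_ ?_
    · have := Finset.sum_le_card_nsmul (Finset.range t₁) _ _ fun t _ => hbig t
      simpa only [Finset.card_range, nsmul_eq_mul] using this
    · refine (Finset.sum_le_sum fun t _ => hsmall t).trans ?_
      rw [← Finset.mul_sum, div_eq_mul_inv]
      refine mul_le_mul_of_nonneg_left ?_ (by positivity)
      rw [← tsum_geometric_of_lt_one hρ0.le hρ1]
      exact (summable_geometric_of_lt_one hρ0.le hρ1).sum_le_tsum _ fun _ _ => by positivity
  have ht₁le : (t₁ : ℝ) ≤ T₀ * (s + 1) + s := by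
    have h1 : t₁ ≤ T₀ * (s + 1) + s := by
      exact max_le (ht₀.trans (Nat.le_add_right_of_le (Nat.le_mul_of_pos_right _ s.succ_pos)))
        (Nat.le_add_left _ _)
    exact_mod_cast h1
  have hfin : t₁ * (c₁ * ε) + c₂ * ε / (1 - ρ) ≤ ((T₀ + 1) * c₁ + c₂ / (1 - ρ)) * (s + 1) * ε := by
    have h1 := mul_le_mul_of_nonneg_right ht₁le (by positivity : 0 ≤ c₁ * ε)
    have h2 : 0 ≤ c₂ / (1 - ρ) * ε * s := by positivity
    have h3 : 0 ≤ c₁ * ε := by positivity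
    rw [mul_div_right_comm]
    linarith
  rcases le_total t₁ T with hT | hT
  · obtain ⟨k, rfl⟩ := Nat.exists_eq_add_of_le hT
    exact (hsum k).trans hfin
  · have h1 := Finset.sum_le_card_nsmul (Finset.range T) _ _ fun t _ => hbig t
    simp only [Finset.card_range, nsmul_eq_mul] at h1
    refine h1.trans (le_trans ?_ hfin)
    have h2 : (T : ℝ) ≤ t₁ := by exact_mod_cast hT
    have h3 := mul_le_mul_of_nonneg_right h2 (by positivity : 0 ≤ c₁ * ε)
    have h4 : 0 ≤ c₂ * ε / (1 - ρ) := by positivity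
    linarith

end ControlSystem

/-! ### Imitation errors as disturbances, and the switch to LQR -/

namespace ControlSystem

variable {dx du : ℕ} {S : ControlSystem dx du} {Z : Set (Vec dx)} {ρ σ ε : ℝ}

theorem rollout_congr (S : ControlSystem dx du) (x : Vec dx) {p p' : ℕ → Vec dx → Vec du} {t : ℕ}
    (h : ∀ k < t, p k = p' k) : S.rollout p x t = S.rollout p' x t := by
  induction t with
  | zero => rfl
  | succ t ih => rw [rollout, rollout, ih fun k hk => h k (hk.trans t.lt_succ_self),
      h t t.lt_succ_self]

theorem norm_mv_B_le (hS : S.Standing) {d : Vec du} (hd : ‖d‖ ≤ ε / opNorm S.B) :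
    ‖mv S.B d‖ ≤ ε := by
  rw [le_div_iff₀' (opNorm_pos hS.B_ne_zero)] at hd
  exact (norm_mv_le _ _).trans hd

theorem step_eq_add_mv (S : ControlSystem dx du) (x : Vec dx) (u v : Vec du) :
    S.step x u = S.step x v + mv S.B (u - v) := by
  simp only [step, mv_sub]
  abel

/-- Robust recursive feasibility of a loop which stays close to the robust MPC controller. -/
theorem IsRobustMPC.rollout_mem_domain (hS : S.Standing)
    (hZ : S.IsDisturbanceInvariant (closedBall 0 ε) Z) {expert : Vec dx → Vec du}
    (he : S.IsRobustMPC Z expert) {p : ℕ → Vec dx → Vec du} {x : Vec dx} (hx : x ∈ S.feasible Z)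
    {s : ℕ} (hclose : ∀ t < s, ‖expert (S.rollout p x t) - p t (S.rollout p x t)‖
      ≤ ε / opNorm S.B) :
    ∀ t ≤ s, S.rollout p x t ∈ (S.feasible Z + Z) ∩ S.X := by
  intro t
  induction t with
  | zero => exact fun _ => hZ.mem_domain_of_feasible hS hx
  | succ t ih =>
    intro ht
    obtain ⟨y, u, hyu, hexp⟩ := he _ (ih (Nat.le_of_succ_le ht))
    have h1 := hclose t ht
    rw [norm_sub_rev] at h1
    have h2 := hyu.step_mem_domain hS hZ (norm_mv_B_le hS h1)
    rw [← hexp, ← step_eq_add_mv] at h2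
    exact h2

/-- The initial value is at most that of tightened MPC because `Z` contains the origin. Afterwards
the imitation error, mapped by `B`, is an admissible disturbance, which cannot raise the value. -/
theorem IsRobustMPC.rollout_value_le (hS : S.Standing)
    (hZ : S.IsDisturbanceInvariant (closedBall 0 ε) Z) {expert : Vec dx → Vec du}
    (he : S.IsRobustMPC Z expert) {p : ℕ → Vec dx → Vec du} {x : Vec dx} (hx : x ∈ S.feasible Z)
    {M : ℝ} (hM : ∀ u, S.Admissible Z x u → S.V x u ≤ M)
    {s : ℕ} (hclose : ∀ t < s, ‖expert (S.rollout p x t) - p t (S.rollout p x t)‖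
      ≤ ε / opNorm S.B) :
    ∀ t ≤ s, ∃ y u, S.IsRMPCOptimal Z (S.rollout p x t) y u ∧
      expert (S.rollout p x t) = u 0 + mv S.K (S.rollout p x t - y) ∧ S.V y u ≤ M := by
  have hdom := he.rollout_mem_domain hS hZ hx hclose
  intro t
  induction t with
  | zero =>
    intro _
    obtain ⟨y, u, hyu, hexp⟩ := he _ (hdom 0 (Nat.zero_le _))
    refine ⟨y, u, hyu, hexp, ?_⟩
    obtain ⟨v, hv⟩ := mem_feasible_iff.1 hx
    exact (hyu.2 x v (by simpa [rollout] using mem_of_mem_nhds hZ.1) hv).trans (hM v hv)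
  | succ t ih =>
    intro ht
    obtain ⟨y, u, hyu, hexp, hV⟩ := ih (Nat.le_of_succ_le ht)
    obtain ⟨y', u', hyu', hexp'⟩ := he _ (hdom (t + 1) ht)
    refine ⟨y', u', hyu', hexp', le_trans ?_ hV⟩
    have h1 := hclose t ht
    rw [norm_sub_rev] at h1
    refine hyu.V_step_le hS hZ (norm_mv_B_le hS h1) (w := mv S.B (p t (S.rollout p x t)
      - expert (S.rollout p x t))) ?_
    rw [← hexp, ← step_eq_add_mv]
    exact hyu'

/-- The policy `p` up to time `s`, and LQR from then on. -/
noncomputable def switched (S : ControlSystem dx du) (p : ℕ → Vec dx → Vec du) (s : ℕ) :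
    ℕ → Vec dx → Vec du := fun t => if t < s then p t else S.lqr

theorem rollout_switched (S : ControlSystem dx du) (p : ℕ → Vec dx → Vec du) {s t : ℕ}
    (h : t ≤ s) (x : Vec dx) : S.rollout (S.switched p s) x t = S.rollout p x t :=
  S.rollout_congr x fun k hk => by rw [switched, if_pos (hk.trans_le h)]

theorem rollout_switched_late (S : ControlSystem dx du) (p : ℕ → Vec dx → Vec du) (s k : ℕ)
    (x : Vec dx) : S.rollout (S.switched p s) x (s + k) = mv (S.AK ^ k) (S.rollout p x s) := by
  induction k with
  | zero => rw [add_zero, pow_zero, mv_one, rollout_switched _ _ le_rfl]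
  | succ k ih =>
    rw [← add_assoc, rollout, ih, switched, if_neg (by omega), lqr, step_lqr, ← mv_mul,
      ← pow_succ']

/-- Cost of switching to LQR, in the worst case. -/
theorem Standing.cost_switched_le (hS : S.Standing) {p : ℕ → Vec dx → Vec du} {x : Vec dx}
    {s : ℕ} {c c' : ℝ} (T : ℕ)
    (h : ∀ t < s, S.stageCost (S.rollout p x t) (p t (S.rollout p x t)) ≤ c)
    (h' : quadForm S.P (S.rollout p x s) ≤ c') :
    S.cost (S.switched p s) T x ≤ s * c + c' := by
  have hlate : ∀ k, S.cost (S.switched p s) (s + k) x ≤ s * c + c' := by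
    intro k
    rw [cost, Finset.sum_range_add]
    refine add_le_add ?_ ?_
    · have := Finset.sum_le_card_nsmul (Finset.range s) (fun t => S.stageCost
        (S.rollout (S.switched p s) x t) (S.switched p s t (S.rollout (S.switched p s) x t))) c
        fun t ht => by
          have ht := Finset.mem_range.1 ht
          rw [rollout_switched _ _ ht.le, switched, if_pos ht]
          exact h t ht
      simpa only [Finset.card_range, nsmul_eq_mul] using this
    · refine le_trans ?_ h'
      -- LQR spends exactly the decrease of xᵀPx.
      have key : ∑ t ∈ Finset.range k, S.stageCost (S.rollout (S.switched p s) x (s + t))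
          (S.switched p s (s + t) (S.rollout (S.switched p s) x (s + t)))
          + quadForm S.P (mv (S.AK ^ k) (S.rollout p x s)) = quadForm S.P (S.rollout p x s) := by
        induction k with
        | zero => simp [mv_one]
        | succ k ih =>
          rw [Finset.sum_range_succ, rollout_switched_late, pow_succ', mv_mul]
          have e : S.switched p s (s + k) = S.lqr := by rw [switched, if_neg (by omega)]
          have h1 := hS.stageCost_add_step (mv (S.AK ^ k) (S.rollout p x s))
            (mv S.K (mv (S.AK ^ k) (S.rollout p x s)))
          rw [step_lqr, sub_self] at h1
          have h0 : quadForm S.inputWeight (0 : Vec du) = 0 := by simp [quadForm]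
          rw [e, lqr]
          linarith
      linarith [quadForm_nonneg hS.P_posDef.posSemidef (mv (S.AK ^ k) (S.rollout p x s))]
  rcases le_total s T with hT | hT
  · obtain ⟨k, rfl⟩ := Nat.exists_eq_add_of_le hT
    exact hlate k
  · refine le_trans ?_ (hlate 0)
    exact Finset.sum_le_sum_of_subset_of_nonneg (Finset.range_subset_range.2 hT)
      fun t _ _ => hS.stageCost_nonneg _ _

end ControlSystem

/-! ### The deterministic regret bound -/

namespace ControlSystem

variable {dx du : ℕ} {S : ControlSystem dx du} {Z : Set (Vec dx)} {ρ σ : ℝ}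

/-- The regret of a learned policy followed by LQR against the tightened MPC controller. -/
theorem Standing.exists_regret_bound (hS : S.Standing) (hρ0 : 0 < ρ) (hρ1 : ρ < 1) (hσ : 0 < σ)
    (hdecay : ∀ k : ℕ, opNorm (S.AK ^ k) ≤ σ * ρ ^ k) (b : ℝ) :
    ∃ C : ℝ, 0 < C ∧ ∀ ε : ℝ, 0 < ε → ε < 1 → ∀ Z : Set (Vec dx),
      S.IsDisturbanceInvariant (closedBall 0 ε) Z → Z ⊆ closedBall 0 (σ / (1 - ρ) * ε) →
      ∀ piRef, S.IsTightMPC Z piRef → ∀ expert, S.IsRobustMPC Z expert →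
      ∀ (p : ℕ → Vec dx → Vec du) (s T : ℕ), ∀ x ∈ S.feasible Z, ‖x‖ ≤ b →
        S.rollout p x s ∈ S.tightO Z →
        (∀ t < s, ‖expert (S.rollout p x t) - p t (S.rollout p x t)‖ ≤ ε / opNorm S.B) →
        S.cost (S.switched p s) T x - S.cost (fun _ => piRef) T x ≤ C * (s + 1) * ε := by
  obtain ⟨M, hM0, hM⟩ := hS.exists_V_bound b
  obtain ⟨cP, hcP, hnormP⟩ := exists_norm_bound_of_quadForm hS.P_posDef
  obtain ⟨ε₁, hε₁, r, hr0, hball⟩ := hS.exists_ball_subset_tight hρ0 hρ1 hσ hdecay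
  obtain ⟨ν, hν1, hν2, hν3, hν4⟩ := exists_contracted_norm hρ0 hdecay
  obtain ⟨ζ, hζ0, hζ⟩ := hS.exists_expert_eq_lqr hρ0 hρ1 hσ hdecay hr0
  have hB := opNorm_pos hS.B_ne_zero
  have hK := opNorm_nonneg S.K
  have hκ : 0 ≤ σ / (1 - ρ) := div_nonneg hσ.le (sub_nonneg.2 hρ1.le)
  have hU0 : 0 ≤ S.inputBound := by simpa using hS.norm_le_inputBound hS.zero_mem_U
  obtain ⟨κ, hκd⟩ : ∃ κ, κ = σ / (1 - ρ) := ⟨_, rfl⟩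
  rw [← hκd] at hκ
  obtain ⟨β₁, hβ₁⟩ : ∃ β, β = Real.sqrt (cP * M) := ⟨_, rfl⟩
  have hβ₁0 : 0 ≤ β₁ := hβ₁ ▸ Real.sqrt_nonneg _
  have hβP : ∀ y : Vec dx, quadForm S.P y ≤ M → ‖y‖ ≤ β₁ := fun y hy => by
    rw [hβ₁]
    exact Real.le_sqrt_of_sq_le (hnormP y M hy)
  -- Covers the states before the switch, bounded by β₁ + κ, and the LQR orbit after it, larger by a
  -- factor of at most σ.
  obtain ⟨β, hβ⟩ : ∃ β, β = (1 + σ) * (β₁ + κ) := ⟨_, rfl⟩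
  have hβ0 : 0 ≤ β := by rw [hβ]; positivity
  have hβ₁κ : β₁ + κ ≤ β := by
    rw [hβ]
    exact le_mul_of_one_le_left (by positivity) (by linarith)
  have hσβ : σ * (β₁ + κ) ≤ β := by
    rw [hβ]
    exact mul_le_mul_of_nonneg_right (by linarith) (by positivity)
  -- The first three terms bound the learned inputs (nominal input, tube feedback, imitation error),
  -- the last one the LQR inputs.
  obtain ⟨γ, hγ⟩ : ∃ γ, γ = S.inputBound + opNorm S.K * κ + 1 / opNorm S.B + opNorm S.K * β :=
    ⟨_, rfl⟩
  have hγ0 : 0 ≤ γ := by rw [hγ]; positivity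
  have hUγ : S.inputBound ≤ γ := by
    have h1 : 0 ≤ opNorm S.K * κ + 1 / opNorm S.B + opNorm S.K * β := by positivity
    linarith
  obtain ⟨L, hL0, hL⟩ := hS.exists_lipschitz_tightMPC hρ0 hρ1 hσ hdecay hr0 β
  -- Errors per unit of ε: evaluating the reference controller at the nominal state, tube feedback,
  -- imitation.
  obtain ⟨c, hc⟩ : ∃ c, c = L * κ + opNorm S.K * κ + 1 / opNorm S.B := ⟨_, rfl⟩
  have hc0 : 0 ≤ c := by rw [hc]; positivity
  obtain ⟨T₀, hT₀⟩ := hS.exists_reach_small hρ0 hρ1 hσ hν1 hν2 hν3 hν4 b M (half_pos hζ0)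
  obtain ⟨C₁, G, hC₁, hG, hcomp⟩ :=
    S.sum_stageCost_sub_le hρ0 hρ1 hσ hν1 hν2 hν3 hν4 hL0 hc0 hβ0 hγ0 T₀
  obtain ⟨c₁, hc₁⟩ : ∃ c, c = opNorm S.Q * β ^ 2 + opNorm S.R * γ ^ 2 := ⟨_, rfl⟩
  obtain ⟨c₂, hc₂⟩ : ∃ c, c = opNorm S.P * β ^ 2 := ⟨_, rfl⟩
  have hQ := opNorm_nonneg S.Q
  have hR := opNorm_nonneg S.R
  have hP := opNorm_nonneg S.P
  have hc₁0 : 0 ≤ c₁ := by rw [hc₁]; positivity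
  have hc₂0 : 0 ≤ c₂ := by rw [hc₂]; positivity
  obtain ⟨ε₀, hε₀⟩ : ∃ e, e = min ε₁ (ζ / 2 / (G + 1)) := ⟨_, rfl⟩
  have hε₀0 : 0 < ε₀ := by
    rw [hε₀]
    exact lt_min hε₁ (by positivity)
  have hcrude : 0 ≤ (c₁ + c₂) / ε₀ := by positivity
  refine ⟨C₁ + (c₁ + c₂) / ε₀ + 1, by positivity, ?_⟩
  intro ε hε hε1 Z hZ hZκ piRef href expert hexp p s T x hx hxb hreach hclose
  rw [← hκd] at hZκ
  have h0Z : (0 : Vec dx) ∈ Z := mem_of_mem_nhds hZ.1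
  have hZn : ∀ z ∈ Z, ‖z‖ ≤ κ * ε := fun z hz => by simpa using hZκ hz
  have hκε : κ * ε ≤ κ := mul_le_of_le_one_right hκ hε1.le
  have hMx : ∀ u, S.Admissible Z x u → S.V x u ≤ M := fun u hu => hM Z x u hxb hu
  obtain ⟨hyfeas, hyU, hyP, hysum⟩ := href.exists_values hS hx hMx
  have hval := hexp.rollout_value_le hS hZ hx hMx hclose
  -- The learned trajectory before the switch.
  have hyn : ∀ {t} {y : Vec dx} {u : ℕ → Vec du}, S.IsRMPCOptimal Z (S.rollout p x t) y u →
      S.V y u ≤ M → ‖y‖ ≤ β₁ ∧ ‖S.rollout p x t - y‖ ≤ κ * ε := fun h hV =>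
    ⟨hβP _ ((hS.quadForm_le_V _ _).trans hV), hZn _ h.1.1⟩
  have hxearly : ∀ t ≤ s, ‖S.rollout p x t‖ ≤ β₁ + κ := by
    intro t ht
    obtain ⟨y, u, hyu, -, hV⟩ := hval t ht
    obtain ⟨h1, h2⟩ := hyn hyu hV
    have := norm_add_le y (S.rollout p x t - y)
    rw [add_sub_cancel] at this
    linarith
  have huearly : ∀ t < s, ‖p t (S.rollout p x t)‖ ≤ γ := by
    intro t ht
    obtain ⟨y, u, hyu, he, hV⟩ := hval t ht.le
    obtain ⟨h1, h2⟩ := hyn hyu hV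
    have h3 := hclose t ht
    have h4 : ε / opNorm S.B ≤ 1 / opNorm S.B := by gcongr
    have h5 := hS.norm_le_inputBound (hyu.1.2.mem_tightU hS).1
    have h6 : ‖mv S.K (S.rollout p x t - y)‖ ≤ opNorm S.K * κ :=
      (norm_mv_le _ _).trans (mul_le_mul_of_nonneg_left (h2.trans hκε) hK)
    have h7 := norm_add_le (u 0) (mv S.K (S.rollout p x t - y))
    rw [← he] at h7
    have h8 := norm_le_insert (expert (S.rollout p x t)) (p t (S.rollout p x t))
    have h9 : 0 ≤ opNorm S.K * β := by positivity
    linarith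
  -- For ε ≥ ε₀ the whole cost is at most (c₁ + c₂)(s + 1), and dividing by ε₀ buys the factor ε.
  -- Only small ε needs the comparison of trajectories.
  rcases lt_or_ge ε ε₀ with hlt | hge
  swap
  · have h1 := hS.cost_switched_le (p := p) (x := x) (s := s) (c := c₁) (c' := c₂) T
      (fun t ht => by
        have hx1 := (hxearly t ht.le).trans hβ₁κ
        have hu1 := huearly t ht
        rw [hc₁]
        refine (S.stageCost_le _ _).trans ?_
        gcongr)
      (by
        have hx1 := (hxearly s le_rfl).trans hβ₁κ
        rw [hc₂]
        refine (quadForm_le _ _).trans ?_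
        gcongr)
    have h2 : 0 ≤ S.cost (fun _ => piRef) T x :=
      Finset.sum_nonneg fun t _ => hS.stageCost_nonneg _ _
    have h3 : c₁ + c₂ ≤ (c₁ + c₂) / ε₀ * ε := by
      rw [div_mul_eq_mul_div, le_div_iff₀ hε₀0]
      exact mul_le_mul_of_nonneg_left hge (by positivity)
    have h4 : s * c₁ + c₂ ≤ (c₁ + c₂) * (s + 1) := by
      have : 0 ≤ c₂ * s := by positivity
      linarith
    have h5 := mul_le_mul_of_nonneg_right h3 (by positivity : (0 : ℝ) ≤ s + 1)
    have h6 : 0 ≤ (C₁ + 1) * (s + 1) * ε := by positivity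
    linarith
  have hlt₁ : ε ≤ ε₁ := hlt.le.trans (hε₀ ▸ min_le_left _ _)
  have hGε : G * ε ≤ ζ / 2 := by
    have h1 : ε ≤ ζ / 2 / (G + 1) := hlt.le.trans (hε₀ ▸ min_le_right _ _)
    rw [le_div_iff₀ (by positivity)] at h1
    linarith
  -- The learned trajectory ends in the terminal set, which is therefore nonempty, as the ball lemma
  -- requires.
  have hrZ := hball ε hlt₁ Z hZ.1 (by rw [← hκd]; exact hZκ) ⟨_, hreach⟩
  have hlip := hL Z h0Z (isBounded_closedBall.subset hZκ) hrZ piRef href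
  have hζZ := hζ Z h0Z hrZ
  have hrefO : ∀ y ∈ S.tightO Z, piRef y = mv S.K y := by
    intro y hy
    obtain ⟨u, hu, hyu⟩ := href y (tightO_subset_feasible hy)
    rw [hyu, hS.first_input_of_mem_tightO hu hy]
  obtain ⟨t₀, ht₀, hyt₀⟩ := hT₀ (S.rollout (fun _ => piRef) x)
    (fun t => piRef (S.rollout (fun _ => piRef) x t)) (fun t => rfl) hxb hysum
  have hsplit : ∀ t, t < s ∨ ∃ k, t = s + k := fun t => by
    rcases lt_or_ge t s with h | h
    · exact Or.inl h
    · exact Or.inr (Nat.exists_eq_add_of_le h)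
  have hlate : ∀ k, mv (S.AK ^ k) (S.rollout p x s) ∈ S.tightO Z ∧
      ‖mv (S.AK ^ k) (S.rollout p x s)‖ ≤ β := by
    intro k
    refine ⟨?_, ?_⟩
    · induction k with
      | zero => rwa [pow_zero, mv_one]
      | succ k ih =>
        rw [pow_succ', mv_mul]
        exact mv_AK_mem_tightO ih
    · have h1 := norm_AK_pow_le hdecay k (S.rollout p x s)
      have h2 : ρ ^ k ≤ 1 := pow_le_one₀ hρ0.le hρ1.le
      have h3 : σ * ρ ^ k * ‖S.rollout p x s‖ ≤ σ * 1 * (β₁ + κ) := by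
        have := hxearly s le_rfl
        gcongr
      linarith
  have hsw : ∀ k, S.switched p s (s + k) = S.lqr := fun k => by
    rw [switched, if_neg (by omega)]
  have hrefβ : ∀ t, ‖S.rollout (fun _ => piRef) x t‖ ≤ β := fun t => by
    have := hβP _ (hyP t)
    linarith
  have hmain := hcomp (S.rollout (S.switched p s) x) (S.rollout (fun _ => piRef) x)
    (fun t => S.switched p s t (S.rollout (S.switched p s) x t))
    (fun t => piRef (S.rollout (fun _ => piRef) x t)) ε (ζ / 2) s t₀ hε.le (fun _ => rfl)
    (fun _ => rfl) rfl ?_ hrefβ ?_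
    (fun t => (hS.norm_le_inputBound (hyU t)).trans hUγ) ?_ ht₀ hyt₀ hGε ?_ ?_ ?_ T
  · rw [Finset.sum_sub_distrib] at hmain
    refine le_trans hmain ?_
    gcongr
    linarith
  · intro t
    rcases hsplit t with ht | ⟨k, rfl⟩
    · rw [rollout_switched _ _ ht.le]
      exact (hxearly t ht.le).trans hβ₁κ
    · rw [rollout_switched_late]
      exact (hlate k).2
  · intro t
    rcases hsplit t with ht | ⟨k, rfl⟩
    · rw [rollout_switched _ _ ht.le, switched, if_pos ht]
      exact huearly t ht
    · rw [rollout_switched_late, hsw, lqr]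
      have h1 := (norm_mv_le S.K _).trans (mul_le_mul_of_nonneg_left (hlate k).2 hK)
      have h2 : 0 ≤ S.inputBound + opNorm S.K * κ + 1 / opNorm S.B := by positivity
      linarith
  · intro t
    rcases hsplit t with ht | ⟨k, rfl⟩
    · rw [rollout_switched _ _ ht.le, switched, if_pos ht]
      obtain ⟨y, u, hyu, he, hV⟩ := hval t ht.le
      obtain ⟨h1, h2⟩ := hyn hyu hV
      obtain ⟨v, hv, hyv⟩ := href y (mem_feasible_iff.2 ⟨u, hyu.1.2⟩)
      obtain ⟨f, hf⟩ : ∃ f, f = S.rollout (fun _ => piRef) x t := ⟨_, rfl⟩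
      -- The robust and the tightened optimal input sequences at `y` coincide by strong convexity.
      have hyu' : piRef y = u 0 := by
        have e := isFiberMin_of_isMPCOptimal (le_refl ‖y‖) hv
        have e' := isFiberMin_of_isMPCOptimal (le_refl ‖y‖) hyu.isMPCOptimal
        obtain ⟨μ, hμ, hRμ⟩ := exists_quadForm_ge hS.R_posDef
        have := fiberMin_unique hμ hS.valueForm_symm (hS.valueForm_ge hRμ hμ)
          (hS.convex_admissible_bounded ‖y‖) e e'.1 (e'.2 _ e.1)
        rw [hyv]
        exact (congrFun this ⟨0, hS.N_pos⟩).symm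
      have h3 := hlip y (mem_feasible_iff.2 ⟨u, hyu.1.2⟩) f (hf ▸ hyfeas t) (by linarith)
        (hf ▸ hrefβ t)
      rw [← hf]
      have h4 : p t (S.rollout p x t) - piRef f = (p t (S.rollout p x t) - expert (S.rollout p x t))
          + mv S.K (S.rollout p x t - y) + (piRef y - piRef f) := by
        rw [he, hyu']
        abel
      rw [h4]
      have h5 := hclose t ht
      rw [norm_sub_rev] at h5
      have h6 := (norm_mv_le S.K (S.rollout p x t - y)).trans (mul_le_mul_of_nonneg_left h2 hK)
      have h7 : ‖y - f‖ ≤ κ * ε + ‖S.rollout p x t - f‖ := by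
        have := norm_sub_le (S.rollout p x t - f) (S.rollout p x t - y)
        rw [sub_sub_sub_cancel_left] at this
        linarith
      have h8 := mul_le_mul_of_nonneg_left h7 hL0
      refine norm_add₃_le.trans ?_
      rw [hc]
      have h9 : ε / opNorm S.B = 1 / opNorm S.B * ε := by ring
      rw [h9] at h5
      linarith
    · rw [rollout_switched_late, hsw, lqr, ← hrefO _ (hlate k).1]
      refine (hlip _ (tightO_subset_feasible (hlate k).1) _ (hyfeas _) (hlate k).2
        (hrefβ _)).trans ?_
      exact le_add_of_nonneg_right (by positivity)
  · intro t ht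
    rw [mul_div_cancel₀ _ two_ne_zero] at ht
    exact hrefO _ (hζZ _ ht).1
  · intro t hn
    rw [mul_div_cancel₀ _ two_ne_zero] at hn
    rcases hsplit t with ht | ⟨k, rfl⟩
    · rw [rollout_switched _ _ ht.le] at hn ⊢
      rw [switched, if_pos ht]
      obtain ⟨y, u, hyu, he, hV⟩ := hval t ht.le
      rw [← (hζZ _ hn).2 y u hyu, ← he]
      have h1 := hclose t ht
      rw [norm_sub_rev] at h1
      exact norm_mv_B_le hS h1
    · rw [hsw, lqr, sub_self, mv_zero, norm_zero]
      exact hε.le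
  · intro t ht
    obtain ⟨k, rfl⟩ := Nat.exists_eq_add_of_le ht
    rw [hsw, lqr]

end ControlSystem

/-! ### The sampling schedule -/

/-- Discrete form of the fact that -1/log t has derivative 1/(t log² t). The factor two covers t + 3
≤ 2(t + 2). -/
theorem one_div_mul_log_sq_le (t : ℕ) :
    1 / (((t : ℝ) + 2) * Real.log ((t : ℝ) + 3) ^ 2)
      ≤ 2 * (1 / Real.log ((t : ℝ) + 2) - 1 / Real.log ((t : ℝ) + 3)) := by
  have ht : (0 : ℝ) ≤ t := t.cast_nonneg
  have h2 : 0 < Real.log ((t : ℝ) + 2) := Real.log_pos (by linarith)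
  have h3 : 0 < Real.log ((t : ℝ) + 3) := Real.log_pos (by linarith)
  have hle : Real.log ((t : ℝ) + 2) ≤ Real.log ((t : ℝ) + 3) :=
    Real.log_le_log (by linarith) (by linarith)
  have hdiff : 1 / ((t : ℝ) + 3) ≤ Real.log ((t : ℝ) + 3) - Real.log ((t : ℝ) + 2) := by
    rw [← Real.log_div (by linarith) (by linarith)]
    refine le_trans (le_of_eq ?_) (Real.one_sub_inv_le_log_of_pos (by positivity))
    field_simp
    ring
  have e : 1 / Real.log ((t : ℝ) + 2) - 1 / Real.log ((t : ℝ) + 3)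
      = (Real.log ((t : ℝ) + 3) - Real.log ((t : ℝ) + 2))
        / (Real.log ((t : ℝ) + 2) * Real.log ((t : ℝ) + 3)) := by
    field_simp
  rw [e, ← mul_div_assoc, div_le_div_iff₀ (by positivity) (by positivity), one_mul]
  have h4 : 1 ≤ 2 * (Real.log ((t : ℝ) + 3) - Real.log ((t : ℝ) + 2)) * ((t : ℝ) + 2) := by
    have h5 : 1 ≤ 2 * (1 / ((t : ℝ) + 3)) * ((t : ℝ) + 2) := by
      rw [mul_one_div, div_mul_eq_mul_div, le_div_iff₀ (by linarith)]
      linarith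
    refine h5.trans ?_
    gcongr
  calc Real.log ((t : ℝ) + 2) * Real.log ((t : ℝ) + 3)
      ≤ Real.log ((t : ℝ) + 3) * Real.log ((t : ℝ) + 3) := by gcongr
    _ = 1 * Real.log ((t : ℝ) + 3) ^ 2 := by ring
    _ ≤ 2 * (Real.log ((t : ℝ) + 3) - Real.log ((t : ℝ) + 2)) * ((t : ℝ) + 2)
        * Real.log ((t : ℝ) + 3) ^ 2 := by gcongr
    _ = _ := by ring

theorem summable_schedule :
    Summable fun t : ℕ => 1 / (((t : ℝ) + 1) * Real.log ((t : ℝ) + 2) ^ 2) := by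
  -- Dropping the first term keeps log 1 = 0 out of the telescoping bound.
  rw [← summable_nat_add_iff 1]
  have h0 : ∀ t : ℕ, 0 ≤ 1 / (((t : ℝ) + 2) * Real.log ((t : ℝ) + 3) ^ 2) :=
    fun t => by positivity
  have hs : Summable fun t : ℕ => 1 / (((t : ℝ) + 2) * Real.log ((t : ℝ) + 3) ^ 2) := by
    refine summable_of_sum_range_le (c := 2 * (1 / Real.log 2)) h0 fun n => ?_
    have h1 : ∀ n : ℕ, ∑ t ∈ Finset.range n, 1 / (((t : ℝ) + 2) * Real.log ((t : ℝ) + 3) ^ 2)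
        ≤ 2 * (1 / Real.log 2 - 1 / Real.log ((n : ℝ) + 2)) := by
      intro n
      induction n with
      | zero => simp
      | succ n ih =>
        rw [Finset.sum_range_succ]
        have := one_div_mul_log_sq_le n
        push_cast
        rw [show (n : ℝ) + 1 + 2 = n + 3 by ring]
        linarith
    refine (h1 n).trans ?_
    have : 0 ≤ 1 / Real.log ((n : ℝ) + 2) := by
      have := Real.log_nonneg (by linarith [n.cast_nonneg (α := ℝ)] : (1 : ℝ) ≤ (n : ℝ) + 2)
      positivity
    linarith
  refine hs.congr fun t => ?_
  push_cast
  ring_nf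

theorem scheduleConst_pos : 0 < scheduleConst := by
  refine summable_schedule.tsum_pos (fun t => by positivity) 0 ?_
  have : 0 < Real.log 2 := Real.log_pos (by norm_num)
  simp only [Nat.cast_zero, zero_add, one_mul]
  positivity

theorem le_numSamples (n t : ℕ) : (n : ℝ) ≤ numSamples n t := by
  refine le_trans ?_ (Nat.le_ceil _)
  have := scheduleConst_pos
  exact le_add_of_nonneg_left (by positivity)

/-- The sample sizes of all stages are large enough for a union bound. -/
theorem sum_one_div_numSamples_le {n : ℕ} (hn : 0 < n) (T : ℕ) :
    ∑ t ∈ Finset.range T, 1 / (numSamples n t : ℝ) ≤ 2 / n := by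
  have hn' : (0 : ℝ) < n := by exact_mod_cast hn
  have hc := scheduleConst_pos
  have hle : ∀ t : ℕ, 1 / (numSamples n (t + 1) : ℝ)
      ≤ 1 / (scheduleConst * n) * (1 / (((t : ℝ) + 1) * Real.log ((t : ℝ) + 2) ^ 2)) := by
    intro t
    have hlog : 0 < Real.log ((t : ℝ) + 2) :=
      Real.log_pos (by linarith [t.cast_nonneg (α := ℝ)])
    rw [one_div_mul_one_div]
    refine one_div_le_one_div_of_le (by positivity) (le_trans ?_ (Nat.le_ceil _))
    push_cast
    rw [show (t : ℝ) + 1 + 1 = t + 2 by ring, ← mul_assoc]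
    have h1 : Real.log ((t : ℝ) + 2) ^ 2 ≤ (⌈Real.log ((t : ℝ) + 2) ^ 2⌉₊ : ℝ) := Nat.le_ceil _
    have h2 := mul_le_mul_of_nonneg_left h1
      (by positivity : 0 ≤ scheduleConst * n * ((t : ℝ) + 1))
    linarith
  -- Stage zero contributes at most 1/n, and all later stages together at most 1/n by the choice of
  -- `scheduleConst`.
  have h0 : 1 / (numSamples n 0 : ℝ) ≤ 1 / n :=
    one_div_le_one_div_of_le hn' (le_numSamples n 0)
  have hsum : ∀ T : ℕ, ∑ t ∈ Finset.range T, 1 / (numSamples n (t + 1) : ℝ) ≤ 1 / n := by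
    intro T
    refine (Finset.sum_le_sum fun t _ => hle t).trans ?_
    rw [← Finset.mul_sum]
    have h1 := summable_schedule.sum_le_tsum (Finset.range T) fun t _ => by positivity
    refine (mul_le_mul_of_nonneg_left h1 (by positivity)).trans (le_of_eq ?_)
    change 1 / (scheduleConst * n) * scheduleConst = 1 / n
    field_simp
  have e : (2 : ℝ) / n = 1 / n + 1 / n := by ring
  cases T with
  | zero => simpa using div_nonneg zero_le_two hn'.le
  | succ T =>
    rw [Finset.sum_range_succ', e]
    exact add_le_add (hsum T) h0

/-! ### Independence of fresh samples from earlier policies -/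

namespace TrainingRun

variable {Ω : Type*} {dx du : ℕ} {r : TrainingRun Ω dx du} {S : ControlSystem dx du}

/-- All sampled initial states, for training and for tests. -/
def sample (r : TrainingRun Ω dx du) : (ℕ × ℕ) ⊕ (ℕ × ℕ) → Ω → Vec dx :=
  fun j => Sum.elim (fun p : ℕ × ℕ => r.train p.1 p.2) (fun p : ℕ × ℕ => r.test p.1 p.2) j

/-- The stage of a sample. -/
def stage : (ℕ × ℕ) ⊕ (ℕ × ℕ) → ℕ := Sum.elim Prod.fst Prod.fst

/-- A stage uses its own samples, hence the strict inequality: only the policies of stages before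
`t` are independent of the samples of stage `t`. -/
theorem past_le_iSup_sample (r : TrainingRun Ω dx du) {s t : ℕ} (hst : s < t) :
    r.past s ≤ ⨆ j ∈ {j | stage j < t}, MeasurableSpace.comap (r.sample j) inferInstance := by
  refine iSup_le fun ⟨k, hk⟩ => iSup_le fun i => sup_le ?_ ?_
  · exact le_iSup₂_of_le (f := fun j (_ : j ∈ {j | stage j < t}) =>
      MeasurableSpace.comap (r.sample j) inferInstance) (Sum.inl (k, i)) (hk.trans_lt hst) le_rfl
  · exact le_iSup₂_of_le (f := fun j (_ : j ∈ {j | stage j < t}) =>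
      MeasurableSpace.comap (r.sample j) inferInstance) (Sum.inr (k, i)) (hk.trans_lt hst) le_rfl

theorem switchTime_le (r : TrainingRun Ω dx du) (S : ControlSystem dx du) (Z : Set (Vec dx))
    (T ℓ : ℕ) (ω : Ω) : r.switchTime S Z T ℓ ω ≤ T :=
  Nat.sInf_le (Or.inr rfl)

theorem exists_notMem_of_lt_switchTime {Z : Set (Vec dx)} {T ℓ : ℕ} {ω : Ω} {t : ℕ} (ht : 1 ≤ t)
    (h : t < r.switchTime S Z T ℓ ω) :
    ∃ i < ℓ, S.rollout (r.learned ω) (r.test t i ω) t ∉ S.tightO Z := by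
  by_contra! hcon
  exact Nat.notMem_of_lt_sInf h (Or.inl ⟨ht, hcon⟩)

/-- Below `T` the switching time is not the default value, so a test was really passed. -/
theorem switchTime_spec {Z : Set (Vec dx)} {T ℓ : ℕ} {ω : Ω} (h : r.switchTime S Z T ℓ ω < T) :
    1 ≤ r.switchTime S Z T ℓ ω ∧ ∀ i < ℓ, S.rollout (r.learned ω)
      (r.test (r.switchTime S Z T ℓ ω) i ω) (r.switchTime S Z T ℓ ω) ∈ S.tightO Z := by
  have hmem := Nat.sInf_mem (s := {t | 1 ≤ t ∧ ∀ i < ℓ,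
    S.rollout (r.learned ω) (r.test t i ω) t ∈ S.tightO Z} ∪ {T}) ⟨T, Or.inr rfl⟩
  rcases hmem with h1 | h1
  · exact h1
  · exact absurd h1 h.ne

variable [MeasurableSpace Ω] {μ : Measure Ω} {D : Measure (Vec dx)} {Z : Set (Vec dx)} {expert : Vec dx → Vec du}
  {models : Finset (Vec dx → Vec du)} {T n ℓ : ℕ}

theorem IsForwardSwitch.measurable_sample (h : r.IsForwardSwitch S μ D Z expert models T n ℓ)
    (j : (ℕ × ℕ) ⊕ (ℕ × ℕ)) : Measurable (r.sample j) := by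
  rcases j with j | j
  · exact h.train_measurable _ _
  · exact h.test_measurable _ _

theorem IsForwardSwitch.map_sample (h : r.IsForwardSwitch S μ D Z expert models T n ℓ)
    (j : (ℕ × ℕ) ⊕ (ℕ × ℕ)) : μ.map (r.sample j) = D := by
  rcases j with j | j
  · exact h.train_law _ _
  · exact h.test_law _ _

/-- The fresh samples of stage `t` rarely all lie in a small set, even if the set depends on the
policies of the earlier stages. -/
theorem IsForwardSwitch.measure_le_pow [IsProbabilityMeasure μ]
    (h : r.IsForwardSwitch S μ D Z expert models T n ℓ)
    {t : ℕ} (htT : t ≤ T) (I : Finset ((ℕ × ℕ) ⊕ (ℕ × ℕ))) (hI : ∀ j ∈ I, stage j = t)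
    (A : (ℕ → Vec dx → Vec du) → Set (Vec dx))
    (hA : ∀ p p', (∀ k < t, p k = p' k) → A p = A p') (c : ENNReal) (bad : Set Ω)
    (hbad : ∀ ω ∈ bad, (∀ s < t, r.policy s ω ∈ models) ∧ D (A (r.learned ω)) ≤ c ∧
      ∀ j ∈ I, r.sample j ω ∈ A (r.learned ω)) :
    μ bad ≤ c ^ I.card := by
  classical
  -- Only the first `t` policies matter and they range over a finite set, so conditioning on them is
  -- a finite sum; zero is a filler.
  let ext : (Fin t → models) → ℕ → Vec dx → Vec du := fun p s =>
    if hs : s < t then (p ⟨s, hs⟩ : Vec dx → Vec du) else 0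
  let E : (Fin t → models) → Set Ω := fun p => ⋂ s : Fin t, {ω | r.policy s ω = p s}
  -- The set `A` need not be measurable; its measurable hull has the same measure.
  let G : (Fin t → models) → Set Ω := fun p =>
    ⋂ j ∈ I, r.sample j ⁻¹' toMeasurable D (A (ext p))
  let m : (ℕ × ℕ) ⊕ (ℕ × ℕ) → MeasurableSpace Ω := fun j =>
    MeasurableSpace.comap (r.sample j) inferInstance
  have hm : ∀ j, m j ≤ ‹MeasurableSpace Ω› := fun j => (h.measurable_sample j).comap_le
  have hEm : ∀ p, MeasurableSet[⨆ j ∈ {j | stage j < t}, m j] (E p) := fun p =>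
    MeasurableSet.iInter fun s => r.past_le_iSup_sample s.2 _
      (h.nonanticipating s (s.2.trans_le htT) (p s) (p s).2)
  have hEm' : ∀ p, MeasurableSet (E p) := fun p => (iSup₂_le fun j _ => hm j) _ (hEm p)
  have hGm : ∀ p, MeasurableSet[⨆ j ∈ {j | stage j = t}, m j] (G p) := by
    intro p
    refine MeasurableSet.biInter I.countable_toSet fun j hj => ?_
    have h1 : m j ≤ ⨆ j ∈ {j | stage j = t}, m j :=
      le_iSup₂_of_le (f := fun j (_ : j ∈ {j | stage j = t}) => m j) j (hI j hj) le_rfl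
    exact h1 _ ⟨_, measurableSet_toMeasurable _ _, rfl⟩
  have hind : Indep (⨆ j ∈ {j | stage j < t}, m j) (⨆ j ∈ {j | stage j = t}, m j) μ := by
    refine indep_iSup_of_disjoint hm h.indep.iIndep ?_
    rw [Set.disjoint_left]
    intro j (hj : stage j < t) (hj' : stage j = t)
    exact hj.ne hj'
  have hGμ : ∀ p, D (A (ext p)) ≤ c → μ (G p) ≤ c ^ I.card := by
    intro p hp
    have h1 := h.indep.measure_inter_preimage_eq_mul I
      (sets := fun _ => toMeasurable D (A (ext p))) fun _ _ => measurableSet_toMeasurable _ _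
    refine (le_of_eq h1).trans (le_of_eq_of_le (b := D (A (ext p)) ^ I.card) ?_ ?_)
    · rw [Finset.prod_eq_pow_card]
      intro j _
      rw [← measure_toMeasurable (A (ext p)), ← h.map_sample j,
        Measure.map_apply (h.measurable_sample j) (by
          rw [h.map_sample j]
          exact measurableSet_toMeasurable _ _)]
      rw [h.map_sample j]
      rfl
    · exact pow_le_pow_left' hp _
  have hsub : bad ⊆ ⋃ p ∈ Finset.univ.filter (fun p => D (A (ext p)) ≤ c), E p ∩ G p := by
    intro ω hω
    obtain ⟨h1, h2, h3⟩ := hbad ω hω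
    let p : Fin t → models := fun s => ⟨r.policy s ω, h1 s s.2⟩
    have hp : A (r.learned ω) = A (ext p) := hA _ _ fun k hk => by
      simp only [ext, p, dif_pos hk, learned]
    rw [hp] at h2 h3
    simp only [Set.mem_iUnion]
    refine ⟨p, Finset.mem_filter.2 ⟨Finset.mem_univ _, h2⟩, Set.mem_iInter.2 fun s => rfl, ?_⟩
    exact Set.mem_iInter₂.2 fun j hj => subset_toMeasurable _ _ (h3 j hj)
  -- The events `E p` are disjoint, so summing over all policy histories costs no factor for their
  -- number.
  calc μ bad ≤ ∑ p ∈ Finset.univ.filter (fun p => D (A (ext p)) ≤ c), μ (E p ∩ G p) :=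
        (measure_mono hsub).trans (measure_biUnion_finset_le _ _)
    _ ≤ ∑ p ∈ Finset.univ.filter (fun p => D (A (ext p)) ≤ c), μ (E p) * c ^ I.card := by
        refine Finset.sum_le_sum fun p hp => ?_
        rw [(Indep_iff _ _ _).1 hind _ _ (hEm p) (hGm p)]
        exact mul_le_mul_right (hGμ p (Finset.mem_filter.1 hp).2) _
    _ = (∑ p ∈ Finset.univ.filter (fun p => D (A (ext p)) ≤ c), μ (E p)) * c ^ I.card :=
        (Finset.sum_mul _ _ _).symm
    _ ≤ 1 * c ^ I.card := by
        refine mul_le_mul_left ?_ _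
        refine (sum_measure_le_measure_univ (fun p _ => (hEm' p).nullMeasurableSet) ?_).trans
          prob_le_one
        intro p _ p' _ hpp'
        refine Disjoint.aedisjoint ?_
        rw [Set.disjoint_left]
        intro ω hω hω'
        apply hpp'
        funext s
        exact Subtype.ext ((Set.mem_iInter.1 hω s).symm.trans (Set.mem_iInter.1 hω' s))
    _ = c ^ I.card := one_mul _

end TrainingRun

/-! ### From imitation error to arrival in the terminal set -/

namespace ControlSystem

variable {dx du : ℕ}

theorem measurable_rollout (S : ControlSystem dx du) {p : ℕ → Vec dx → Vec du} {t : ℕ}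
    (hp : ∀ k < t, Measurable (p k)) : Measurable fun x => S.rollout p x t := by
  induction t with
  | zero => exact measurable_id
  | succ t ih =>
    have h1 := ih fun k hk => hp k (hk.trans t.lt_succ_self)
    exact ((continuous_mv S.A).measurable.comp h1).add
      ((continuous_mv S.B).measurable.comp ((hp t t.lt_succ_self).comp h1))

/-- If the inputs are small, all loops in the class are close to robust MPC. -/
theorem IsRobustMPC.close_of_inputBound_le {S : ControlSystem dx du} {Z : Set (Vec dx)} {ε : ℝ}
    (hS : S.Standing) (hZ : S.IsDisturbanceInvariant (closedBall 0 ε) Z)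
    {expert : Vec dx → Vec du} (he : S.IsRobustMPC Z expert)
    (heU : ∀ x ∈ S.X, expert x ∈ S.U) (hsmall : 2 * (opNorm S.B * S.inputBound) ≤ ε)
    {p : ℕ → Vec dx → Vec du} {s : ℕ} (hp : ∀ t < s, ∀ x ∈ S.X, p t x ∈ S.U)
    {x : Vec dx} (hx : x ∈ S.feasible Z) :
    ∀ t < s, ‖expert (S.rollout p x t) - p t (S.rollout p x t)‖ ≤ ε / opNorm S.B := by
  intro t
  induction t using Nat.strong_induction_on with
  | _ t ih =>
    intro ht
    -- Inputs are known to lie in `S.U` only at states in `S.X`, which the closeness at all earlier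
    -- times provides; hence the strong induction.
    have hX := (he.rollout_mem_domain hS hZ hx (fun k hk => ih k hk (hk.trans ht)) t le_rfl).2
    rw [le_div_iff₀ (opNorm_pos hS.B_ne_zero)]
    have h1 := hS.norm_le_inputBound (heU _ hX)
    have h2 := hS.norm_le_inputBound (hp t ht _ hX)
    have h3 := norm_sub_le (expert (S.rollout p x t)) (p t (S.rollout p x t))
    have h4 := mul_le_mul_of_nonneg_right (h3.trans (add_le_add h1 h2)) (opNorm_nonneg S.B)
    linarith

/-- A loop which stays close to robust MPC up to the reach time arrives in the terminal set. -/
theorem IsReachTime.ae_mem_tightO {S : ControlSystem dx du} {Z : Set (Vec dx)} {ε : ℝ}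
    (hS : S.Standing) (hε : 0 ≤ ε) {D : Measure (Vec dx)} {expert : Vec dx → Vec du} {τ : ℕ}
    (hτ : S.IsReachTime Z ε D expert τ) (p : ℕ → Vec dx → Vec du) :
    ∀ᵐ x ∂D, (∀ t < τ, ‖expert (S.rollout p x t) - p t (S.rollout p x t)‖ ≤ ε / opNorm S.B) →
      S.rollout p x τ ∈ S.tightO Z := by
  filter_upwards [hτ.2] with x hx hclose
  -- The imitation error mapped by `B` is the disturbance; after `τ` any admissible choice would do.
  set w : ℕ → Vec dx := fun t => if t < τ then
    mv S.B (p t (S.rollout p x t) - expert (S.rollout p x t)) else 0 with hw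
  have hwε : ∀ t, w t ∈ closedBall (0 : Vec dx) ε := by
    intro t
    rw [mem_closedBall, dist_zero_right]
    simp only [hw]
    split_ifs with ht
    · refine norm_mv_B_le hS ?_
      rw [norm_sub_rev]
      exact hclose t ht
    · simpa using hε
  have key : ∀ t ≤ τ, S.disturbed expert w x t = S.rollout p x t := by
    intro t
    induction t with
    | zero => exact fun _ => rfl
    | succ t ih =>
      intro ht
      rw [disturbed, ih (Nat.le_of_succ_le ht), rollout]
      simp only [hw, if_pos (Nat.lt_of_succ_le ht)]
      exact (step_eq_add_mv S _ _ _).symm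
  rw [← key τ le_rfl]
  exact hx w hwε

end ControlSystem

/-! ### Imitation learning in one stage -/

namespace TrainingRun

variable {Ω : Type*} {dx du : ℕ} {r : TrainingRun Ω dx du} {S : ControlSystem dx du}
  [MeasurableSpace Ω] {μ : Measure Ω} {D : Measure (Vec dx)} {Z : Set (Vec dx)}
  {expert : Vec dx → Vec du} {models : Finset (Vec dx → Vec du)} {T n ℓ : ℕ}

/-- In the realizable case an empirical risk minimizer agrees with the expert on the samples. -/
theorem IsForwardSwitch.policy_eq_on_samples (h : r.IsForwardSwitch S μ D Z expert models T n ℓ)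
    (he : expert ∈ models) {ω : Ω} {t : ℕ} (ht : t < r.switchTime S Z T ℓ ω) {i : ℕ}
    (hi : i < numSamples n t) :
    expert (S.rollout (r.learned ω) (r.train t i ω) t)
      = r.policy t ω (S.rollout (r.learned ω) (r.train t i ω) t) := by
  have h1 := (h.erm ω t ht).2 expert he
  have h2 : r.empLoss S expert n t ω expert = 0 := by simp [empLoss]
  rw [h2, empLoss] at h1
  have hpos : 0 < 1 / (numSamples n t : ℝ) := by
    have : 0 < numSamples n t := (Nat.zero_le i).trans_lt hi
    positivity
  have h3 := nonpos_of_mul_nonpos_right h1 hpos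
  have h4 := Finset.single_le_sum (f := fun i =>
    ‖expert (S.rollout (r.learned ω) (r.train t i ω) t)
      - r.policy t ω (S.rollout (r.learned ω) (r.train t i ω) t)‖)
    (fun _ _ => norm_nonneg _) (Finset.mem_range.2 hi)
  exact sub_eq_zero.1 (norm_le_zero_iff.1 (h4.trans h3))

/-- One stage of imitation learning: the learned policy disagrees with the expert on a set of small
probability. -/
theorem IsForwardSwitch.measure_stage_le [IsProbabilityMeasure μ] [IsProbabilityMeasure D]
    (h : r.IsForwardSwitch S μ D Z expert models T n ℓ) (he : expert ∈ models)
    (hmeas : ∀ π ∈ models, Measurable π) {t : ℕ} (htT : t < T) (q : ℝ) :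
    μ {ω | t < r.switchTime S Z T ℓ ω ∧ ENNReal.ofReal q
      < D {x | expert (S.rollout (r.learned ω) x t) ≠ r.policy t ω (S.rollout (r.learned ω) x t)}}
      ≤ models.card * ENNReal.ofReal (Real.exp (-(q * numSamples n t))) := by
  classical
  let A : (Vec dx → Vec du) → (ℕ → Vec dx → Vec du) → Set (Vec dx) := fun π p =>
    {x | expert (S.rollout p x t) = π (S.rollout p x t)}
  let I : Finset ((ℕ × ℕ) ⊕ (ℕ × ℕ)) :=
    (Finset.range (numSamples n t)).image fun i => Sum.inl (t, i)
  have hIcard : I.card = numSamples n t := by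
    rw [Finset.card_image_of_injective _ fun i j hij => by simpa using hij, Finset.card_range]
  -- The learned policy depends on the samples of its own stage, so independence applies only to a
  -- fixed candidate `π`; a union over the class follows.
  let bad : (Vec dx → Vec du) → Set Ω := fun π => {ω | t < r.switchTime S Z T ℓ ω ∧
    D (A π (r.learned ω)) ≤ ENNReal.ofReal (Real.exp (-q)) ∧
    ∀ i < numSamples n t, r.train t i ω ∈ A π (r.learned ω)}
  have hbad : ∀ π, μ (bad π) ≤ ENNReal.ofReal (Real.exp (-(q * numSamples n t))) := by
    intro π
    have h1 := h.measure_le_pow htT.le I (fun j hj => by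
        obtain ⟨i, -, rfl⟩ := Finset.mem_image.1 hj
        rfl) (A π) (fun p p' hpp' => by
        ext x
        simp only [A, Set.mem_ofPred_eq, S.rollout_congr x hpp'])
      (ENNReal.ofReal (Real.exp (-q))) (bad π) (fun ω hω => ⟨fun s hs =>
        (h.erm ω s (hs.trans hω.1)).1, hω.2.1, fun j hj => by
          obtain ⟨i, hi, rfl⟩ := Finset.mem_image.1 hj
          exact hω.2.2 i (Finset.mem_range.1 hi)⟩)
    refine h1.trans (le_of_eq ?_)
    rw [hIcard, ← ENNReal.ofReal_pow (Real.exp_pos _).le, ← Real.exp_nat_mul]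
    congr 2
    ring
  have hsub : {ω | t < r.switchTime S Z T ℓ ω ∧ ENNReal.ofReal q
      < D {x | expert (S.rollout (r.learned ω) x t) ≠ r.policy t ω (S.rollout (r.learned ω) x t)}}
      ⊆ ⋃ π ∈ models, bad π := by
    rintro ω ⟨hω, hD⟩
    have hpol := (h.erm ω t hω).1
    simp only [Set.mem_iUnion]
    refine ⟨r.policy t ω, hpol, hω, ?_, fun i hi => h.policy_eq_on_samples he hω hi⟩
    have hroll := S.measurable_rollout (p := r.learned ω) (t := t) fun k hk =>
      hmeas _ (h.erm ω k (hk.trans hω)).1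
    have hAm : MeasurableSet (A (r.policy t ω) (r.learned ω)) :=
      measurableSet_eq_fun ((hmeas _ he).comp hroll) ((hmeas _ hpol).comp hroll)
    have hcompl : {x | expert (S.rollout (r.learned ω) x t)
        ≠ r.policy t ω (S.rollout (r.learned ω) x t)} = (A (r.policy t ω) (r.learned ω))ᶜ := rfl
    rw [hcompl, prob_compl_eq_one_sub hAm] at hD
    have h2 : D (A (r.policy t ω) (r.learned ω)) ≤ 1 - ENNReal.ofReal q := by
      have h3 := lt_tsub_iff_left.1 hD
      exact ENNReal.le_sub_of_add_le_right ENNReal.ofReal_ne_top h3.le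
    refine h2.trans ?_
    rw [← ENNReal.ofReal_one]
    rcases le_total 0 q with hq | hq
    · rw [← ENNReal.ofReal_sub _ hq]
      exact ENNReal.ofReal_le_ofReal (Real.one_sub_le_exp_neg q)
    · refine tsub_le_self.trans (ENNReal.ofReal_le_ofReal ?_)
      exact Real.one_le_exp (by linarith)
  calc _ ≤ ∑ π ∈ models, μ (bad π) := (measure_mono hsub).trans (measure_biUnion_finset_le _ _)
    _ ≤ ∑ π ∈ models, ENNReal.ofReal (Real.exp (-(q * numSamples n t))) :=
        Finset.sum_le_sum fun π _ => hbad π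
    _ = _ := by rw [Finset.sum_const, nsmul_eq_mul]

end TrainingRun

/-! ### Probability of the training event -/

namespace TrainingRun

variable {Ω : Type*} {dx du : ℕ} {r : TrainingRun Ω dx du} {S : ControlSystem dx du}
  [MeasurableSpace Ω] {μ : Measure Ω} {D : Measure (Vec dx)} {Z : Set (Vec dx)}
  {expert : Vec dx → Vec du} {models : Finset (Vec dx → Vec du)} {T n ℓ : ℕ} {ε δ : ℝ}

/-- Outside of a small training event, the learned loop is close to robust MPC with high
probability. -/
theorem IsForwardSwitch.exists_close [IsProbabilityMeasure μ] [IsProbabilityMeasure D]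
    (h : r.IsForwardSwitch S μ D Z expert models T n ℓ) (hS : S.Standing)
    (hZ : S.IsDisturbanceInvariant (closedBall 0 ε) Z) (hexp : S.IsRobustMPC Z expert)
    (he : expert ∈ models) (hmodels : ∀ π ∈ models, Measurable π ∧ ∀ x ∈ S.X, π x ∈ S.U)
    (hD : ∀ᵐ x ∂D, x ∈ S.feasible Z) (hε : 0 < ε) (hδ : 0 < δ) (hδ1 : δ < 1) (hT : 1 ≤ T)
    (hℓ : 1 ≤ ℓ) (hn : 14 * ℓ * opNorm S.B * S.inputBound *
      Real.log (2 * T * ℓ * models.card / δ) / (ε * δ) ≤ n) :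
    ∃ (bad : Set Ω) (q : ENNReal), μ bad ≤ ENNReal.ofReal δ ∧ ℓ * q ≤ ENNReal.ofReal δ ∧
      q ≤ ENNReal.ofReal δ ∧ ∀ ω ∉ bad, ∀ s ≤ r.switchTime S Z T ℓ ω,
        D {x | ¬∀ t < s, ‖expert (S.rollout (r.learned ω) x t)
          - r.policy t ω (S.rollout (r.learned ω) x t)‖ ≤ ε / opNorm S.B} ≤ q := by
  -- With inputs this small every loop in the class is close to the expert and nothing has to be
  -- learned. Otherwise ‖B‖B_u/ε exceeds 1/2 and the sample size bound becomes n ≥ 7ℓΛ/δ, without ε.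
  rcases le_or_gt (2 * (opNorm S.B * S.inputBound)) ε with hsmall | hlarge
  · refine ⟨∅, 0, by simp, by simp, by simp, fun ω _ s hs => le_of_eq ?_⟩
    refine ae_iff.1 ?_
    filter_upwards [hD] with x hx
    exact hexp.close_of_inputBound_le hS hZ (hmodels _ he).2 hsmall
      (fun t ht => (hmodels _ (h.erm ω t (ht.trans_le hs)).1).2) hx
  have hm : (1 : ℝ) ≤ models.card := by exact_mod_cast Finset.card_pos.2 ⟨_, he⟩
  have hT' : (1 : ℝ) ≤ T := by exact_mod_cast hT
  have hℓ' : (1 : ℝ) ≤ ℓ := by exact_mod_cast hℓ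
  have harg : 1 < 2 * (T : ℝ) * ℓ * models.card / δ := by
    rw [one_lt_div hδ]
    have h1 : 1 ≤ (T : ℝ) * ℓ * models.card :=
      one_le_mul_of_one_le_of_one_le (one_le_mul_of_one_le_of_one_le hT' hℓ') hm
    linarith
  obtain ⟨Λ, hΛ⟩ : ∃ v, v = Real.log (2 * T * ℓ * models.card / δ) := ⟨_, rfl⟩
  have hΛ0 : 0 < Λ := hΛ ▸ Real.log_pos harg
  have hexpΛ : Real.exp (-Λ) = δ / (2 * T * ℓ * models.card) := by
    rw [hΛ, Real.exp_neg, Real.exp_log (by linarith), inv_div]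
  have hn7 : 7 * ℓ * Λ / δ ≤ n := by
    refine le_trans ?_ hn
    rw [← hΛ, div_le_div_iff₀ hδ (by positivity)]
    have h1 := mul_le_mul_of_nonneg_right hlarge.le (by positivity : 0 ≤ 7 * ℓ * Λ * δ)
    linarith
  have hn0' : (0 : ℝ) < n := lt_of_lt_of_le (by positivity) hn7
  have hn0 : 0 < n := by exact_mod_cast hn0'
  have hnum : ∀ t, (0 : ℝ) < numSamples n t := fun t => hn0'.trans_le (le_numSamples n t)
  have hq : ℓ * (Λ * (2 / n)) ≤ δ := by
    rw [div_le_iff₀ hδ] at hn7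
    rw [← mul_assoc, ← mul_div_assoc, div_le_iff₀ hn0']
    have : 0 ≤ ℓ * Λ := by positivity
    linarith
  have hℓq : (ℓ : ENNReal) * ENNReal.ofReal (Λ * (2 / n)) ≤ ENNReal.ofReal δ := by
    rw [← ENNReal.ofReal_natCast, ← ENNReal.ofReal_mul (by positivity)]
    exact ENNReal.ofReal_le_ofReal hq
  -- Stage `t` tolerates disagreement Λ/n_t and fails with probability at most |Π| exp(-Λ) =
  -- δ/(2Tℓ). The tolerances sum to at most 2Λ/n ≤ δ/ℓ.
  refine ⟨⋃ t ∈ Finset.range T, {ω | t < r.switchTime S Z T ℓ ω ∧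
    ENNReal.ofReal (Λ / numSamples n t) < D {x | expert (S.rollout (r.learned ω) x t)
      ≠ r.policy t ω (S.rollout (r.learned ω) x t)}}, ENNReal.ofReal (Λ * (2 / n)), ?_, hℓq,
    ?_, ?_⟩
  · calc _ ≤ ∑ t ∈ Finset.range T, (models.card : ENNReal) * ENNReal.ofReal (Real.exp (-Λ)) := by
          refine (measure_biUnion_finset_le _ _).trans (Finset.sum_le_sum fun t ht => ?_)
          have h1 := h.measure_stage_le he (fun π hπ => (hmodels π hπ).1) (Finset.mem_range.1 ht)
            (Λ / numSamples n t)
          rwa [div_mul_cancel₀ _ (hnum t).ne'] at h1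
      _ = ENNReal.ofReal (T * (models.card * Real.exp (-Λ))) := by
          rw [Finset.sum_const, Finset.card_range, nsmul_eq_mul, ENNReal.ofReal_mul (by positivity),
            ENNReal.ofReal_mul (by positivity), ENNReal.ofReal_natCast, ENNReal.ofReal_natCast]
      _ ≤ ENNReal.ofReal δ := by
          refine ENNReal.ofReal_le_ofReal ?_
          rw [hexpΛ, ← mul_assoc, ← mul_div_assoc, div_le_iff₀ (by positivity)]
          have h1 : (T : ℝ) * models.card * δ * 1 ≤ T * models.card * δ * (2 * ℓ) :=
            mul_le_mul_of_nonneg_left (by linarith) (by positivity)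
          linarith
  · refine le_trans ?_ hℓq
    exact le_mul_of_one_le_left zero_le (by exact_mod_cast hℓ)
  · intro ω hω s hs
    simp only [Set.mem_iUnion, not_exists] at hω
    have hstage : ∀ t ∈ Finset.range s, D {x | expert (S.rollout (r.learned ω) x t)
        ≠ r.policy t ω (S.rollout (r.learned ω) x t)} ≤ ENNReal.ofReal (Λ / numSamples n t) := by
      intro t ht
      have ht' := (Finset.mem_range.1 ht).trans_le hs
      by_contra! hcon
      exact hω t (Finset.mem_range.2 (ht'.trans_le (r.switchTime_le S Z T ℓ ω))) ⟨ht', hcon⟩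
    have hsub : {x | ¬∀ t < s, ‖expert (S.rollout (r.learned ω) x t)
          - r.policy t ω (S.rollout (r.learned ω) x t)‖ ≤ ε / opNorm S.B} ⊆
        ⋃ t ∈ Finset.range s, {x | expert (S.rollout (r.learned ω) x t)
          ≠ r.policy t ω (S.rollout (r.learned ω) x t)} := by
      intro x hx
      have hx' : ¬∀ t < s, ‖expert (S.rollout (r.learned ω) x t)
        - r.policy t ω (S.rollout (r.learned ω) x t)‖ ≤ ε / opNorm S.B := hx
      push Not at hx'
      obtain ⟨t, ht, hlt⟩ := hx'
      simp only [Set.mem_iUnion]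
      refine ⟨t, Finset.mem_range.2 ht, fun heq => ?_⟩
      rw [heq, sub_self, norm_zero] at hlt
      exact absurd hlt (not_lt.2 (div_nonneg hε.le (opNorm_nonneg _)))
    calc _ ≤ ∑ t ∈ Finset.range s, ENNReal.ofReal (Λ / numSamples n t) :=
          (measure_mono hsub).trans ((measure_biUnion_finset_le _ _).trans
            (Finset.sum_le_sum hstage))
      _ = ENNReal.ofReal (∑ t ∈ Finset.range s, Λ / numSamples n t) :=
          (ENNReal.ofReal_sum_of_nonneg fun t _ => (div_pos hΛ0 (hnum t)).le).symm
      _ ≤ _ := by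
          refine ENNReal.ofReal_le_ofReal ?_
          have h1 := mul_le_mul_of_nonneg_left (sum_one_div_numSamples_le hn0 s) hΛ0.le
          rw [Finset.mul_sum] at h1
          simpa only [mul_one_div] using h1

/-- A test which is passed although the terminal set is missed with probability more than `δ`. -/
theorem IsForwardSwitch.measure_test_le [IsProbabilityMeasure μ]
    (h : r.IsForwardSwitch S μ D Z expert models T n ℓ) (hδ : 0 < δ) (hδ1 : δ < 1)
    (hT : 1 ≤ T) (hℓ : 10 * Real.log (T / δ) / δ ≤ ℓ) :
    μ (⋃ t ∈ Finset.range T, {ω | t ≤ r.switchTime S Z T ℓ ω ∧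
      D {x | S.rollout (r.learned ω) x t ∈ S.tightO Z} ≤ ENNReal.ofReal (1 - δ) ∧
      ∀ i < ℓ, S.rollout (r.learned ω) (r.test t i ω) t ∈ S.tightO Z}) ≤ ENNReal.ofReal δ := by
  classical
  have hT' : (1 : ℝ) ≤ T := by exact_mod_cast hT
  have hstage : ∀ t ∈ Finset.range T, μ {ω | t ≤ r.switchTime S Z T ℓ ω ∧
      D {x | S.rollout (r.learned ω) x t ∈ S.tightO Z} ≤ ENNReal.ofReal (1 - δ) ∧
      ∀ i < ℓ, S.rollout (r.learned ω) (r.test t i ω) t ∈ S.tightO Z}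
      ≤ ENNReal.ofReal (δ / T) := by
    intro t ht
    let I : Finset ((ℕ × ℕ) ⊕ (ℕ × ℕ)) := (Finset.range ℓ).image fun i => Sum.inr (t, i)
    have hIcard : I.card = ℓ := by
      rw [Finset.card_image_of_injective _ fun i j hij => by simpa using hij, Finset.card_range]
    have h1 := h.measure_le_pow (Finset.mem_range.1 ht).le I (fun j hj => by
        obtain ⟨i, -, rfl⟩ := Finset.mem_image.1 hj
        rfl) (fun p => {x | S.rollout p x t ∈ S.tightO Z}) (fun p p' hpp' => by
        ext x
        simp only [Set.mem_ofPred_eq, S.rollout_congr x hpp']) (ENNReal.ofReal (1 - δ)) _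
      (fun ω (hω : ω ∈ {ω | t ≤ r.switchTime S Z T ℓ ω ∧
        D {x | S.rollout (r.learned ω) x t ∈ S.tightO Z} ≤ ENNReal.ofReal (1 - δ) ∧
        ∀ i < ℓ, S.rollout (r.learned ω) (r.test t i ω) t ∈ S.tightO Z}) =>
        ⟨fun s hs => (h.erm ω s (hs.trans_le hω.1)).1, hω.2.1, fun j hj => by
          obtain ⟨i, hi, rfl⟩ := Finset.mem_image.1 hj
          exact hω.2.2 i (Finset.mem_range.1 hi)⟩)
    refine h1.trans ?_
    rw [hIcard, ← ENNReal.ofReal_pow (by linarith)]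
    refine ENNReal.ofReal_le_ofReal ?_
    -- Since (1 - δ)^ℓ ≤ exp(-δℓ), this already brings each stage below δ/T.
    have hle : Real.log (T / δ) ≤ δ * ℓ := by
      rw [div_le_iff₀ hδ] at hℓ
      have : 0 ≤ Real.log (T / δ) := Real.log_nonneg (by rw [le_div_iff₀ hδ]; linarith)
      linarith
    calc (1 - δ) ^ ℓ ≤ Real.exp (-δ) ^ ℓ :=
          pow_le_pow_left₀ (by linarith) (Real.one_sub_le_exp_neg δ) ℓ
      _ = Real.exp (-(δ * ℓ)) := by
          rw [← Real.exp_nat_mul]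
          congr 1
          ring
      _ ≤ Real.exp (-Real.log (T / δ)) := Real.exp_le_exp.2 (neg_le_neg hle)
      _ = δ / T := by rw [Real.exp_neg, Real.exp_log (by positivity), inv_div]
  refine (measure_biUnion_finset_le _ _).trans ((Finset.sum_le_sum hstage).trans (le_of_eq ?_))
  rw [Finset.sum_const, Finset.card_range, nsmul_eq_mul, ← ENNReal.ofReal_natCast,
    ← ENNReal.ofReal_mul (by positivity), mul_div_cancel₀ _ (by positivity)]

/-- The tests of time `t` rarely fail if the terminal set is missed with small probability. -/
theorem IsForwardSwitch.measure_fail_le [IsProbabilityMeasure μ]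
    (h : r.IsForwardSwitch S μ D Z expert models T n ℓ) {t : ℕ} (htT : t ≤ T) (q : ENNReal) :
    μ {ω | t ≤ r.switchTime S Z T ℓ ω ∧ D {x | S.rollout (r.learned ω) x t ∉ S.tightO Z} ≤ q ∧
      ∃ i < ℓ, S.rollout (r.learned ω) (r.test t i ω) t ∉ S.tightO Z} ≤ ℓ * q := by
  -- A single fresh sample, so the power is one; the union over the tests supplies the factor ℓ.
  have hi : ∀ i, μ {ω | t ≤ r.switchTime S Z T ℓ ω ∧
      D {x | S.rollout (r.learned ω) x t ∉ S.tightO Z} ≤ q ∧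
      S.rollout (r.learned ω) (r.test t i ω) t ∉ S.tightO Z} ≤ q := by
    intro i
    have h1 := h.measure_le_pow htT {Sum.inr (t, i)} (fun j hj => by
        obtain rfl := Finset.mem_singleton.1 hj
        rfl) (fun p => {x | S.rollout p x t ∉ S.tightO Z}) (fun p p' hpp' => by
        ext x
        simp only [Set.mem_ofPred_eq, S.rollout_congr x hpp']) q _
      (fun ω (hω : ω ∈ {ω | t ≤ r.switchTime S Z T ℓ ω ∧
        D {x | S.rollout (r.learned ω) x t ∉ S.tightO Z} ≤ q ∧
        S.rollout (r.learned ω) (r.test t i ω) t ∉ S.tightO Z}) =>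
        ⟨fun s hs => (h.erm ω s (hs.trans_le hω.1)).1, hω.2.1, fun j hj => by
          obtain rfl := Finset.mem_singleton.1 hj
          exact hω.2.2⟩)
    simpa using h1
  have hsub : {ω | t ≤ r.switchTime S Z T ℓ ω ∧
      D {x | S.rollout (r.learned ω) x t ∉ S.tightO Z} ≤ q ∧
      ∃ i < ℓ, S.rollout (r.learned ω) (r.test t i ω) t ∉ S.tightO Z} ⊆
      ⋃ i ∈ Finset.range ℓ, {ω | t ≤ r.switchTime S Z T ℓ ω ∧
      D {x | S.rollout (r.learned ω) x t ∉ S.tightO Z} ≤ q ∧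
      S.rollout (r.learned ω) (r.test t i ω) t ∉ S.tightO Z} := by
    rintro ω ⟨h1, h2, i, hi, h3⟩
    simp only [Set.mem_iUnion]
    exact ⟨i, Finset.mem_range.2 hi, h1, h2, h3⟩
  refine (measure_mono hsub).trans ((measure_biUnion_finset_le _ _).trans
    ((Finset.sum_le_sum fun i _ => hi i).trans (le_of_eq ?_)))
  rw [Finset.sum_const, Finset.card_range, nsmul_eq_mul]

theorem ofReal_one_sub_le_of_compl {α : Type*} [MeasurableSpace α] {ν : Measure α}
    [IsProbabilityMeasure ν] {s : Set α} {δ : ℝ} (hδ : 0 ≤ δ) (h : ν sᶜ ≤ ENNReal.ofReal δ) :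
    ENNReal.ofReal (1 - δ) ≤ ν s := by
  rw [ENNReal.ofReal_sub _ hδ, ENNReal.ofReal_one, tsub_le_iff_right]
  calc (1 : ENNReal) = ν (s ∪ sᶜ) := by rw [Set.union_compl_self, measure_univ]
    _ ≤ ν s + ν sᶜ := measure_union_le _ _
    _ ≤ ν s + ENNReal.ofReal δ := by gcongr

/-- The training event has high probability. -/
theorem IsForwardSwitch.measure_goodEvent [IsProbabilityMeasure μ] [IsProbabilityMeasure D]
    (h : r.IsForwardSwitch S μ D Z expert models T n ℓ) (hS : S.Standing)
    (hZ : S.IsDisturbanceInvariant (closedBall 0 ε) Z) (hexp : S.IsRobustMPC Z expert)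
    (he : expert ∈ models) (hmodels : ∀ π ∈ models, Measurable π ∧ ∀ x ∈ S.X, π x ∈ S.U)
    (hD : ∀ᵐ x ∂D, x ∈ S.feasible Z) (hε : 0 < ε) (hδ : 0 < δ) (hδ1 : δ < 1) {τ : ℕ}
    (hτ : S.IsReachTime Z ε D expert τ) (hτT : τ ≤ T) (hℓ : 10 * Real.log (T / δ) / δ ≤ ℓ)
    (hn : 14 * ℓ * opNorm S.B * S.inputBound *
      Real.log (2 * T * ℓ * models.card / δ) / (ε * δ) ≤ n) :
    ENNReal.ofReal (1 - 3 * δ) ≤ μ (r.goodEvent S D Z ε δ expert T ℓ τ) := by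
  have hT : 1 ≤ T := hτ.1.trans hτT
  have hT' : (1 : ℝ) ≤ T := by exact_mod_cast hT
  have hℓ1 : 1 ≤ ℓ := by
    have h1 : 0 < Real.log (T / δ) := Real.log_pos (by rw [one_lt_div hδ]; linarith)
    have h2 : (0 : ℝ) < ℓ := lt_of_lt_of_le (by positivity) hℓ
    exact_mod_cast h2
  obtain ⟨bad₁, q, hbad₁, hℓq, hqδ, hclose⟩ :=
    h.exists_close hS hZ hexp he hmodels hD hε hδ hδ1 hT hℓ1 hn
  have hbad₂ := h.measure_test_le hδ hδ1 hT hℓ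
  have hbad₃ := (h.measure_fail_le hτT q).trans hℓq
  set bad₂ := ⋃ t ∈ Finset.range T, {ω | t ≤ r.switchTime S Z T ℓ ω ∧
      D {x | S.rollout (r.learned ω) x t ∈ S.tightO Z} ≤ ENNReal.ofReal (1 - δ) ∧
      ∀ i < ℓ, S.rollout (r.learned ω) (r.test t i ω) t ∈ S.tightO Z} with hbad₂def
  set bad₃ := {ω | τ ≤ r.switchTime S Z T ℓ ω ∧
      D {x | S.rollout (r.learned ω) x τ ∉ S.tightO Z} ≤ q ∧
      ∃ i < ℓ, S.rollout (r.learned ω) (r.test τ i ω) τ ∉ S.tightO Z} with hbad₃def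
  refine ofReal_one_sub_le_of_compl (by positivity) ?_
  have hsub : (r.goodEvent S D Z ε δ expert T ℓ τ)ᶜ ⊆ bad₁ ∪ bad₂ ∪ bad₃ := by
    intro ω hω
    by_contra hcon
    simp only [Set.mem_union, not_or] at hcon
    obtain ⟨⟨h1, h2⟩, h3⟩ := hcon
    apply hω
    -- Up to the switching time closeness holds outside probability `q`, and a close trajectory is a
    -- disturbed robust MPC loop, which has arrived at time `τ`.
    have hmiss : τ ≤ r.switchTime S Z T ℓ ω →
        D {x | S.rollout (r.learned ω) x τ ∉ S.tightO Z} ≤ q := by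
      intro hle
      refine (measure_mono_ae ?_).trans (hclose ω h1 τ hle)
      filter_upwards [hτ.ae_mem_tightO hS hε.le (r.learned ω)] with x hx hx' hall
      exact hx' (hx hall)
    have hle : r.switchTime S Z T ℓ ω ≤ τ := by
      by_contra! hlt
      exact h3 ⟨hlt.le, hmiss hlt.le, exists_notMem_of_lt_switchTime hτ.1 hlt⟩
    refine ⟨hle, ?_, ?_⟩
    -- At `τ` itself the switch may come from the default value `T` without a passed test, so
    -- arrival is taken from `hmiss`. Before `τ` a test was passed, and outside `bad₂` this
    -- certifies arrival.
    · rcases eq_or_lt_of_le hle with heq | hlt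
      · refine ofReal_one_sub_le_of_compl hδ.le (le_trans ?_ ((hmiss heq.ge).trans hqδ))
        rw [reachEvent, heq]
        rfl
      · by_contra! hcon
        refine h2 ?_
        simp only [hbad₂def, Set.mem_iUnion]
        exact ⟨_, Finset.mem_range.2 (hlt.trans_le hτT), le_rfl, hcon.le,
          (switchTime_spec (hlt.trans_le hτT)).2⟩
    · exact ofReal_one_sub_le_of_compl hδ.le ((hclose ω h1 _ le_rfl).trans hqδ)
  calc _ ≤ μ bad₁ + μ bad₂ + μ bad₃ :=
        (measure_mono hsub).trans ((measure_union_le _ _).trans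
          (add_le_add (measure_union_le _ _) le_rfl))
    _ ≤ ENNReal.ofReal δ + ENNReal.ofReal δ + ENNReal.ofReal δ := by gcongr
    _ = ENNReal.ofReal (3 * δ) := by
        rw [← ENNReal.ofReal_add hδ.le hδ.le, ← ENNReal.ofReal_add (by positivity) hδ.le]
        congr 1
        ring

end TrainingRun

/-! ### The theorem -/

theorem theorem3 {dx du : ℕ} (S : ControlSystem dx du) (hS : S.Standing)
    (ρ σ b : ℝ) (hρ0 : 0 < ρ) (hρ1 : ρ < 1) (hσ : 0 < σ)
    (hdecay : ∀ k : ℕ, opNorm (S.AK ^ k) ≤ σ * ρ ^ k) :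
    ∃ C : ℝ, 0 < C ∧
      ∀ (ε δ : ℝ), 0 < ε → ε < 1 → 0 < δ → δ < 1 →
      ∀ (Z : Set (Vec dx)), S.IsDisturbanceInvariant (closedBall 0 ε) Z →
        Z ⊆ closedBall 0 (σ / (1 - ρ) * ε) →
      ∀ (piRef : Vec dx → Vec du), S.IsTightMPC Z piRef →
      ∀ (expert : Vec dx → Vec du), S.IsRobustMPC Z expert →
      ∀ (D : Measure (Vec dx)) [IsProbabilityMeasure D],
        (∀ᵐ x ∂D, x ∈ S.feasible Z ∧ ‖x‖ ≤ b) →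
      ∀ (models : Finset (Vec dx → Vec du)), expert ∈ models →
        (∀ π ∈ models, Measurable π ∧ ∀ x ∈ S.X, π x ∈ S.U) →
      ∀ (τ : ℕ), S.IsReachTime Z ε D expert τ →
      ∀ (T n ℓ : ℕ), 10 * Real.log (T / δ) / δ ≤ ℓ →
        14 * ℓ * opNorm S.B * S.inputBound * Real.log (2 * T * ℓ * models.card / δ) / (ε * δ) ≤ n →
      ∀ {Ω : Type*} [MeasurableSpace Ω] (μ : Measure Ω) [IsProbabilityMeasure μ]
        (r : TrainingRun Ω dx du), r.IsForwardSwitch S μ D Z expert models T n ℓ →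
        (τ ≤ T → ENNReal.ofReal (1 - 3 * δ) ≤ μ (r.goodEvent S D Z ε δ expert T ℓ τ)) ∧
        ∀ ω ∈ r.goodEvent S D Z ε δ expert T ℓ τ,
        ∀ x₀ ∈ S.feasible Z, ‖x₀‖ ≤ b →
          x₀ ∈ r.reachEvent S Z T ℓ ω → x₀ ∈ r.closeEvent S Z ε expert T ℓ ω →
          S.cost (r.output S Z T ℓ ω) T x₀ - S.cost (fun _ => piRef) T x₀ ≤ C * τ * ε := by
  obtain ⟨C, hC, hmain⟩ := hS.exists_regret_bound hρ0 hρ1 hσ hdecay b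
  -- The regret bound has s + 1 with s ≤ τ, and τ ≥ 1 gives s + 1 ≤ 2τ.
  refine ⟨2 * C, by positivity, ?_⟩
  intro ε δ hε hε1 hδ hδ1 Z hZ hZκ piRef href expert hexp D _ hD models he hmodels τ hτ T n ℓ hℓ hn
    Ω _ μ _ r hr
  refine ⟨fun hτT => hr.measure_goodEvent hS hZ hexp he hmodels (hD.mono fun x hx => hx.1) hε hδ
    hδ1 hτ hτT hℓ hn, ?_⟩
  intro ω hω x₀ hx₀ hb hreach hclose
  have hsτ : r.switchTime S Z T ℓ ω ≤ τ := hω.1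
  refine (hmain ε hε hε1 Z hZ hZκ piRef href expert hexp (r.learned ω)
    (r.switchTime S Z T ℓ ω) T x₀ hx₀ hb hreach hclose).trans ?_
  have h1 : (r.switchTime S Z T ℓ ω : ℝ) ≤ τ := by exact_mod_cast hsτ
  have h2 : (1 : ℝ) ≤ τ := by exact_mod_cast hτ.1
  refine mul_le_mul_of_nonneg_right ?_ hε.le
  have h3 := mul_le_mul_of_nonneg_left (by linarith : (r.switchTime S Z T ℓ ω : ℝ) + 1 ≤ 2 * τ) hC.le
  linarith
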